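/- All bornological vector spaces are complex, convex and complete; $\hat\otimes$ is the completed bornological tensor product, and $M(A)$ denotes the algebra of (bounded, two-sided) multipliers of a bornological algebra $A$. A homomorphism $f\colon A\to M(B)$ is essential if it induces isomorphisms $A\hat\otimes_A B\cong B\cong B\hat\otimes_A A$; it then extends canonically to $M(A)\to M(B)$, and the extension is denoted by the same symbol. Let $H$ be a bornological quantum group: a nonzero essential bornological algebra ($H\hat\otimes_H H\cong H$) with the approximation property, together with a comultiplication, i.e. a coassociative essential homomorphism $\Delta\colon H\to M(H\hat\otimes H)$, all of whose Galois maps $$f\otimes g\mapsto \Delta(f)(g\otimes 1),\quad \Delta(f)(1\otimes g),\quad (f\otimes 1)\Delta(g),\quad (1\otimes f)\Delta(g)$$ are bornological isomorphisms of $H\hat\otimes H$, denoted $\gamma_l,\gamma_r,\rho_l,\rho_r$ respectively, and with a faithful bounded functional $\phi\colon H\to\mathbb C$ that is left invariant, $(\mathrm{id}\hat\otimes\phi)\Delta(f)=\phi(f)1$ for all $f\in H$. Here, for a bounded functional $\omega$, the multipliers $(\mathrm{id}\hat\otimes\omega)\Delta(f)$ and $(\omega\hat\otimes\mathrm{id})\Delta(f)$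 of $H$ are defined by $$(\mathrm{id}\hat\otimes\omega)\Delta(f)\cdot g=(\mathrm{id}\hat\otimes\omega)\gamma_l(f\otimes g),\qquad g\cdot(\mathrm{id}\hat\otimes\omega)\Delta(f)=(\mathrm{id}\hat\otimes\omega)\rho_l(g\otimes f),$$ $$(\omega\hat\otimes\mathrm{id})\Delta(f)\cdot g=(\omega\hat\otimes\mathrm{id})\gamma_r(f\otimes g),\qquad g\cdot(\omega\hat\otimes\mathrm{id})\Delta(f)=(\omega\hat\otimes\mathrm{id})\rho_r(g\otimes f).$$ Then: 1. $H$ has a unique counit and antipode: there are a unique essential algebra homomorphism $\epsilon\colon H\to\mathbb C$ and a unique bornological linear isomorphism $S\colon H\to H$ such that $S$ is an antihomomorphism of algebras and of coalgebras, $(\epsilon\hat\otimes\mathrm{id})\Delta=\mathrm{id}=(\mathrm{id}\hat\otimes\epsilon)\Delta$, $\mu(S\hat\otimes\mathrm{id})\gamma_r=\epsilon\hat\otimes\mathrm{id}$ and $\mu(\mathrm{id}\hat\otimes S)\rho_l=\mathrm{id}\hat\otimes\epsilon$, where $\mu$ is the multiplication of $H$. 2. There is a unique multiplier $\delta\in M(H)$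 (the modular element) such that $(\phi\hat\otimes\mathrm{id})\Delta(f)=\phi(f)\,\delta$ for all $f\in H$. 3. The modular element $\delta$ is invertible in $M(H)$, and, for the canonical extensions of $\Delta$, $\epsilon$ and $S$ to multipliers, $$\Delta(\delta)=\delta\otimes\delta,\qquad \epsilon(\delta)=1,\qquad S(\delta)=\delta^{-1}.$$ -/

import Mathlib

noncomputable section

set_option linter.unusedSectionVars false

open Bornology Set Filter
open scoped Pointwise

namespace BornQG

/-! ### Complete convex bornological vector spaces -/

section Disks

variable {V : Type*} [AddCommGroup V] [Module ℂ V]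

/-- A disk: a (nonempty) circled and convex subset of a complex vector space. -/
def IsDisk (T : Set V) : Prop :=
  T.Nonempty ∧ ∀ x ∈ T, ∀ y ∈ T, ∀ a b : ℂ, ‖a‖ + ‖b‖ ≤ 1 → a • x + b • y ∈ T

/-- A completant disk: its linear span, with the Minkowski functional of `T` as norm, is a
Banach space. The two last clauses say that the Minkowski functional is a norm and that it is
complete. -/
def IsCompletantDisk (T : Set V) : Prop :=
  IsDisk T ∧ (∀ x : V, (∀ ε : ℝ, 0 < ε → x ∈ (ε : ℂ) • T) → x = 0) ∧
    ∀ u : ℕ → V, (∀ n, u n ∈ Submodule.span ℂ T) →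
      (∀ ε : ℝ, 0 < ε → ∃ N, ∀ m ≥ N, ∀ n ≥ N, u m - u n ∈ (ε : ℂ) • T) →
      ∃ x, ∀ ε : ℝ, 0 < ε → ∃ N, ∀ n ≥ N, u n - x ∈ (ε : ℂ) • T

theorem IsDisk.zero_mem {T : Set V} (h : IsDisk T) : (0 : V) ∈ T := by
  obtain ⟨x, hx⟩ := h.1
  simpa using h.2 x hx x hx 0 0 (by simp)

theorem IsDisk.smul_mem {T : Set V} (h : IsDisk T) {a : ℂ} (ha : ‖a‖ ≤ 1) {x : V} (hx : x ∈ T) :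
    a • x ∈ T := by
  simpa using h.2 x hx x hx a 0 (by simpa using ha)

theorem IsDisk.zero_mem_scale {T : Set V} (h : IsDisk T) (ε : ℝ) : (0 : V) ∈ (ε : ℂ) • T :=
  ⟨0, h.zero_mem, by simp⟩

theorem IsDisk.scale_smul {T : Set V} (h : IsDisk T) {ε δ : ℝ} (hδ : 0 ≤ δ) {c : ℂ}
    (hc : ‖c‖ * ε ≤ δ) (hε : 0 ≤ ε) {x : V} (hx : x ∈ (ε : ℂ) • T) : c • x ∈ (δ : ℂ) • T := by
  obtain ⟨t, ht, rfl⟩ := hx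
  rcases hδ.eq_or_lt with h0 | hpos
  · subst h0
    have h1 : ‖c‖ * ε = 0 := le_antisymm hc (by positivity)
    have h2 : c * (ε : ℂ) = 0 := by
      rw [← norm_eq_zero, norm_mul, Complex.norm_real, Real.norm_of_nonneg hε, h1]
    refine ⟨0, h.zero_mem, ?_⟩
    change ((0 : ℝ) : ℂ) • (0 : V) = c • (ε : ℂ) • t
    rw [smul_smul, h2, zero_smul, smul_zero]
  · refine ⟨(c * ε / δ) • t, h.smul_mem ?_ ht, ?_⟩
    · rw [norm_div, norm_mul, Complex.norm_real, Complex.norm_real, Real.norm_of_nonneg hε,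
        Real.norm_of_nonneg hpos.le]
      exact div_le_one_of_le₀ hc hpos.le
    · have : (δ : ℂ) ≠ 0 := by exact_mod_cast hpos.ne'
      simp only [smul_smul]
      congr 1
      field_simp

theorem IsDisk.scale_mono {T : Set V} (h : IsDisk T) {ε δ : ℝ} (hε : 0 ≤ ε) (hεδ : ε ≤ δ)
    {x : V} (hx : x ∈ (ε : ℂ) • T) : x ∈ (δ : ℂ) • T := by
  simpa using h.scale_smul (hε.trans hεδ) (c := 1) (by simpa using hεδ) hε hx

theorem IsDisk.scale_neg {T : Set V} (h : IsDisk T) {ε : ℝ} (hε : 0 ≤ ε)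
    {x : V} (hx : x ∈ (ε : ℂ) • T) : -x ∈ (ε : ℂ) • T := by
  simpa using h.scale_smul hε (c := -1) (by simp) hε hx

theorem IsDisk.scale_add {T : Set V} (h : IsDisk T) {ε δ : ℝ} (hε : 0 ≤ ε) (hδ : 0 ≤ δ)
    {x y : V} (hx : x ∈ (ε : ℂ) • T) (hy : y ∈ (δ : ℂ) • T) :
    x + y ∈ ((ε + δ : ℝ) : ℂ) • T := by
  obtain ⟨t, ht, rfl⟩ := hx
  obtain ⟨s, hs, rfl⟩ := hy
  rcases (add_nonneg hε hδ).eq_or_lt with h0 | hpos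
  · have h1 : ε = 0 := by linarith
    have h2 : δ = 0 := by linarith
    exact ⟨0, h.zero_mem, by simp [h1, h2]⟩
  · refine ⟨((ε / (ε + δ) : ℝ) : ℂ) • t + ((δ / (ε + δ) : ℝ) : ℂ) • s,
      h.2 t ht s hs _ _ ?_, ?_⟩
    · rw [Complex.norm_real, Complex.norm_real, Real.norm_of_nonneg (by positivity),
        Real.norm_of_nonneg (by positivity), ← add_div, div_self hpos.ne']
    · have : ((ε : ℂ) + δ) ≠ 0 := by exact_mod_cast hpos.ne'
      simp only [smul_add, smul_smul]
      push_cast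
      congr 2 <;> field_simp

theorem IsDisk.scale_sub {T : Set V} (h : IsDisk T) {ε δ : ℝ} (hε : 0 ≤ ε) (hδ : 0 ≤ δ)
    {x y : V} (hx : x ∈ (ε : ℂ) • T) (hy : y ∈ (δ : ℂ) • T) :
    x - y ∈ ((ε + δ : ℝ) : ℂ) • T := by
  rw [sub_eq_add_neg]
  exact h.scale_add hε hδ hx (h.scale_neg hδ hy)

theorem IsDisk.scale_sum {ι : Type*} {T : Set V} (h : IsDisk T) (c : ι → ℂ) (b : ι → V)
    (s : Finset ι) (hb : ∀ i ∈ s, c i ≠ 0 → b i ∈ T) :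
    ∑ i ∈ s, c i • b i ∈ ((∑ i ∈ s, ‖c i‖ : ℝ) : ℂ) • T := by
  classical
  induction s using Finset.induction_on with
  | empty => simpa using h.zero_mem_scale 0
  | insert i s hi ih =>
    rw [Finset.sum_insert hi, Finset.sum_insert hi]
    refine h.scale_add (norm_nonneg _) (Finset.sum_nonneg fun _ _ => norm_nonneg _) ?_
      (ih fun j hj => hb j (Finset.mem_insert_of_mem hj))
    by_cases hc : c i = 0
    · simpa [hc] using h.zero_mem_scale 0
    · refine h.scale_smul (norm_nonneg _) (ε := 1) (by simp) zero_le_one ?_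
      simpa using hb i (Finset.mem_insert_self _ _) hc

end Disks

/-- A complete convex bornological vector space over `ℂ`: a vector bornology such that every
small (i.e. bounded) set is contained in a small completant disk. -/
class CompleteBornSpace (V : Type*) [AddCommGroup V] [Module ℂ V] [Bornology V] : Prop where
  isBounded_add : ∀ {S T : Set V}, IsBounded S → IsBounded T → IsBounded (S + T)
  isBounded_smul : ∀ (c : ℂ) {S : Set V}, IsBounded S → IsBounded (c • S)
  exists_completant : ∀ {S : Set V}, IsBounded S →
    ∃ T : Set V, IsBounded T ∧ IsCompletantDisk T ∧ S ⊆ T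

open CompleteBornSpace

section Convergence

variable {V : Type*} [AddCommGroup V] [Module ℂ V] [Bornology V]

/-- Bornological convergence: `u` converges to `x` along `l` in the semi-normed space spanned
by some small disk. -/
def BTendsto {ι : Type*} (u : ι → V) (l : Filter ι) (x : V) : Prop :=
  ∃ T : Set V, IsBounded T ∧ IsDisk T ∧ ∀ ε : ℝ, 0 < ε → ∀ᶠ i in l, u i - x ∈ (ε : ℂ) • T

variable [CompleteBornSpace V]

theorem eq_zero_of_scale {T : Set V} (hT : IsBounded T) {x : V}
    (hx : ∀ ε : ℝ, 0 < ε → x ∈ (ε : ℂ) • T) : x = 0 := by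
  obtain ⟨U, -, hU, hTU⟩ := exists_completant hT
  exact hU.2.1 x fun ε hε => smul_set_mono hTU (hx ε hε)

theorem BTendsto.enlarge {ι : Type*} {u : ι → V} {l : Filter ι} {x : V} (h : BTendsto u l x)
    {S : Set V} (hS : IsBounded S) : ∃ T : Set V, IsBounded T ∧ IsCompletantDisk T ∧ S ⊆ T ∧
      ∀ ε : ℝ, 0 < ε → ∀ᶠ i in l, u i - x ∈ (ε : ℂ) • T := by
  obtain ⟨T, hT, -, h⟩ := h
  obtain ⟨U, hU, hUc, hTU⟩ := exists_completant (hT.union hS)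
  refine ⟨U, hU, hUc, subset_union_right.trans hTU, fun ε hε => (h ε hε).mono fun i hi => ?_⟩
  exact smul_set_mono (subset_union_left.trans hTU) hi

theorem BTendsto.add {ι : Type*} {u v : ι → V} {l : Filter ι} {x y : V} (hu : BTendsto u l x)
    (hv : BTendsto v l y) : BTendsto (fun i => u i + v i) l (x + y) := by
  obtain ⟨T, hT, -, h⟩ := hv
  obtain ⟨U, hU, hUc, hTU, h'⟩ := hu.enlarge hT
  refine ⟨U, hU, hUc.1, fun ε hε => ?_⟩
  filter_upwards [h _ (half_pos hε), h' _ (half_pos hε)] with i h1 h2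
  have := hUc.1.scale_add (half_pos hε).le (half_pos hε).le h2 (smul_set_mono hTU h1)
  rw [add_halves] at this
  convert this using 1
  abel

theorem BTendsto.smul {ι : Type*} {u : ι → V} {l : Filter ι} {x : V} (c : ℂ)
    (hu : BTendsto u l x) : BTendsto (fun i => c • u i) l (c • x) := by
  obtain ⟨T, hT, hTd, h⟩ := hu
  refine ⟨T, hT, hTd, fun ε hε => ?_⟩
  have hpos : 0 < ε / (‖c‖ + 1) := by positivity
  filter_upwards [h _ hpos] with i hi
  rw [← smul_sub]
  refine hTd.scale_smul hε.le ?_ hpos.le hi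
  rw [mul_div_assoc', div_le_iff₀ (by positivity)]
  nlinarith [norm_nonneg c]

theorem BTendsto.unique {ι : Type*} {u : ι → V} {l : Filter ι} [l.NeBot] {x y : V}
    (hx : BTendsto u l x) (hy : BTendsto u l y) : x = y := by
  have h := hy.add (hx.smul (-1))
  obtain ⟨T, hT, hTd, h⟩ := h
  have : y + (-1 : ℂ) • x = 0 := by
    refine eq_zero_of_scale hT fun ε hε => ?_
    obtain ⟨i, hi⟩ := (h ε hε).exists
    have := hTd.scale_neg hε.le hi
    convert this using 1
    module
  have h2 : y - x = 0 := by rw [← this]; module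
  exact (sub_eq_zero.mp h2).symm

/-- Absolutely convergent series in a complete bornological vector space. -/
theorem exists_bsum {ι : Type*} {U : Set V} (hU : IsBounded U) (hUc : IsCompletantDisk U)
    (c : ι → ℂ) (b : ι → V) (hc : Summable fun i => ‖c i‖) (hb : ∀ i, c i ≠ 0 → b i ∈ U) :
    ∃ x, BTendsto (fun s : Finset ι => ∑ i ∈ s, c i • b i) atTop x ∧
      ∀ C : ℝ, (∀ s : Finset ι, ∑ i ∈ s, ‖c i‖ ≤ C) → x ∈ ((1 + C : ℝ) : ℂ) • U := by
  classical
  have hvan : ∀ n : ℕ, ∃ s : Finset ι, ∀ t : Finset ι, Disjoint t s →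
      ∑ i ∈ t, ‖c i‖ ≤ 1 / ((n : ℝ) + 1) := by
    intro n
    obtain ⟨s, hs⟩ := summable_iff_vanishing_norm.1 hc (1 / ((n : ℝ) + 1)) (by positivity)
    exact ⟨s, fun t ht => (le_abs_self _).trans (hs t ht).le⟩
  choose s hs using hvan
  have key : ∀ (n : ℕ) (t : Finset ι), Disjoint t (s n) →
      ∑ i ∈ t, c i • b i ∈ ((1 / ((n : ℝ) + 1) : ℝ) : ℂ) • U := fun n t ht =>
    hUc.1.scale_mono (Finset.sum_nonneg fun _ _ => norm_nonneg _) (hs n t ht)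
      (hUc.1.scale_sum c b t fun i _ => hb i)
  have hdiff : ∀ t r : Finset ι, ∑ i ∈ t, c i • b i - ∑ i ∈ r, c i • b i
      = ∑ i ∈ t \ r, c i • b i - ∑ i ∈ r \ t, c i • b i := by
    intro t r
    rw [← Finset.sum_sdiff_sub_sum_sdiff]
  have hsmall : ∀ ε : ℝ, 0 < ε → ∃ N : ℕ, ∀ n ≥ N, 1 / ((n : ℝ) + 1) ≤ ε := by
    intro ε hε
    obtain ⟨N, hN⟩ := exists_nat_one_div_lt hε
    exact ⟨N, fun n hn => (Nat.one_div_le_one_div hn).trans hN.le⟩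
  obtain ⟨x, hx⟩ := hUc.2.2 (fun n => ∑ i ∈ s n, c i • b i)
    (fun n => Submodule.sum_mem _ fun i _ => by
      by_cases h0 : c i = 0
      · simp [h0]
      · exact Submodule.smul_mem _ _ (Submodule.subset_span (hb i h0)))
    (by
      intro ε hε
      obtain ⟨N, hN⟩ := hsmall (ε / 2) (by positivity)
      refine ⟨N, fun m hm n hn => ?_⟩
      rw [hdiff]
      have h1 := key n (s m \ s n) Finset.sdiff_disjoint
      have h2 := key m (s n \ s m) Finset.sdiff_disjoint
      refine hUc.1.scale_mono (by positivity) ?_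
        (hUc.1.scale_sub (by positivity) (by positivity) h1 h2)
      linarith [hN n hn, hN m hm])
  refine ⟨x, ⟨U, hU, hUc.1, fun ε hε => ?_⟩, fun C hC => ?_⟩
  rotate_left
  · obtain ⟨N, hN⟩ := hx 1 one_pos
    have h1 := hUc.1.scale_neg zero_le_one (hN N le_rfl)
    have hC0 : 0 ≤ C := (Finset.sum_nonneg fun _ _ => norm_nonneg _).trans (hC (s N))
    have h2 := hUc.1.scale_mono (Finset.sum_nonneg fun _ _ => norm_nonneg _) (hC (s N))
      (hUc.1.scale_sum c b (s N) fun i _ => hb i)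
    have h3 := hUc.1.scale_add zero_le_one hC0 h1 h2
    rwa [neg_sub, sub_add_cancel] at h3
  obtain ⟨N, hN⟩ := hsmall (ε / 2) (by positivity)
  obtain ⟨M, hM⟩ := hx (ε / 2) (by positivity)
  set n := max N M
  filter_upwards [eventually_ge_atTop (s n)] with t ht
  have h1 := hM n (le_max_right _ _)
  have h2 := key n (t \ s n) Finset.sdiff_disjoint
  have h3 := hUc.1.scale_add (by positivity) (by positivity) h1 h2
  have h4 := hUc.1.scale_mono (by positivity)
    (show _ ≤ ε by linarith [hN n (le_max_left _ _)]) h3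
  have h5 : ∑ i ∈ s n, c i • b i - x + ∑ i ∈ t \ s n, c i • b i = ∑ i ∈ t, c i • b i - x := by
    rw [← Finset.sum_sdiff ht]
    abel
  rwa [h5] at h4

end Convergence

/-! ### Bounded linear maps -/

/-- Bounded linear maps: linear maps sending small sets to small sets. -/
structure BLin (V W : Type*) [AddCommGroup V] [Module ℂ V] [Bornology V]
    [AddCommGroup W] [Module ℂ W] [Bornology W] extends V →ₗ[ℂ] W where
  bounded' : ∀ S : Set V, IsBounded S → IsBounded (toFun '' S)

namespace BLin

variable {V W X Y : Type*}
  [AddCommGroup V] [Module ℂ V] [Bornology V]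
  [AddCommGroup W] [Module ℂ W] [Bornology W]
  [AddCommGroup X] [Module ℂ X] [Bornology X]
  [AddCommGroup Y] [Module ℂ Y] [Bornology Y]

instance : FunLike (BLin V W) V W where
  coe f := f.toFun
  coe_injective f g h := by
    cases f; cases g; congr; exact DFunLike.coe_injective h

instance : LinearMapClass (BLin V W) ℂ V W where
  map_add f := f.map_add'
  map_smulₛₗ f := f.map_smul'

@[ext] theorem ext {f g : BLin V W} (h : ∀ x, f x = g x) : f = g := DFunLike.ext f g h

theorem bounded (f : BLin V W) {S : Set V} (hS : IsBounded S) : IsBounded (f '' S) :=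
  f.bounded' S hS

@[simp] theorem coe_mk (f : V →ₗ[ℂ] W) (h) (x : V) : (BLin.mk f h : BLin V W) x = f x := rfl

@[simp] theorem toLinearMap_apply (f : BLin V W) (x : V) : f.toLinearMap x = f x := rfl

/-- The identity map. -/
def id (V : Type*) [AddCommGroup V] [Module ℂ V] [Bornology V] : BLin V V :=
  ⟨LinearMap.id, fun S hS => by simpa using hS⟩

@[simp] theorem id_apply (x : V) : BLin.id V x = x := rfl

/-- Composition of bounded linear maps. -/
def comp (g : BLin W X) (f : BLin V W) : BLin V X :=
  ⟨g.toLinearMap.comp f.toLinearMap, fun S hS => by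
    have := g.bounded (f.bounded hS)
    rwa [← image_comp] at this⟩

@[simp] theorem comp_apply (g : BLin W X) (f : BLin V W) (x : V) : g.comp f x = g (f x) := rfl

/-- A bornological isomorphism: a bounded linear map with a bounded linear inverse. -/
def IsIso (f : BLin V W) : Prop := ∃ g : BLin W V, (∀ x, g (f x) = x) ∧ ∀ y, f (g y) = y

section Module

variable [CompleteBornSpace W]

instance : Zero (BLin V W) := ⟨⟨0, fun S _ => (isBounded_singleton (x := (0 : W))).subset (by
  rintro _ ⟨x, -, rfl⟩; rfl)⟩⟩

instance : Add (BLin V W) := ⟨fun f g => ⟨f.toLinearMap + g.toLinearMap, fun S hS =>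
  (isBounded_add (f.bounded hS) (g.bounded hS)).subset (by
    rintro _ ⟨x, hx, rfl⟩
    exact add_mem_add (mem_image_of_mem _ hx) (mem_image_of_mem _ hx))⟩⟩

instance : SMul ℂ (BLin V W) := ⟨fun c f => ⟨c • f.toLinearMap, fun S hS =>
  (isBounded_smul c (f.bounded hS)).subset (by
    rintro _ ⟨x, hx, rfl⟩
    exact smul_mem_smul_set (mem_image_of_mem _ hx))⟩⟩

instance : Neg (BLin V W) := ⟨fun f => (-1 : ℂ) • f⟩

@[simp] theorem zero_apply (x : V) : (0 : BLin V W) x = 0 := rfl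
@[simp] theorem add_apply (f g : BLin V W) (x : V) : (f + g) x = f x + g x := rfl
@[simp] theorem smul_apply (c : ℂ) (f : BLin V W) (x : V) : (c • f) x = c • f x := rfl
@[simp] theorem neg_apply (f : BLin V W) (x : V) : (-f) x = -f x := by
  change (-1 : ℂ) • f x = _
  simp

instance : AddCommGroup (BLin V W) where
  add_assoc f g h := by ext; simp [add_assoc]
  zero_add f := by ext; simp
  add_zero f := by ext; simp
  add_comm f g := by ext; simp [add_comm]
  neg_add_cancel f := by ext; simp
  nsmul := nsmulRec
  zsmul := zsmulRec

@[simp] theorem sub_apply (f g : BLin V W) (x : V) : (f - g) x = f x - g x := by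
  rw [sub_eq_add_neg, sub_eq_add_neg, add_apply, neg_apply]

instance : Module ℂ (BLin V W) where
  one_smul f := by ext; simp
  mul_smul a b f := by ext; simp [mul_smul]
  smul_zero a := by ext; simp
  smul_add a f g := by ext; simp
  add_smul a b f := by ext; simp [add_smul]
  zero_smul f := by ext; simp

end Module

/-- The equibounded sets of bounded linear maps: `L` is small if `L(S)` is small for all
small `S`. -/
instance : Bornology (BLin V W) :=
  Bornology.ofBounded {L | ∀ S : Set V, IsBounded S →
      IsBounded (image2 (fun (f : BLin V W) x => f x) L S)}
    (fun S _ => by simp)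
    (fun L hL M hM S hS => (hL S hS).subset (image2_subset_right hM))
    (fun L hL M hM S hS => by rw [image2_union_left]; exact (hL S hS).union (hM S hS))
    (fun f S hS => by rw [image2_singleton_left]; exact f.bounded hS)

theorem isBounded_iff {L : Set (BLin V W)} : IsBounded L ↔ ∀ S : Set V, IsBounded S →
    IsBounded (image2 (fun (f : BLin V W) x => f x) L S) :=
  Bornology.isBounded_ofBounded_iff _

section Complete

variable [CompleteBornSpace W]

instance : CompleteBornSpace (BLin V W) where
  isBounded_add {L M} hL hM := by
    rw [isBounded_iff] at *
    refine fun S hS => (isBounded_add (hL S hS) (hM S hS)).subset ?_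
    rintro _ ⟨_, ⟨f, hf, g, hg, rfl⟩, x, hx, rfl⟩
    exact add_mem_add (mem_image2_of_mem hf hx) (mem_image2_of_mem hg hx)
  isBounded_smul c {L} hL := by
    rw [isBounded_iff] at *
    refine fun S hS => (isBounded_smul c (hL S hS)).subset ?_
    rintro _ ⟨_, ⟨f, hf, rfl⟩, x, hx, rfl⟩
    exact smul_mem_smul_set (mem_image2_of_mem hf hx)
  exists_completant {L} hL := by
    rw [isBounded_iff] at hL
    choose! T hT hTc hTL using fun S hS => exists_completant (hL S hS)
    set D : Set (BLin V W) := {f | ∀ S, IsBounded S → ∀ x ∈ S, f x ∈ T S} with hD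
    have hscale : ∀ {ε : ℝ}, 0 < ε → ∀ {f : BLin V W}, f ∈ (ε : ℂ) • D ↔
        ∀ S, IsBounded S → ∀ x ∈ S, f x ∈ (ε : ℂ) • T S := by
      intro ε hε f
      have hne : (ε : ℂ) ≠ 0 := by exact_mod_cast hε.ne'
      simp only [mem_smul_set_iff_inv_smul_mem₀ hne, hD, mem_ofPred_eq, smul_apply]
    have hdisk : IsDisk D := by
      refine ⟨⟨0, fun S hS x _ => (hTc S hS).1.zero_mem⟩, fun f hf g hg a b hab S hS x hx => ?_⟩
      exact (hTc S hS).1.2 _ (hf S hS x hx) _ (hg S hS x hx) a b hab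
    refine ⟨D, ?_, ⟨hdisk, ?_, ?_⟩, fun f hf S hS x hx => hTL S hS (mem_image2_of_mem hf hx)⟩
    · rw [isBounded_iff]
      refine fun S hS => (hT S hS).subset ?_
      rintro _ ⟨f, hf, x, hx, rfl⟩
      exact hf S hS x hx
    · intro f hf
      ext x
      refine eq_zero_of_scale (hT {x} isBounded_singleton) fun ε hε => ?_
      exact (hscale hε).1 (hf ε hε) {x} isBounded_singleton x rfl
    · intro u hu hcau
      have hspan : ∀ S, IsBounded S → ∀ x ∈ S, ∀ n, u n x ∈ Submodule.span ℂ (T S) := by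
        intro S hS x hx n
        refine Submodule.span_induction (p := fun f _ => f x ∈ Submodule.span ℂ (T S))
          ?_ ?_ ?_ ?_ (hu n)
        · exact fun f hf => Submodule.subset_span (hf S hS x hx)
        · exact Submodule.zero_mem _
        · exact fun f g _ _ hf hg => Submodule.add_mem _ hf hg
        · exact fun a f _ hf => Submodule.smul_mem _ a hf
      have hlim : ∀ S, IsBounded S → ∀ x ∈ S, ∃ y, ∀ ε : ℝ, 0 < ε →
          ∃ N, ∀ n ≥ N, u n x - y ∈ (ε : ℂ) • T S := by
        intro S hS x hx
        refine (hTc S hS).2.2 (fun n => u n x) (hspan S hS x hx) fun ε hε => ?_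
        obtain ⟨N, hN⟩ := hcau ε hε
        refine ⟨N, fun m hm n hn => ?_⟩
        have := (hscale hε).1 (hN m hm n hn) S hS x hx
        rwa [sub_apply] at this
      have hB : ∀ S, IsBounded S → ∀ y (x : V), (∀ ε : ℝ, 0 < ε →
          ∃ N, ∀ n ≥ N, u n x - y ∈ (ε : ℂ) • T S) → BTendsto (fun n => u n x) atTop y := by
        intro S hS y x hxy
        exact ⟨T S, hT S hS, (hTc S hS).1, fun ε hε => eventually_atTop.2 (hxy ε hε)⟩
      choose g hg using fun x => hlim {x} isBounded_singleton x rfl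
      have hgB : ∀ x, BTendsto (fun n => u n x) atTop (g x) :=
        fun x => hB _ isBounded_singleton _ _ (hg x)
      have hgS : ∀ S, IsBounded S → ∀ x ∈ S, ∀ ε : ℝ, 0 < ε →
          ∃ N, ∀ n ≥ N, u n x - g x ∈ (ε : ℂ) • T S := by
        intro S hS x hx
        obtain ⟨y, hy⟩ := hlim S hS x hx
        rwa [(hgB x).unique (hB S hS y x hy)]
      have hunif : ∀ ε : ℝ, 0 < ε → ∃ N, ∀ n ≥ N, ∀ S, IsBounded S → ∀ x ∈ S,
          u n x - g x ∈ (ε : ℂ) • T S := by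
        intro ε hε
        obtain ⟨N, hN⟩ := hcau (ε / 2) (half_pos hε)
        refine ⟨N, fun n hn S hS x hx => ?_⟩
        obtain ⟨M, hM⟩ := hgS S hS x hx (ε / 2) (half_pos hε)
        have h1 := (hscale (half_pos hε)).1 (hN n hn (max N M) (le_max_left _ _)) S hS x hx
        have h2 := hM (max N M) (le_max_right _ _)
        have := (hTc S hS).1.scale_add (half_pos hε).le (half_pos hε).le h1 h2
        rw [add_halves, sub_apply, sub_add_sub_cancel] at this
        exact this
      refine ⟨⟨⟨⟨g, fun x y => ?_⟩, fun c x => ?_⟩, fun S hS => ?_⟩, fun ε hε => ?_⟩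
      · have := (hgB x).add (hgB y)
        refine (hgB (x + y)).unique ?_
        simpa using this
      · have := (hgB x).smul c
        refine (hgB (c • x)).unique ?_
        simpa using this
      · obtain ⟨N, hN⟩ := hunif 1 one_pos
        refine (isBounded_add ((u N).bounded hS) (isBounded_smul (-1) (hT S hS))).subset ?_
        rintro _ ⟨x, hx, rfl⟩
        have := hN N le_rfl S hS x hx
        simp only [Complex.ofReal_one, one_smul] at this
        refine ⟨u N x, mem_image_of_mem _ hx, (-1 : ℂ) • (u N x - g x),
          smul_mem_smul_set this, ?_⟩
        change u N x + (-1 : ℂ) • (u N x - g x) = g x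
        module
      · obtain ⟨N, hN⟩ := hunif ε hε
        refine ⟨N, fun n hn => (hscale hε).2 fun S hS x hx => ?_⟩
        rw [sub_apply]
        exact hN n hn S hS x hx

end Complete

theorem map_btendsto {ι : Type*} (f : BLin V W) {u : ι → V} {l : Filter ι} {x : V}
    (h : BTendsto u l x) : BTendsto (fun i => f (u i)) l (f x) := by
  obtain ⟨T, hT, hTd, h⟩ := h
  refine ⟨f '' T, f.bounded hT, ⟨hTd.1.image _, ?_⟩, fun ε hε => (h ε hε).mono fun i hi => ?_⟩
  · rintro _ ⟨x, hx, rfl⟩ _ ⟨y, hy, rfl⟩ a b hab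
    exact ⟨a • x + b • y, hTd.2 x hx y hy a b hab, by simp⟩
  · obtain ⟨t, ht, hti⟩ := hi
    refine ⟨f t, mem_image_of_mem _ ht, ?_⟩
    have := congrArg f hti
    rw [map_sub] at this
    rw [← this]
    exact (map_smul f (ε : ℂ) t).symm

/-- Bounded bilinear maps as bounded linear maps into the space of bounded linear maps. -/
def mk₂ [CompleteBornSpace X] (f : V → W → X)
    (h₁ : ∀ x x' y, f (x + x') y = f x y + f x' y) (h₂ : ∀ (c : ℂ) x y, f (c • x) y = c • f x y)
    (h₃ : ∀ x y y', f x (y + y') = f x y + f x y') (h₄ : ∀ (c : ℂ) x y, f x (c • y) = c • f x y)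
    (hb : ∀ S T, IsBounded S → IsBounded T → IsBounded (image2 f S T)) : BLin V (BLin W X) where
  toFun x := ⟨⟨⟨f x, h₃ x⟩, fun c y => h₄ c x y⟩, fun T hT =>
    (hb {x} T isBounded_singleton hT).subset (by simp)⟩
  map_add' x x' := ext fun y => h₁ x x' y
  map_smul' c x := ext fun y => h₂ c x y
  bounded' S hS := by
    rw [isBounded_iff]
    refine fun T hT => (hb S T hS hT).subset ?_
    rintro _ ⟨_, ⟨x, hx, rfl⟩, y, hy, rfl⟩
    exact mem_image2_of_mem hx hy

@[simp] theorem mk₂_apply [CompleteBornSpace X] (f : V → W → X) (h₁ h₂ h₃ h₄ hb) (x : V) (y : W) :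
    mk₂ f h₁ h₂ h₃ h₄ hb x y = f x y := rfl

theorem bounded₂ [CompleteBornSpace X] (f : BLin V (BLin W X)) {S : Set V} {T : Set W}
    (hS : IsBounded S) (hT : IsBounded T) : IsBounded (image2 (fun x y => f x y) S T) := by
  refine (isBounded_iff.1 (f.bounded hS) T hT).subset ?_
  rintro _ ⟨x, hx, y, hy, rfl⟩
  exact ⟨f x, mem_image_of_mem _ hx, y, hy, rfl⟩

/-- Exchange of the two arguments of a bounded bilinear map. -/
def flip [CompleteBornSpace X] (f : BLin V (BLin W X)) : BLin W (BLin V X) :=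
  mk₂ (fun y x => f x y) (by simp) (by simp) (by simp) (by simp) fun S T hS hT => by
    rw [image2_swap]
    exact f.bounded₂ hT hS

@[simp] theorem flip_apply [CompleteBornSpace X] (f : BLin V (BLin W X)) (y : W) (x : V) :
    f.flip y x = f x y := rfl

/-- Composition as a bounded bilinear map. -/
def compB [CompleteBornSpace W] [CompleteBornSpace X] :
    BLin (BLin W X) (BLin (BLin V W) (BLin V X)) :=
  mk₂ (fun g f => g.comp f) (fun g g' f => rfl) (fun c g f => rfl)
    (fun g f f' => by ext; simp) (fun c g f => by ext; simp) fun S T hS hT => by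
      rw [isBounded_iff] at *
      refine fun R hR => (hS _ (hT R hR)).subset ?_
      rintro _ ⟨_, ⟨g, hg, f, hf, rfl⟩, x, hx, rfl⟩
      exact mem_image2_of_mem hg (mem_image2_of_mem hf hx)

@[simp] theorem compB_apply [CompleteBornSpace W] [CompleteBornSpace X] (g : BLin W X)
    (f : BLin V W) : compB g f = g.comp f := rfl

/-- Scalar multiplication as a bounded bilinear map. -/
def smulB [CompleteBornSpace V] : BLin ℂ (BLin V V) :=
  mk₂ (fun c v => c • v) (fun _ _ _ => add_smul _ _ _) (fun _ _ _ => by rw [smul_assoc])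
    (fun _ _ _ => smul_add _ _ _) (fun _ _ _ => smul_comm _ _ _) fun S T hS hT => by
      obtain ⟨U, hU, hUc, hTU⟩ := exists_completant hT
      obtain ⟨C, hC, hSC⟩ := hS.exists_pos_norm_le
      refine (isBounded_smul (C : ℂ) hU).subset ?_
      rintro _ ⟨c, hc, v, hv, rfl⟩
      exact hUc.1.scale_smul hC.le (ε := 1) (by simpa using hSC c hc) zero_le_one
        (by simpa using hTU hv)

@[simp] theorem smulB_apply [CompleteBornSpace V] (c : ℂ) (v : V) : smulB c v = c • v := rfl

end BLin

instance : CompleteBornSpace ℂ where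
  isBounded_add hS hT := hS.add hT
  isBounded_smul c _ hS := hS.smul₀ c
  exists_completant {S} hS := by
    obtain ⟨C, hC, hSC⟩ := hS.exists_pos_norm_le
    have hne : (C : ℂ) ≠ 0 := by exact_mod_cast hC.ne'
    have hsc : ∀ {ε : ℝ}, 0 < ε → ∀ {x : ℂ}, x ∈ (ε : ℂ) • Metric.closedBall (0 : ℂ) C ↔
        ‖x‖ ≤ ε * C := by
      intro ε hε x
      have hε' : (ε : ℂ) ≠ 0 := by exact_mod_cast hε.ne'
      rw [mem_smul_set_iff_inv_smul_mem₀ hε', mem_closedBall_zero_iff, norm_smul, norm_inv,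
        Complex.norm_real, Real.norm_of_nonneg hε.le, inv_mul_le_iff₀ hε]
    refine ⟨Metric.closedBall 0 C, Metric.isBounded_closedBall,
      ⟨⟨⟨0, by simpa using hC.le⟩, fun x hx y hy a b hab => ?_⟩, fun x hx => ?_,
        fun u _ hcau => ?_⟩, fun x hx => by simpa using hSC x hx⟩
    · rw [mem_closedBall_zero_iff] at *
      calc ‖a • x + b • y‖ ≤ ‖a‖ * ‖x‖ + ‖b‖ * ‖y‖ := by
            rw [← norm_smul, ← norm_smul]; exact norm_add_le _ _
        _ ≤ ‖a‖ * C + ‖b‖ * C := by gcongr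
        _ ≤ C := by nlinarith
    · refine norm_eq_zero.1 (le_antisymm (le_of_forall_pos_le_add fun ε hε => ?_) (norm_nonneg _))
      have := (hsc (ε := ε / C) (by positivity)).1 (hx _ (by positivity))
      rw [div_mul_cancel₀ _ hC.ne'] at this
      linarith
    · obtain ⟨x, hx⟩ := cauchySeq_tendsto_of_complete (u := u)
        (Metric.cauchySeq_iff.2 fun ε hε => by
          obtain ⟨N, hN⟩ := hcau (ε / 2 / C) (by positivity)
          refine ⟨N, fun m hm n hn => ?_⟩
          have := (hsc (by positivity)).1 (hN m hm n hn)
          rw [div_mul_cancel₀ _ hC.ne'] at this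
          rw [dist_eq_norm]
          linarith)
      refine ⟨x, fun ε hε => ?_⟩
      obtain ⟨N, hN⟩ := Metric.tendsto_atTop.1 hx (ε * C) (by positivity)
      refine ⟨N, fun n hn => (hsc hε).2 ?_⟩
      rw [← dist_eq_norm]
      exact (hN n hn).le

/-! ### Quotients by bornologically closed subspaces -/

section Quotient

variable {V : Type*} [AddCommGroup V] [Module ℂ V] [Bornology V]

/-- Bornologically closed subspaces: closed under limits of convergent sequences. -/
def BClosed (N : Submodule ℂ V) : Prop :=
  ∀ (u : ℕ → V) (x : V), (∀ n, u n ∈ N) → BTendsto u atTop x → x ∈ N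

/-- The bornologically closed subspace generated by a set. -/
def closedSpan (r : Set V) : Submodule ℂ V := sInf {N | r ⊆ N ∧ BClosed N}

theorem subset_closedSpan (r : Set V) : r ⊆ closedSpan r := fun _ hx =>
  Submodule.mem_sInf.2 fun _ hN => hN.1 hx

theorem bClosed_closedSpan (r : Set V) : BClosed (closedSpan r) := fun u x hu hx =>
  Submodule.mem_sInf.2 fun N hN => hN.2 u x (fun n => Submodule.mem_sInf.1 (hu n) N hN) hx

theorem closedSpan_le {r : Set V} {N : Submodule ℂ V} (h : r ⊆ N) (hN : BClosed N) :
    closedSpan r ≤ N := sInf_le ⟨h, hN⟩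

theorem bClosed_ker {W : Type*} [AddCommGroup W] [Module ℂ W] [Bornology W]
    [CompleteBornSpace W] (f : BLin V W) : BClosed (LinearMap.ker f.toLinearMap) := by
  intro u x hu hx
  have h1 := f.map_btendsto hx
  have h2 : BTendsto (fun n => f (u n)) atTop (0 : W) := by
    refine ⟨{0}, isBounded_singleton, ⟨singleton_nonempty _, by simp⟩, fun ε hε => ?_⟩
    refine Eventually.of_forall fun n => ⟨0, rfl, ?_⟩
    have : f (u n) = 0 := hu n
    simp [this]
  exact h1.unique h2

/-- The complete bornological quotient of `V` by the closed subspace generated by `r`. -/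
def BQuot (r : Set V) : Type _ := V ⧸ closedSpan r

namespace BQuot

variable (r : Set V)

instance : AddCommGroup (BQuot r) := inferInstanceAs (AddCommGroup (V ⧸ closedSpan r))

instance : Module ℂ (BQuot r) := inferInstanceAs (Module ℂ (V ⧸ closedSpan r))

/-- The quotient map, as a linear map. -/
def mkLin : V →ₗ[ℂ] BQuot r := (closedSpan r).mkQ

theorem mkLin_surjective : Function.Surjective (mkLin r) := Submodule.mkQ_surjective _

theorem mkLin_eq_zero {x : V} : mkLin r x = 0 ↔ x ∈ closedSpan r :=
  Submodule.Quotient.mk_eq_zero _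

/-- The quotient bornology: the small sets are the images of small sets. -/
instance : Bornology (BQuot r) :=
  Bornology.ofBounded {B | ∃ S : Set V, IsBounded S ∧ B ⊆ mkLin r '' S}
    ⟨∅, isBounded_empty, by simp⟩
    (fun B ⟨S, hS, h⟩ B' h' => ⟨S, hS, h'.trans h⟩)
    (fun B ⟨S, hS, h⟩ B' ⟨S', hS', h'⟩ => ⟨S ∪ S', hS.union hS', by
      rw [image_union]; exact union_subset_union h h'⟩)
    (fun x => by
      obtain ⟨y, rfl⟩ := mkLin_surjective r x
      exact ⟨{y}, isBounded_singleton, by simp⟩)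

theorem isBounded_iff {B : Set (BQuot r)} :
    IsBounded B ↔ ∃ S : Set V, IsBounded S ∧ B ⊆ mkLin r '' S :=
  Bornology.isBounded_ofBounded_iff _

/-- The quotient map. -/
def mk : BLin V (BQuot r) := ⟨mkLin r, fun S hS => (isBounded_iff r).2 ⟨S, hS, subset_rfl⟩⟩

theorem mk_surjective : Function.Surjective (mk r) := mkLin_surjective r

theorem mk_eq_zero {x : V} : mk r x = 0 ↔ x ∈ closedSpan r := mkLin_eq_zero r

theorem mem_scale_image {T : Set V} {ε : ℝ} {x : BQuot r} :
    x ∈ (ε : ℂ) • (mk r '' T) ↔ ∃ t ∈ (ε : ℂ) • T, mk r t = x := by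
  constructor
  · rintro ⟨_, ⟨t, ht, rfl⟩, rfl⟩
    exact ⟨(ε : ℂ) • t, smul_mem_smul_set ht, map_smul (mk r) _ _⟩
  · rintro ⟨_, ⟨t, ht, rfl⟩, rfl⟩
    exact ⟨mk r t, mem_image_of_mem _ ht, (map_smul (mk r) (ε : ℂ) t).symm⟩

theorem isCompletantDisk_image {D : Set V} (hD : IsBounded D) (hDc : IsCompletantDisk D) :
    IsCompletantDisk (mk r '' D) := by
  refine ⟨⟨hDc.1.1.image _, ?_⟩, fun x hx => ?_, fun u hu hcau => ?_⟩
  · rintro _ ⟨x, hx, rfl⟩ _ ⟨y, hy, rfl⟩ a b hab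
    exact ⟨a • x + b • y, hDc.1.2 x hx y hy a b hab, by simp⟩
  · obtain ⟨y, rfl⟩ := mk_surjective r x
    choose d hd hdy using fun n : ℕ => (mem_scale_image r).1
      (hx (1 / ((n : ℝ) + 1)) (by positivity))
    refine (mk_eq_zero r).2 (bClosed_closedSpan r (fun n => y - d n) y (fun n => ?_) ?_)
    · rw [← mk_eq_zero, map_sub, hdy, sub_self]
    · refine ⟨D, hD, hDc.1, fun ε hε => ?_⟩
      obtain ⟨N, hN⟩ := exists_nat_one_div_lt hε
      filter_upwards [eventually_ge_atTop N] with n hn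
      have := hDc.1.scale_neg (by positivity) (hd n)
      rw [sub_sub_cancel_left]
      exact hDc.1.scale_mono (by positivity) ((Nat.one_div_le_one_div hn).trans hN.le) this
  · -- choose a rapidly converging subsequence and lift it
    have hpow : ∀ j : ℕ, (0 : ℝ) < (1 / 2) ^ j := fun j => by positivity
    choose N hN using fun j : ℕ => hcau ((1 / 2) ^ j) (hpow j)
    set k : ℕ → ℕ := fun j => ∑ i ∈ Finset.range (j + 1), N i with hk
    have hkN : ∀ j, N j ≤ k j := fun j =>
      Finset.single_le_sum (f := N) (fun _ _ => Nat.zero_le _) (Finset.self_mem_range_succ j)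
    have hkmono : ∀ j, k j ≤ k (j + 1) := fun j => by
      simp only [hk]
      rw [Finset.sum_range_succ _ (j + 1)]
      exact Nat.le_add_right _ _
    choose d hd hdu using fun j : ℕ => (mem_scale_image r).1
      (hN j (k (j + 1)) ((hkN j).trans (hkmono j)) (k j) (hkN j))
    obtain ⟨y₀, hy₀, hy₀u⟩ : ∃ y₀ ∈ Submodule.span ℂ D, mk r y₀ = u (k 0) := by
      have h1 : u (k 0) ∈ (Submodule.span ℂ D).map (mkLin r) := by
        rw [Submodule.map_span]
        exact hu (k 0)
      exact h1
    set y : ℕ → V := fun j => y₀ + ∑ i ∈ Finset.range j, d i with hy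
    have hysucc : ∀ j, y (j + 1) = y j + d j := fun j => by
      simp only [hy, Finset.sum_range_succ, add_assoc]
    have hyu : ∀ j, mk r (y j) = u (k j) := by
      intro j
      induction j with
      | zero => simpa [hy] using hy₀u
      | succ j ih => rw [hysucc, map_add, ih, hdu]; abel
    have hdiff : ∀ n l : ℕ, y (n + l) - y n ∈
        ((2 * (1 / 2) ^ n - 2 * (1 / 2) ^ (n + l) : ℝ) : ℂ) • D := by
      intro n l
      induction l with
      | zero => simpa using hDc.1.zero_mem_scale 0
      | succ l ih =>
        have hle : ((1 : ℝ) / 2) ^ (n + l) ≤ (1 / 2) ^ n :=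
          pow_le_pow_of_le_one (by norm_num) (by norm_num) (Nat.le_add_right _ _)
        have := hDc.1.scale_add (by linarith) (hpow _).le ih (hd (n + l))
        have e1 : y (n + l) - y n + d (n + l) = y (n + (l + 1)) - y n := by
          rw [← add_assoc n l 1, hysucc]; abel
        rw [e1] at this
        refine hDc.1.scale_mono (by linarith [hpow (n + l)]) (le_of_eq ?_) this
        rw [← add_assoc n l 1, pow_succ _ (n + l)]
        ring
    have hdiff' : ∀ n m : ℕ, n ≤ m → y m - y n ∈ ((2 * (1 / 2) ^ n : ℝ) : ℂ) • D := by
      intro n m hnm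
      obtain ⟨l, rfl⟩ := Nat.exists_eq_add_of_le hnm
      have hle : ((1 : ℝ) / 2) ^ (n + l) ≤ (1 / 2) ^ n :=
        pow_le_pow_of_le_one (by norm_num) (by norm_num) (Nat.le_add_right _ _)
      exact hDc.1.scale_mono (by linarith) (by linarith [hpow (n + l)]) (hdiff n l)
    obtain ⟨x, hx⟩ := hDc.2.2 y
      (fun n => Submodule.add_mem _ hy₀ (Submodule.sum_mem _ fun i _ => by
        obtain ⟨t, ht, h⟩ := hd i
        rw [← h]
        exact Submodule.smul_mem _ _ (Submodule.subset_span ht)))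
      (by
        intro ε hε
        obtain ⟨M, hM⟩ := exists_pow_lt_of_lt_one (show (0 : ℝ) < ε / 4 by positivity)
          (show (1 / 2 : ℝ) < 1 by norm_num)
        refine ⟨M, fun m hm n hn => ?_⟩
        have h1 := hDc.1.scale_sub (by positivity) (by positivity) (hdiff' M m hm) (hdiff' M n hn)
        rw [sub_sub_sub_cancel_right] at h1
        exact hDc.1.scale_mono (by positivity) (by linarith) h1)
    refine ⟨mk r x, fun ε hε => ?_⟩
    obtain ⟨M, hM⟩ := exists_pow_lt_of_lt_one (show (0 : ℝ) < ε / 2 by positivity)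
      (show (1 / 2 : ℝ) < 1 by norm_num)
    obtain ⟨L, hL⟩ := hx (ε / 2) (half_pos hε)
    set j := max M L
    refine ⟨k j, fun n hn => ?_⟩
    obtain ⟨t, ht, htu⟩ := (mem_scale_image r).1 (hN j n ((hkN j).trans hn) (k j) (hkN j))
    have h1 := hDc.1.scale_add (by positivity) (by positivity) ht (hL j (le_max_right _ _))
    refine (mem_scale_image r).2 ⟨t + (y j - x), hDc.1.scale_mono (by positivity) ?_ h1, ?_⟩
    · have : ((1 : ℝ) / 2) ^ j ≤ (1 / 2) ^ M :=
        pow_le_pow_of_le_one (by norm_num) (by norm_num) (le_max_left _ _)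
      linarith
    · rw [map_add, map_sub, htu, hyu]
      abel

instance [CompleteBornSpace V] : CompleteBornSpace (BQuot r) where
  isBounded_add {B B'} hB hB' := by
    obtain ⟨S, hS, h⟩ := (isBounded_iff r).1 hB
    obtain ⟨S', hS', h'⟩ := (isBounded_iff r).1 hB'
    refine (isBounded_iff r).2 ⟨S + S', isBounded_add hS hS', ?_⟩
    rw [image_add]
    exact add_subset_add h h'
  isBounded_smul c {B} hB := by
    obtain ⟨S, hS, h⟩ := (isBounded_iff r).1 hB
    refine (isBounded_iff r).2 ⟨c • S, isBounded_smul c hS, ?_⟩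
    rw [image_smul_set]
    exact smul_set_mono h
  exists_completant {B} hB := by
    obtain ⟨S, hS, h⟩ := (isBounded_iff r).1 hB
    obtain ⟨D, hD, hDc, hSD⟩ := exists_completant hS
    exact ⟨mk r '' D, (mk r).bounded hD, isCompletantDisk_image r hD hDc,
      h.trans (image_mono hSD)⟩

variable {r}

/-- Bounded linear maps killing `r` descend to the quotient. -/
def lift {W : Type*} [AddCommGroup W] [Module ℂ W] [Bornology W] [CompleteBornSpace W]
    (f : BLin V W) (hf : ∀ x ∈ r, f x = 0) : BLin (BQuot r) W :=
  ⟨(closedSpan r).liftQ f.toLinearMap (closedSpan_le hf (bClosed_ker f)), fun B hB => by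
    obtain ⟨S, hS, h⟩ := (isBounded_iff r).1 hB
    refine (f.bounded hS).subset ((image_mono h).trans ?_)
    rintro _ ⟨_, ⟨x, hx, rfl⟩, rfl⟩
    exact ⟨x, hx, rfl⟩⟩

@[simp] theorem lift_mk {W : Type*} [AddCommGroup W] [Module ℂ W] [Bornology W]
    [CompleteBornSpace W] (f : BLin V W) (hf : ∀ x ∈ r, f x = 0) (x : V) :
    lift f hf (mk r x) = f x := rfl

end BQuot

end Quotient

/-! ### The completed bornological tensor product -/

section Tensor

variable (V W : Type*) [AddCommGroup V] [Module ℂ V] [Bornology V]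
  [AddCommGroup W] [Module ℂ W] [Bornology W]

/-- The absolutely summable families of coefficients `c` on `V × W` supported in a product of
two small sets; `c` stands for the formal series `∑ c (v, w) • (v ⊗ w)`. -/
def FormalTensor : Submodule ℂ (V × W → ℂ) where
  carrier := {c | (Summable fun p => ‖c p‖) ∧
    ∃ (S : Set V) (T : Set W), IsBounded S ∧ IsBounded T ∧ ∀ p, c p ≠ 0 → p ∈ S ×ˢ T}
  zero_mem' := ⟨by simp, ∅, ∅, isBounded_empty, isBounded_empty, by simp⟩
  add_mem' := by
    rintro c d ⟨hc, S, T, hS, hT, h⟩ ⟨hd, S', T', hS', hT', h'⟩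
    refine ⟨(hc.add hd).of_nonneg_of_le (fun _ => norm_nonneg _) (fun p => norm_add_le _ _),
      S ∪ S', T ∪ T', hS.union hS', hT.union hT', fun p hp => ?_⟩
    by_cases h0 : c p = 0
    · have := h' p (by simpa [h0] using hp)
      exact ⟨Or.inr this.1, Or.inr this.2⟩
    · exact ⟨Or.inl (h p h0).1, Or.inl (h p h0).2⟩
  smul_mem' := by
    rintro a c ⟨hc, S, T, hS, hT, h⟩
    refine ⟨by simpa using hc.mul_left ‖a‖, S, T, hS, hT, fun p hp => h p fun h0 => hp ?_⟩
    simp [h0]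

namespace FormalTensor

variable {V W}

/-- The unit ball of the absolutely summable families supported in `S ×ˢ T`. -/
def ball (S : Set V) (T : Set W) : Set (FormalTensor V W) :=
  {c | (∀ p, c.1 p ≠ 0 → p ∈ S ×ˢ T) ∧ ∀ s : Finset (V × W), ∑ p ∈ s, ‖c.1 p‖ ≤ 1}

theorem ball_mono {S S' : Set V} {T T' : Set W} (hS : S ⊆ S') (hT : T ⊆ T') :
    ball S T ⊆ ball S' T' := fun _ hc =>
  ⟨fun p hp => prod_mono hS hT (hc.1 p hp), hc.2⟩

theorem mem_scale_ball {S : Set V} {T : Set W} {ε : ℝ} (hε : 0 < ε) {c : FormalTensor V W} :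
    c ∈ (ε : ℂ) • ball S T ↔
      (∀ p, c.1 p ≠ 0 → p ∈ S ×ˢ T) ∧ ∀ s : Finset (V × W), ∑ p ∈ s, ‖c.1 p‖ ≤ ε := by
  have hne : (ε : ℂ) ≠ 0 := by exact_mod_cast hε.ne'
  rw [mem_smul_set_iff_inv_smul_mem₀ hne]
  have h1 : ∀ p, (((ε : ℂ)⁻¹ • c : FormalTensor V W)).1 p = (ε : ℂ)⁻¹ * c.1 p := fun p => rfl
  simp only [ball, mem_ofPred_eq, h1]
  refine and_congr (forall_congr' fun p => ?_) (forall_congr' fun s => ?_)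
  · simp [hε.ne']
  · simp only [norm_mul, norm_inv, Complex.norm_real, Real.norm_of_nonneg hε.le]
    rw [← Finset.mul_sum, inv_mul_le_iff₀ hε, mul_one]

theorem isDisk_ball (S : Set V) (T : Set W) : IsDisk (ball S T) := by
  refine ⟨⟨0, fun p hp => absurd rfl hp, fun s => ?_⟩, ?_⟩
  · have : ∀ p, (0 : FormalTensor V W).1 p = 0 := fun _ => rfl
    simp [this]
  · rintro c ⟨hc, hc'⟩ d ⟨hd, hd'⟩ a b hab
    have h1 : ∀ p, (a • c + b • d : FormalTensor V W).1 p = a * c.1 p + b * d.1 p := fun _ => rfl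
    refine ⟨fun p hp => ?_, fun s => ?_⟩
    · by_cases h0 : c.1 p = 0
      · exact hd p fun h2 => hp (by rw [h1, h0, h2]; simp)
      · exact hc p h0
    · calc ∑ p ∈ s, ‖(a • c + b • d : FormalTensor V W).1 p‖
          ≤ ∑ p ∈ s, (‖a‖ * ‖c.1 p‖ + ‖b‖ * ‖d.1 p‖) := Finset.sum_le_sum fun p _ => by
            rw [h1, ← norm_mul, ← norm_mul]; exact norm_add_le _ _
        _ = ‖a‖ * ∑ p ∈ s, ‖c.1 p‖ + ‖b‖ * ∑ p ∈ s, ‖d.1 p‖ := by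
            rw [Finset.sum_add_distrib, Finset.mul_sum, Finset.mul_sum]
        _ ≤ ‖a‖ * 1 + ‖b‖ * 1 := by
            gcongr
            · exact hc' s
            · exact hd' s
        _ ≤ 1 := by linarith

theorem isCompletantDisk_ball {S : Set V} {T : Set W} (hS : IsBounded S) (hT : IsBounded T) :
    IsCompletantDisk (ball S T) := by
  refine ⟨isDisk_ball S T, fun c hc => ?_, fun u _ hcau => ?_⟩
  · refine Subtype.ext (funext fun p => norm_eq_zero.1 (le_antisymm ?_ (norm_nonneg _)))
    refine le_of_forall_pos_le_add fun ε hε => ?_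
    simpa using ((mem_scale_ball hε).1 (hc ε hε)).2 {p}
  · have hsub : ∀ m n p, (u m - u n : FormalTensor V W).1 p = (u m).1 p - (u n).1 p :=
      fun _ _ _ => rfl
    have hpt : ∀ p, ∃ z : ℂ, Tendsto (fun n => (u n).1 p) atTop (nhds z) := by
      intro p
      refine cauchySeq_tendsto_of_complete (Metric.cauchySeq_iff.2 fun ε hε => ?_)
      obtain ⟨N, hN⟩ := hcau (ε / 2) (half_pos hε)
      refine ⟨N, fun m hm n hn => ?_⟩
      have := ((mem_scale_ball (half_pos hε)).1 (hN m hm n hn)).2 {p}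
      rw [Finset.sum_singleton, hsub] at this
      rw [dist_eq_norm]
      linarith
    choose z hz using hpt
    have hle : ∀ ε : ℝ, 0 < ε → ∃ N, ∀ n ≥ N, (∀ p, (u n).1 p - z p ≠ 0 → p ∈ S ×ˢ T) ∧
        ∀ s : Finset (V × W), ∑ p ∈ s, ‖(u n).1 p - z p‖ ≤ ε := by
      intro ε hε
      obtain ⟨N, hN⟩ := hcau ε hε
      refine ⟨N, fun n hn => ⟨fun p hp => ?_, fun s => ?_⟩⟩
      · by_contra hpS
        refine hp (sub_eq_zero.2 ?_)
        refine tendsto_nhds_unique (tendsto_const_nhds.congr' ?_) (hz p)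
        filter_upwards [eventually_ge_atTop N] with m hm
        by_contra hne
        exact hpS (((mem_scale_ball hε).1 (hN n hn m hm)).1 p (by
          rw [hsub]; exact sub_ne_zero.2 hne))
      · have h1 : Tendsto (fun m => ∑ p ∈ s, ‖(u n).1 p - (u m).1 p‖) atTop
            (nhds (∑ p ∈ s, ‖(u n).1 p - z p‖)) :=
          tendsto_finsetSum _ fun p _ => (tendsto_const_nhds.sub (hz p)).norm
        refine le_of_tendsto h1 ?_
        filter_upwards [eventually_ge_atTop N] with m hm
        exact ((mem_scale_ball hε).1 (hN n hn m hm)).2 s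
    obtain ⟨N, hN⟩ := hle 1 one_pos
    have hmem : (fun p => (u N).1 p - z p) ∈ FormalTensor V W :=
      ⟨summable_of_sum_le (fun _ => norm_nonneg _) (hN N le_rfl).2, S, T, hS, hT,
        (hN N le_rfl).1⟩
    have hzmem : z ∈ FormalTensor V W := by
      have := Submodule.sub_mem _ (u N).2 hmem
      convert this using 1
      funext p
      simp
    refine ⟨⟨z, hzmem⟩, fun ε hε => ?_⟩
    obtain ⟨M, hM⟩ := hle ε hε
    exact ⟨M, fun n hn => (mem_scale_ball hε).2 (hM n hn)⟩

/-- The small sets of formal tensors: uniformly supported in a product of small sets and with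
uniformly bounded `ℓ¹`-norms. -/
instance : Bornology (FormalTensor V W) :=
  Bornology.ofBounded {B | ∃ (S : Set V) (T : Set W) (C : ℝ), IsBounded S ∧ IsBounded T ∧ 0 < C ∧
      B ⊆ (C : ℂ) • ball S T}
    ⟨∅, ∅, 1, isBounded_empty, isBounded_empty, one_pos, by simp⟩
    (fun B ⟨S, T, C, hS, hT, hC, h⟩ B' h' => ⟨S, T, C, hS, hT, hC, h'.trans h⟩)
    (fun B ⟨S, T, C, hS, hT, hC, h⟩ B' ⟨S', T', C', hS', hT', hC', h'⟩ => by
      refine ⟨S ∪ S', T ∪ T', C + C', hS.union hS', hT.union hT', by positivity,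
        union_subset (fun c hc => ?_) (fun c hc => ?_)⟩
      · exact (isDisk_ball _ _).scale_mono hC.le (by linarith)
          (smul_set_mono (ball_mono subset_union_left subset_union_left) (h hc))
      · exact (isDisk_ball _ _).scale_mono hC'.le (by linarith)
          (smul_set_mono (ball_mono subset_union_right subset_union_right) (h' hc)))
    (fun c => by
      obtain ⟨hc, S, T, hS, hT, h⟩ := c.2
      have hpos : 0 < (∑' p, ‖c.1 p‖) + 1 := by
        have : 0 ≤ ∑' p, ‖c.1 p‖ := tsum_nonneg fun _ => norm_nonneg _
        linarith
      refine ⟨S, T, (∑' p, ‖c.1 p‖) + 1, hS, hT, hpos,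
        singleton_subset_iff.2 ((mem_scale_ball hpos).2 ⟨h, fun s => ?_⟩)⟩
      exact (hc.sum_le_tsum s fun _ _ => norm_nonneg _).trans (by linarith))

theorem isBounded_iff {B : Set (FormalTensor V W)} : IsBounded B ↔
    ∃ (S : Set V) (T : Set W) (C : ℝ), IsBounded S ∧ IsBounded T ∧ 0 < C ∧
      B ⊆ (C : ℂ) • ball S T :=
  Bornology.isBounded_ofBounded_iff _

theorem isBounded_ball {S : Set V} {T : Set W} (hS : IsBounded S) (hT : IsBounded T) (C : ℝ)
    (hC : 0 < C) : IsBounded ((C : ℂ) • ball S T) :=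
  isBounded_iff.2 ⟨S, T, C, hS, hT, hC, subset_rfl⟩

instance : CompleteBornSpace (FormalTensor V W) where
  isBounded_add {B B'} hB hB' := by
    obtain ⟨S, T, C, hS, hT, hC, h⟩ := isBounded_iff.1 hB
    obtain ⟨S', T', C', hS', hT', hC', h'⟩ := isBounded_iff.1 hB'
    refine isBounded_iff.2 ⟨S ∪ S', T ∪ T', C + C', hS.union hS', hT.union hT', by positivity, ?_⟩
    rintro _ ⟨c, hc, d, hd, rfl⟩
    exact (isDisk_ball _ _).scale_add hC.le hC'.le
      (smul_set_mono (ball_mono subset_union_left subset_union_left) (h hc))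
      (smul_set_mono (ball_mono subset_union_right subset_union_right) (h' hd))
  isBounded_smul a {B} hB := by
    obtain ⟨S, T, C, hS, hT, hC, h⟩ := isBounded_iff.1 hB
    refine isBounded_iff.2 ⟨S, T, (‖a‖ + 1) * C, hS, hT, by positivity, ?_⟩
    rintro _ ⟨c, hc, rfl⟩
    refine (isDisk_ball _ _).scale_smul (by positivity) ?_ hC.le (h hc)
    gcongr
    linarith
  exists_completant {B} hB := by
    obtain ⟨S, T, C, hS, hT, hC, h⟩ := isBounded_iff.1 hB
    have hne : (C : ℂ) ≠ 0 := by exact_mod_cast hC.ne'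
    have hsc : ∀ {ε : ℝ}, (ε : ℂ) • (C : ℂ) • ball S T = ((ε * C : ℝ) : ℂ) • ball S T := by
      intro ε
      rw [smul_smul, Complex.ofReal_mul]
    refine ⟨(C : ℂ) • ball S T, isBounded_ball hS hT C hC, ⟨⟨(isDisk_ball S T).1.smul_set, ?_⟩,
      fun x hx => ?_, fun u hu hcau => ?_⟩, h⟩
    · rintro _ ⟨c, hc, rfl⟩ _ ⟨d, hd, rfl⟩ a b hab
      refine ⟨a • c + b • d, (isDisk_ball S T).2 c hc d hd a b hab, ?_⟩
      simp only [smul_add]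
      rw [smul_comm _ a, smul_comm _ b]
    · refine (isCompletantDisk_ball hS hT).2.1 x fun ε hε => ?_
      have := hx (ε / C) (by positivity)
      rwa [hsc, div_mul_cancel₀ _ hC.ne'] at this
    · obtain ⟨x, hx⟩ := (isCompletantDisk_ball hS hT).2.2 u
        (fun n => Submodule.span_le.2 (by
          rintro _ ⟨c, hc, rfl⟩
          exact Submodule.smul_mem _ _ (Submodule.subset_span hc)) (hu n))
        (fun ε hε => by
          obtain ⟨N, hN⟩ := hcau (ε / C) (by positivity)
          refine ⟨N, fun m hm n hn => ?_⟩
          have := hN m hm n hn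
          rwa [hsc, div_mul_cancel₀ _ hC.ne'] at this)
      refine ⟨x, fun ε hε => ?_⟩
      obtain ⟨N, hN⟩ := hx (ε * C) (by positivity)
      refine ⟨N, fun n hn => ?_⟩
      rw [hsc]
      exact hN n hn

open Classical in
/-- The formal tensor `v ⊗ w`. -/
def single (v : V) (w : W) : FormalTensor V W :=
  ⟨Pi.single (v, w) 1, summable_of_ne_finset_zero (s := {(v, w)}) (fun p hp => by
      rw [Finset.mem_singleton] at hp
      simp [hp]),
    {v}, {w}, isBounded_singleton, isBounded_singleton, fun p hp => by
      by_contra h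
      refine hp (Pi.single_eq_of_ne (fun h' => h ?_) _)
      simp [h']⟩

theorem single_self (v : V) (w : W) : (single v w).1 (v, w) = 1 := by
  simp [single]

theorem single_of_ne {v : V} {w : W} {p : V × W} (h : p ≠ (v, w)) : (single v w).1 p = 0 := by
  simp [single, h]

theorem single_mem_ball {S : Set V} {T : Set W} {v : V} {w : W} (hv : v ∈ S) (hw : w ∈ T) :
    single v w ∈ ball S T := by
  classical
  refine ⟨fun p hp => ?_, fun s => ?_⟩
  · by_contra h
    exact hp (single_of_ne fun h' => h (by rw [h']; exact ⟨hv, hw⟩))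
  · calc ∑ p ∈ s, ‖(single v w).1 p‖ ≤ ∑ p ∈ s, if p = (v, w) then (1 : ℝ) else 0 :=
        Finset.sum_le_sum fun p _ => by
          by_cases h : p = (v, w)
          · subst h; simp [single_self]
          · simp [single_of_ne h, h]
      _ ≤ 1 := by
        rw [Finset.sum_ite_eq']
        split_ifs <;> norm_num

end FormalTensor

/-- The relations expressing bilinearity of `v ⊗ w`. -/
inductive TensorRel : FormalTensor V W → Prop
  | add_left (v v' : V) (w : W) : TensorRel (FormalTensor.single (v + v') w -
      FormalTensor.single v w - FormalTensor.single v' w)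
  | add_right (v : V) (w w' : W) : TensorRel (FormalTensor.single v (w + w') -
      FormalTensor.single v w - FormalTensor.single v w')
  | smul_left (a : ℂ) (v : V) (w : W) : TensorRel (FormalTensor.single (a • v) w -
      a • FormalTensor.single v w)
  | smul_right (a : ℂ) (v : V) (w : W) : TensorRel (FormalTensor.single v (a • w) -
      a • FormalTensor.single v w)

/-- The completed bornological tensor product of complete bornological vector spaces, the
universal target of bounded bilinear maps on `V × W` (see `BTensor.lift` and `BTensor.ext`). -/
def BTensor : Type _ := BQuot {x | TensorRel V W x}

namespace BTensor

instance : AddCommGroup (BTensor V W) := inferInstanceAs (AddCommGroup (BQuot _))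
instance : Module ℂ (BTensor V W) := inferInstanceAs (Module ℂ (BQuot _))
instance : Bornology (BTensor V W) := inferInstanceAs (Bornology (BQuot _))
instance : CompleteBornSpace (BTensor V W) := inferInstanceAs (CompleteBornSpace (BQuot _))

/-- The quotient map from formal tensors. -/
def proj : BLin (FormalTensor V W) (BTensor V W) := BQuot.mk _

theorem proj_surjective : Function.Surjective (proj V W) := BQuot.mk_surjective _

variable {V W}

theorem proj_eq_zero {x : FormalTensor V W} (h : TensorRel V W x) : proj V W x = 0 :=
  (BQuot.mk_eq_zero _).2 (subset_closedSpan _ h)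

/-- The universal bounded bilinear map `(v, w) ↦ v ⊗ w`. -/
def tmul : BLin V (BLin W (BTensor V W)) :=
  BLin.mk₂ (fun v w => proj V W (FormalTensor.single v w))
    (fun v v' w => by
      have := proj_eq_zero (TensorRel.add_left v v' w)
      rw [map_sub, map_sub, sub_sub, sub_eq_zero] at this
      exact this)
    (fun a v w => by
      have := proj_eq_zero (TensorRel.smul_left a v w)
      rw [map_sub, map_smul, sub_eq_zero] at this
      exact this)
    (fun v w w' => by
      have := proj_eq_zero (TensorRel.add_right v w w')
      rw [map_sub, map_sub, sub_sub, sub_eq_zero] at this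
      exact this)
    (fun a v w => by
      have := proj_eq_zero (TensorRel.smul_right a v w)
      rw [map_sub, map_smul, sub_eq_zero] at this
      exact this)
    (fun S T hS hT => by
      refine ((proj V W).bounded (FormalTensor.isBounded_ball hS hT 1 one_pos)).subset ?_
      rintro _ ⟨v, hv, w, hw, rfl⟩
      refine mem_image_of_mem _ ?_
      rw [Complex.ofReal_one, one_smul]
      exact FormalTensor.single_mem_ball hv hw)

variable {X : Type*} [AddCommGroup X] [Module ℂ X] [Bornology X] [CompleteBornSpace X]

theorem exists_sum (f : BLin V (BLin W X)) (c : FormalTensor V W) :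
    ∃ x, BTendsto (fun s : Finset (V × W) => ∑ p ∈ s, c.1 p • f p.1 p.2) atTop x := by
  obtain ⟨hc, S, T, hS, hT, h⟩ := c.2
  obtain ⟨U, hU, hUc, hST⟩ := exists_completant (f.bounded₂ hS hT)
  obtain ⟨x, hx, -⟩ := exists_bsum hU hUc c.1 (fun p => f p.1 p.2) hc fun p hp =>
    hST (mem_image2_of_mem (h p hp).1 (h p hp).2)
  exact ⟨x, hx⟩

theorem choose_mem (f : BLin V (BLin W X)) {S : Set V} {T : Set W} {U : Set X} (hU : IsBounded U)
    (hUc : IsCompletantDisk U) (h : ∀ v ∈ S, ∀ w ∈ T, f v w ∈ U) {C : ℝ} (hC : 0 < C)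
    {c : FormalTensor V W} (hc : c ∈ (C : ℂ) • FormalTensor.ball S T) :
    (exists_sum f c).choose ∈ ((1 + C : ℝ) : ℂ) • U := by
  obtain ⟨hcS, hcC⟩ := (FormalTensor.mem_scale_ball hC).1 hc
  obtain ⟨x, hx, hxC⟩ := exists_bsum hU hUc c.1 (fun p => f p.1 p.2) c.2.1 fun p hp =>
    h _ (hcS p hp).1 _ (hcS p hp).2
  rw [(exists_sum f c).choose_spec.unique hx]
  exact hxC C hcC

/-- The linear extension `∑ c (v, w) • f v w` of a bounded bilinear map `f` to formal tensors. -/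
def liftFormal (f : BLin V (BLin W X)) : BLin (FormalTensor V W) X where
  toFun c := (exists_sum f c).choose
  map_add' c d := by
    refine (exists_sum f (c + d)).choose_spec.unique ?_
    refine cast ?_ ((exists_sum f c).choose_spec.add (exists_sum f d).choose_spec)
    congr 1
    funext s
    rw [← Finset.sum_add_distrib]
    exact Finset.sum_congr rfl fun p _ => (add_smul _ _ _).symm
  map_smul' a c := by
    refine (exists_sum f (a • c)).choose_spec.unique ?_
    refine cast ?_ ((exists_sum f c).choose_spec.smul a)
    congr 1
    funext s
    rw [Finset.smul_sum]
    exact Finset.sum_congr rfl fun p _ => (mul_smul _ _ _).symm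
  bounded' B hB := by
    obtain ⟨S, T, C, hS, hT, hC, h⟩ := FormalTensor.isBounded_iff.1 hB
    obtain ⟨U, hU, hUc, hST⟩ := exists_completant (f.bounded₂ hS hT)
    refine (isBounded_smul ((1 + C : ℝ) : ℂ) hU).subset ?_
    rintro _ ⟨c, hc, rfl⟩
    exact choose_mem f hU hUc (fun v hv w hw => hST (mem_image2_of_mem hv hw)) hC (h hc)

theorem liftFormal_mem (f : BLin V (BLin W X)) {S : Set V} {T : Set W} {U : Set X}
    (hU : IsBounded U) (hUc : IsCompletantDisk U) (h : ∀ v ∈ S, ∀ w ∈ T, f v w ∈ U) {C : ℝ}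
    (hC : 0 < C) {c : FormalTensor V W} (hc : c ∈ (C : ℂ) • FormalTensor.ball S T) :
    liftFormal f c ∈ ((1 + C : ℝ) : ℂ) • U := choose_mem f hU hUc h hC hc

theorem liftFormal_single (f : BLin V (BLin W X)) (v : V) (w : W) :
    liftFormal f (FormalTensor.single v w) = f v w := by
  classical
  refine (exists_sum f (FormalTensor.single v w)).choose_spec.unique
    ⟨{0}, isBounded_singleton, ⟨singleton_nonempty _, by simp⟩, fun ε hε => ?_⟩
  filter_upwards [eventually_ge_atTop {(v, w)}] with s hs
  refine ⟨0, rfl, ?_⟩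
  rw [Finset.sum_eq_single_of_mem (v, w) (hs (Finset.mem_singleton_self _))
    (fun p _ hp => by rw [FormalTensor.single_of_ne hp, zero_smul]), FormalTensor.single_self]
  simp

/-- Bounded linear maps out of the tensor product from bounded bilinear maps. -/
def lift (f : BLin V (BLin W X)) : BLin (BTensor V W) X :=
  BQuot.lift (liftFormal f) (by
    rintro x (⟨v, v', w⟩ | ⟨v, w, w'⟩ | ⟨a, v, w⟩ | ⟨a, v, w⟩) <;>
      simp [liftFormal_single])

theorem lift_proj (f : BLin V (BLin W X)) (c : FormalTensor V W) :
    lift f (proj V W c) = liftFormal f c := rfl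

@[simp] theorem lift_tmul (f : BLin V (BLin W X)) (v : V) (w : W) :
    lift f (tmul v w) = f v w := liftFormal_single f v w

/-- Bounded linear maps on the tensor product are determined by their values on `v ⊗ w`. -/
theorem ext {f g : BLin (BTensor V W) X} (h : ∀ v w, f (tmul v w) = g (tmul v w)) : f = g := by
  have key : ∀ d : BLin (FormalTensor V W) X, (∀ v w, d (FormalTensor.single v w) = 0) →
      ∀ c, d c = 0 := by
    intro d hd c
    obtain ⟨hc, S, T, hS, hT, hcS⟩ := c.2
    refine eq_zero_of_scale
      (d.bounded (FormalTensor.isBounded_ball hS hT 1 one_pos)) fun ε hε => ?_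
    obtain ⟨s, hs⟩ := summable_iff_vanishing_norm.1 hc ε hε
    set e : FormalTensor V W := c - ∑ p ∈ s, c.1 p • FormalTensor.single p.1 p.2 with he
    have hde : d c = d e := by simp [he, hd]
    classical
    have hval : ∀ q, e.1 q = if q ∈ s then 0 else c.1 q := by
      intro q
      have h1 : e.1 q = c.1 q - ∑ p ∈ s, c.1 p * (FormalTensor.single p.1 p.2).1 q := by
        rw [he]
        simp
      rw [h1]
      split_ifs with hq
      · rw [Finset.sum_eq_single_of_mem q hq fun p _ hp => by
          rw [FormalTensor.single_of_ne (Ne.symm hp), mul_zero]]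
        rw [FormalTensor.single_self, mul_one, sub_self]
      · rw [Finset.sum_eq_zero, sub_zero]
        intro p hp
        rw [FormalTensor.single_of_ne (fun h => hq (by rw [h]; exact hp)), mul_zero]
    have hemem : e ∈ (ε : ℂ) • FormalTensor.ball S T := by
      refine (FormalTensor.mem_scale_ball hε).2 ⟨fun p hp => ?_, fun t => ?_⟩
      · rw [hval] at hp
        exact hcS p fun h0 => hp (by simp [h0])
      · have h1 : ∑ p ∈ t, ‖e.1 p‖ = ∑ p ∈ t \ s, ‖c.1 p‖ := by
          rw [Finset.sdiff_eq_filter, Finset.sum_filter]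
          refine Finset.sum_congr rfl fun p _ => ?_
          rw [hval]
          by_cases hp : p ∈ s <;> simp [hp]
        rw [h1]
        exact (le_abs_self _).trans (hs _ Finset.sdiff_disjoint).le
    rw [hde]
    obtain ⟨b, hb, hbe⟩ := hemem
    refine ⟨d b, mem_image_of_mem _ ?_, ?_⟩
    · rwa [Complex.ofReal_one, one_smul]
    · rw [← hbe]
      exact (map_smul d (ε : ℂ) b).symm
  refine BLin.ext fun x => ?_
  obtain ⟨c, rfl⟩ := proj_surjective V W x
  have := key ((f - g).comp (proj V W)) (fun v w => by
    rw [BLin.comp_apply, BLin.sub_apply, sub_eq_zero]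
    exact h v w) c
  rw [BLin.comp_apply, BLin.sub_apply, sub_eq_zero] at this
  exact this

theorem ext_apply {f g : BLin (BTensor V W) X} (h : ∀ v w, f (tmul v w) = g (tmul v w))
    (x : BTensor V W) : f x = g x := by rw [ext h]

/-- `lift` as a bounded linear map. -/
def liftB : BLin (BLin V (BLin W X)) (BLin (BTensor V W) X) where
  toFun := lift
  map_add' f g := ext fun v w => by simp
  map_smul' a f := ext fun v w => by simp
  bounded' L hL := by
    rw [BLin.isBounded_iff]
    intro B hB
    obtain ⟨B', hB', hBB'⟩ := (BQuot.isBounded_iff _).1 hB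
    obtain ⟨S, T, C, hS, hT, hC, h⟩ := FormalTensor.isBounded_iff.1 hB'
    obtain ⟨U, hU, hUc, hST⟩ := exists_completant
      (BLin.isBounded_iff.1 (BLin.isBounded_iff.1 hL S hS) T hT)
    refine (isBounded_smul ((1 + C : ℝ) : ℂ) hU).subset ?_
    rintro _ ⟨_, ⟨f, hf, rfl⟩, x, hx, rfl⟩
    obtain ⟨c, hc, rfl⟩ := hBB' hx
    exact liftFormal_mem f hU hUc
      (fun v hv w hw => hST (mem_image2_of_mem (mem_image2_of_mem hf hv) hw)) hC (h hc)

@[simp] theorem liftB_apply (f : BLin V (BLin W X)) : liftB f = lift f := rfl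

variable {V' W' X' : Type*} [AddCommGroup V'] [Module ℂ V'] [Bornology V']
  [AddCommGroup W'] [Module ℂ W'] [Bornology W']
  [AddCommGroup X'] [Module ℂ X'] [Bornology X'] [CompleteBornSpace X']
  [CompleteBornSpace V'] [CompleteBornSpace W']

/-- The tensor product `f ⊗ g` of bounded linear maps, as a bounded bilinear map in `f`, `g`. -/
def mapB : BLin (BLin V V') (BLin (BLin W W') (BLin (BTensor V W) (BTensor V' W'))) :=
  ((BLin.compB liftB).comp ((BLin.compB.flip (BLin.compB tmul)).comp
    (BLin.compB.comp BLin.compB.flip))).flip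

/-- The tensor product `f ⊗ g` of bounded linear maps. -/
def map (f : BLin V V') (g : BLin W W') : BLin (BTensor V W) (BTensor V' W') := mapB f g

@[simp] theorem map_tmul (f : BLin V V') (g : BLin W W') (v : V) (w : W) :
    map f g (tmul v w) = tmul (f v) (g w) := lift_tmul _ v w

@[simp] theorem mapB_apply (f : BLin V V') (g : BLin W W') : mapB f g = map f g := rfl

variable [CompleteBornSpace V] [CompleteBornSpace W]

/-- The flip `v ⊗ w ↦ w ⊗ v`. -/
def swap : BLin (BTensor V W) (BTensor W V) := lift tmul.flip

@[simp] theorem swap_tmul (v : V) (w : W) : swap (tmul v w) = tmul w v := lift_tmul _ v w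

/-- The slice map `ω ⊗ id : V ⊗ W → W` of a bounded functional `ω` on `V`. -/
def sliceLeft (ω : BLin V ℂ) : BLin (BTensor V W) W := lift (BLin.smulB.comp ω)

@[simp] theorem sliceLeft_tmul (ω : BLin V ℂ) (v : V) (w : W) :
    sliceLeft ω (tmul v w) = ω v • w := lift_tmul _ v w

/-- The slice map `id ⊗ ω : V ⊗ W → V` of a bounded functional `ω` on `W`. -/
def sliceRight (ω : BLin W ℂ) : BLin (BTensor V W) V := lift (BLin.smulB.comp ω).flip

@[simp] theorem sliceRight_tmul (ω : BLin W ℂ) (v : V) (w : W) :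
    sliceRight ω (tmul v w) = ω w • v := lift_tmul _ v w

/-- The associativity map `(v ⊗ w) ⊗ x ↦ v ⊗ (w ⊗ x)`. -/
def assoc : BLin (BTensor (BTensor V W) X) (BTensor V (BTensor W X)) :=
  lift (lift ((BLin.compB.flip tmul).comp (BLin.compB.comp tmul)))

@[simp] theorem assoc_tmul (v : V) (w : W) (x : X) :
    assoc (tmul (tmul v w) x) = tmul v (tmul w x) := by
  simp [assoc]

/-- The tensor product of two bounded bilinear maps,
`(v ⊗ v', w ⊗ w') ↦ f v w ⊗ g v' w'`. -/
def map₂ (f : BLin V (BLin W X)) (g : BLin V' (BLin W' X')) :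
    BLin (BTensor V V') (BLin (BTensor W W') (BTensor X X')) :=
  lift ((BLin.compB.flip g).comp (mapB.comp f))

@[simp] theorem map₂_tmul (f : BLin V (BLin W X)) (g : BLin V' (BLin W' X')) (v : V) (v' : V') :
    map₂ f g (tmul v v') = map (f v) (g v') := by
  simp [map₂]

attribute [irreducible] tmul lift mapB map map₂ swap sliceLeft sliceRight assoc

end BTensor

end Tensor

/-! ### Bornological algebras and their multipliers -/

/-- A bornological algebra: a complete bornological vector space over `ℂ` with an associative,
not necessarily unital, bounded multiplication. -/
class BornAlgebra (A : Type*) [NonUnitalRing A] [Module ℂ A] [IsScalarTower ℂ A A]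
    [SMulCommClass ℂ A A] [Bornology A] : Prop extends CompleteBornSpace A where
  isBounded_mul : ∀ {S T : Set A}, IsBounded S → IsBounded T → IsBounded (S * T)

instance : BornAlgebra ℂ where
  isBounded_mul {S T} hS hT := by
    obtain ⟨C, hC, hSC⟩ := hS.exists_pos_norm_le
    obtain ⟨D, hD, hTD⟩ := hT.exists_pos_norm_le
    refine isBounded_iff_forall_norm_le.2 ⟨C * D, ?_⟩
    rintro _ ⟨x, hx, y, hy, rfl⟩
    rw [norm_mul]
    gcongr
    · exact hSC x hx
    · exact hTD y hy

section Algebra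

variable {A B : Type*}
  [NonUnitalRing A] [Module ℂ A] [IsScalarTower ℂ A A] [SMulCommClass ℂ A A] [Bornology A]
  [BornAlgebra A]
  [NonUnitalRing B] [Module ℂ B] [IsScalarTower ℂ B B] [SMulCommClass ℂ B B] [Bornology B]
  [BornAlgebra B]

/-- The multiplication as a bounded bilinear map. -/
def mulB : BLin A (BLin A A) :=
  BLin.mk₂ (fun a b => a * b) add_mul (fun c a b => smul_mul_assoc c a b) mul_add
    (fun c a b => mul_smul_comm c a b) fun _ _ hS hT => BornAlgebra.isBounded_mul hS hT

@[simp] theorem mulB_apply (a b : A) : mulB a b = a * b := rfl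

namespace BTensor

instance : Mul (BTensor A B) := ⟨fun x y => map₂ mulB mulB x y⟩

theorem mul_def (x y : BTensor A B) : x * y = map₂ mulB mulB x y := rfl

@[simp] theorem tmul_mul_tmul (a a' : A) (b b' : B) :
    (tmul a b * tmul a' b' : BTensor A B) = tmul (a * a') (b * b') := by
  simp [mul_def]

/-- The multiplication `(a ⊗ b) (a' ⊗ b') = a a' ⊗ b b'` on the tensor product. -/
instance : NonUnitalRing (BTensor A B) where
  left_distrib x y z := by simp [mul_def]
  right_distrib x y z := by simp [mul_def]
  zero_mul x := by simp [mul_def]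
  mul_zero x := by simp [mul_def]
  mul_assoc x y z := by
    set M : BLin (BTensor A B) (BLin (BTensor A B) (BTensor A B)) := map₂ mulB mulB with hM
    have hMm : ∀ x y : BTensor A B, M x y = x * y := fun _ _ => rfl
    have h1 : ∀ a b a' b' z, (tmul a b * tmul a' b' : BTensor A B) * z =
        tmul a b * (tmul a' b' * z) := fun a b a' b' =>
      ext_apply (f := M (tmul a b * tmul a' b')) (g := (M (tmul a b)).comp (M (tmul a' b')))
        fun a'' b'' => by simp [hMm, mul_assoc]
    have h2 : ∀ a b y z, (tmul a b * y : BTensor A B) * z = tmul a b * (y * z) := fun a b y z =>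
      ext_apply (f := (M.flip z).comp (M (tmul a b))) (g := (M (tmul a b)).comp (M.flip z))
        (fun a' b' => by simpa [hMm] using h1 a b a' b' z) y
    exact ext_apply (f := (M.flip z).comp (M.flip y)) (g := M.flip (M y z))
        (fun a b => by simpa [hMm] using h2 a b y z) x

instance : IsScalarTower ℂ (BTensor A B) (BTensor A B) :=
  ⟨fun c x y => by simp [mul_def]⟩

instance : SMulCommClass ℂ (BTensor A B) (BTensor A B) :=
  ⟨fun c x y => by simp [mul_def]⟩

instance : BornAlgebra (BTensor A B) where
  isBounded_mul hS hT := (map₂ mulB mulB : BLin (BTensor A B) _).bounded₂ hS hT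

end BTensor

end Algebra

/-- A multiplier of a bornological algebra: a pair of a left multiplier `L` and a right
multiplier `R` with `a L(b) = R(a) b`. One thinks of `L a = m · a` and `R a = a · m`. -/
structure Multiplier (A : Type*) [NonUnitalRing A] [Module ℂ A] [Bornology A] where
  L : BLin A A
  R : BLin A A
  L_mul : ∀ a b, L (a * b) = L a * b
  R_mul : ∀ a b, R (a * b) = a * R b
  mul_L : ∀ a b, a * L b = R a * b

namespace Multiplier

section Structure

variable {A : Type*} [NonUnitalRing A] [Module ℂ A] [IsScalarTower ℂ A A] [SMulCommClass ℂ A A]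
  [Bornology A] [BornAlgebra A]

@[ext] theorem ext {m n : Multiplier A} (hL : ∀ a, m.L a = n.L a) (hR : ∀ a, m.R a = n.R a) :
    m = n := by
  cases m; cases n
  congr
  · exact BLin.ext hL
  · exact BLin.ext hR

instance : Zero (Multiplier A) := ⟨⟨0, 0, by simp, by simp, by simp⟩⟩

instance : One (Multiplier A) := ⟨⟨BLin.id A, BLin.id A, by simp, by simp, by simp⟩⟩

instance : Add (Multiplier A) := ⟨fun m n => ⟨m.L + n.L, m.R + n.R,
  by simp [m.L_mul, n.L_mul, add_mul], by simp [m.R_mul, n.R_mul, mul_add],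
  by simp [m.mul_L, n.mul_L, add_mul, mul_add]⟩⟩

instance : SMul ℂ (Multiplier A) := ⟨fun c m => ⟨c • m.L, c • m.R,
  by simp [m.L_mul, smul_mul_assoc], by simp [m.R_mul, mul_smul_comm],
  by simp [m.mul_L, mul_smul_comm, smul_mul_assoc]⟩⟩

instance : Neg (Multiplier A) := ⟨fun m => (-1 : ℂ) • m⟩

/-- The product of multipliers: `(m n) · a = m · (n · a)` and `a · (m n) = (a · m) · n`. -/
instance : Mul (Multiplier A) := ⟨fun m n => ⟨m.L.comp n.L, n.R.comp m.R,
  by simp [m.L_mul, n.L_mul], by simp [m.R_mul, n.R_mul], by simp [m.mul_L, n.mul_L]⟩⟩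

@[simp] theorem zero_L (a : A) : (0 : Multiplier A).L a = 0 := rfl
@[simp] theorem zero_R (a : A) : (0 : Multiplier A).R a = 0 := rfl
@[simp] theorem one_L (a : A) : (1 : Multiplier A).L a = a := rfl
@[simp] theorem one_R (a : A) : (1 : Multiplier A).R a = a := rfl
@[simp] theorem add_L (m n : Multiplier A) (a : A) : (m + n).L a = m.L a + n.L a := rfl
@[simp] theorem add_R (m n : Multiplier A) (a : A) : (m + n).R a = m.R a + n.R a := rfl
@[simp] theorem smul_L (c : ℂ) (m : Multiplier A) (a : A) : (c • m).L a = c • m.L a := rfl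
@[simp] theorem smul_R (c : ℂ) (m : Multiplier A) (a : A) : (c • m).R a = c • m.R a := rfl
@[simp] theorem mul_L_apply (m n : Multiplier A) (a : A) : (m * n).L a = m.L (n.L a) := rfl
@[simp] theorem mul_R_apply (m n : Multiplier A) (a : A) : (m * n).R a = n.R (m.R a) := rfl
@[simp] theorem neg_L (m : Multiplier A) (a : A) : (-m).L a = -m.L a := by
  change (-1 : ℂ) • m.L a = _
  simp
@[simp] theorem neg_R (m : Multiplier A) (a : A) : (-m).R a = -m.R a := by
  change (-1 : ℂ) • m.R a = _
  simp

instance : Ring (Multiplier A) where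
  add_assoc _ _ _ := by ext <;> simp [add_assoc]
  zero_add _ := by ext <;> simp
  add_zero _ := by ext <;> simp
  add_comm _ _ := by ext <;> simp [add_comm]
  neg_add_cancel _ := by ext <;> simp
  left_distrib _ _ _ := by ext <;> simp
  right_distrib _ _ _ := by ext <;> simp
  zero_mul _ := by ext <;> simp
  mul_zero _ := by ext <;> simp
  mul_assoc _ _ _ := by ext <;> simp
  one_mul _ := by ext <;> simp
  mul_one _ := by ext <;> simp
  nsmul := nsmulRec
  zsmul := zsmulRec

instance : Module ℂ (Multiplier A) where
  one_smul _ := by ext <;> simp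
  mul_smul _ _ _ := by ext <;> simp [mul_smul]
  smul_zero _ := by ext <;> simp
  smul_add _ _ _ := by ext <;> simp
  add_smul _ _ _ := by ext <;> simp [add_smul]
  zero_smul _ := by ext <;> simp

/-- The bornology on multipliers as pairs of bounded linear maps. -/
instance : Bornology (Multiplier A) := Bornology.induced fun m => (m.L, m.R)

theorem isBounded_iff {B : Set (Multiplier A)} :
    IsBounded B ↔ IsBounded (L '' B) ∧ IsBounded (R '' B) := by
  have h := isBounded_induced (f := fun m : Multiplier A => (m.L, m.R)) (s := B)
  rw [h, ← isBounded_image_fst_and_snd, image_image, image_image]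

/-- Left multiplication by multipliers, `m ↦ (a ↦ m · a)`. -/
def LB : BLin (Multiplier A) (BLin A A) where
  toFun := L
  map_add' _ _ := rfl
  map_smul' _ _ := rfl
  bounded' _ hS := (isBounded_iff.1 hS).1

/-- Right multiplication by multipliers, `m ↦ (a ↦ a · m)`. -/
def RB : BLin (Multiplier A) (BLin A A) where
  toFun := R
  map_add' _ _ := rfl
  map_smul' _ _ := rfl
  bounded' _ hS := (isBounded_iff.1 hS).2

@[simp] theorem LB_apply (m : Multiplier A) : LB m = m.L := rfl
@[simp] theorem RB_apply (m : Multiplier A) : RB m = m.R := rfl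

variable (A) in
/-- The canonical homomorphism from an algebra to its multiplier algebra. -/
def ι : BLin A (Multiplier A) where
  toFun a := ⟨mulB a, mulB.flip a, fun b c => (mul_assoc a b c).symm, fun b c => mul_assoc b c a,
    fun b c => (mul_assoc b a c).symm⟩
  map_add' a b := by ext x; exacts [add_mul a b x, mul_add x a b]
  map_smul' c a := by ext <;> simp
  bounded' S hS := isBounded_iff.2 ⟨by
    rw [image_image]
    exact mulB.bounded hS, by
    rw [image_image]
    exact mulB.flip.bounded hS⟩

@[simp] theorem ι_L (a b : A) : (ι A a).L b = a * b := rfl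
@[simp] theorem ι_R (a b : A) : (ι A a).R b = b * a := rfl

end Structure

section Tensor

variable {A B : Type*}
  [NonUnitalRing A] [Module ℂ A] [IsScalarTower ℂ A A] [SMulCommClass ℂ A A] [Bornology A]
  [BornAlgebra A]
  [NonUnitalRing B] [Module ℂ B] [IsScalarTower ℂ B B] [SMulCommClass ℂ B B] [Bornology B]
  [BornAlgebra B]

open BTensor

/-- The multiplier `m ⊗ n` of the tensor product of two algebras. -/
def tensor (m : Multiplier A) (n : Multiplier B) : Multiplier (BTensor A B) where
  L := map m.L n.L
  R := map m.R n.R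
  L_mul x y := by
    have h : ∀ a b y, map m.L n.L (tmul a b * y) = map m.L n.L (tmul a b) * y := fun a b =>
      ext_apply (f := (map m.L n.L).comp (mulB (tmul a b))) (g := mulB (map m.L n.L (tmul a b)))
        fun c d => by simp [m.L_mul, n.L_mul]
    exact ext_apply (f := (map m.L n.L).comp (mulB.flip y)) (g := (mulB.flip y).comp (map m.L n.L))
      (fun a b => h a b y) x
  R_mul x y := by
    have h : ∀ a b y, map m.R n.R (tmul a b * y) = tmul a b * map m.R n.R y := fun a b =>
      ext_apply (f := (map m.R n.R).comp (mulB (tmul a b)))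
        (g := (mulB (tmul a b)).comp (map m.R n.R))
        fun c d => by simp [m.R_mul, n.R_mul]
    exact ext_apply (f := (map m.R n.R).comp (mulB.flip y)) (g := mulB.flip (map m.R n.R y))
      (fun a b => h a b y) x
  mul_L x y := by
    have h : ∀ a b y, tmul a b * map m.L n.L y = map m.R n.R (tmul a b) * y := fun a b =>
      ext_apply (f := (mulB (tmul a b)).comp (map m.L n.L)) (g := mulB (map m.R n.R (tmul a b)))
        fun c d => by simp [m.mul_L, n.mul_L]
    exact ext_apply (f := mulB.flip (map m.L n.L y)) (g := (mulB.flip y).comp (map m.R n.R))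
      (fun a b => h a b y) x

@[simp] theorem tensor_L (m : Multiplier A) (n : Multiplier B) : (tensor m n).L = map m.L n.L := rfl

@[simp] theorem tensor_R (m : Multiplier A) (n : Multiplier B) : (tensor m n).R = map m.R n.R := rfl

variable {A' B' : Type*}
  [NonUnitalRing A'] [Module ℂ A'] [IsScalarTower ℂ A' A'] [SMulCommClass ℂ A' A'] [Bornology A']
  [BornAlgebra A']
  [NonUnitalRing B'] [Module ℂ B'] [IsScalarTower ℂ B' B'] [SMulCommClass ℂ B' B'] [Bornology B']
  [BornAlgebra B']

/-- The map `f ⊗ g : A ⊗ B → M(A' ⊗ B')`, `a ⊗ b ↦ f a ⊗ g b`, induced by maps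
`f : A → M(A')` and `g : B → M(B')`. -/
def tensorHom (f : BLin A (Multiplier A')) (g : BLin B (Multiplier B')) :
    BLin (BTensor A B) (Multiplier (BTensor A' B')) where
  toFun t :=
    { L := map₂ (LB.comp f) (LB.comp g) t
      R := map₂ (RB.comp f) (RB.comp g) t
      L_mul := fun x y => ext_apply
        (f := (map₂ (LB.comp f) (LB.comp g)).flip (x * y))
        (g := (mulB.flip y).comp ((map₂ (LB.comp f) (LB.comp g)).flip x))
        (fun a b => by simpa using (tensor (f a) (g b)).L_mul x y) t
      R_mul := fun x y => ext_apply
        (f := (map₂ (RB.comp f) (RB.comp g)).flip (x * y))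
        (g := (mulB x).comp ((map₂ (RB.comp f) (RB.comp g)).flip y))
        (fun a b => by simpa using (tensor (f a) (g b)).R_mul x y) t
      mul_L := fun x y => ext_apply
        (f := (mulB x).comp ((map₂ (LB.comp f) (LB.comp g)).flip y))
        (g := (mulB.flip y).comp ((map₂ (RB.comp f) (RB.comp g)).flip x))
        (fun a b => by simpa using (tensor (f a) (g b)).mul_L x y) t }
  map_add' s t := by ext <;> simp
  map_smul' c t := by ext <;> simp
  bounded' S hS := isBounded_iff.2 ⟨by
    rw [image_image]
    exact (map₂ (LB.comp f) (LB.comp g)).bounded hS, by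
    rw [image_image]
    exact (map₂ (RB.comp f) (RB.comp g)).bounded hS⟩

@[simp] theorem tensorHom_tmul (f : BLin A (Multiplier A')) (g : BLin B (Multiplier B')) (a : A)
    (b : B) : tensorHom f g (tmul a b) = tensor (f a) (g b) := by
  ext x
  · exact congrArg (fun h => h x) (map₂_tmul (LB.comp f) (LB.comp g) a b)
  · exact congrArg (fun h => h x) (map₂_tmul (RB.comp f) (RB.comp g) a b)

end Tensor

end Multiplier

/-! ### Essential algebras and essential homomorphisms -/

section Balanced

variable {A M N P : Type*} [AddCommGroup A] [Module ℂ A] [Bornology A]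
  [AddCommGroup M] [Module ℂ M] [Bornology M] [CompleteBornSpace M]
  [AddCommGroup N] [Module ℂ N] [Bornology N] [CompleteBornSpace N]
  [AddCommGroup P] [Module ℂ P] [Bornology P] [CompleteBornSpace P]

/-- The completed balanced tensor product `M ⊗_A N` of `M` with the right action `ρ` of `A` and
`N` with the left action `l` of `A`: the quotient of `M ⊗ N` by the closed subspace generated by
the elements `m a ⊗ n - m ⊗ a n`. -/
def BalancedTensor (ρ : BLin M (BLin A M)) (l : BLin A (BLin N N)) : Type _ :=
  BQuot {t : BTensor M N | ∃ m a n, t = BTensor.tmul (ρ m a) n - BTensor.tmul m (l a n)}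

namespace BalancedTensor

variable (ρ : BLin M (BLin A M)) (l : BLin A (BLin N N))

instance : AddCommGroup (BalancedTensor ρ l) := inferInstanceAs (AddCommGroup (BQuot _))
instance : Module ℂ (BalancedTensor ρ l) := inferInstanceAs (Module ℂ (BQuot _))
instance : Bornology (BalancedTensor ρ l) := inferInstanceAs (Bornology (BQuot _))
instance : CompleteBornSpace (BalancedTensor ρ l) := inferInstanceAs (CompleteBornSpace (BQuot _))

/-- The quotient map `M ⊗ N → M ⊗_A N`. -/
def mk : BLin (BTensor M N) (BalancedTensor ρ l) := BQuot.mk _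

theorem mk_surjective : Function.Surjective (mk ρ l) := BQuot.mk_surjective _

variable {ρ l}

/-- The map on `M ⊗_A N` induced by a balanced bounded bilinear map. -/
def lift (β : BLin M (BLin N P)) (h : ∀ m a n, β (ρ m a) n = β m (l a n)) :
    BLin (BalancedTensor ρ l) P :=
  BQuot.lift (BTensor.lift β) (by
    rintro _ ⟨m, a, n, rfl⟩
    simp [h])

@[simp] theorem lift_mk (β : BLin M (BLin N P)) (h : ∀ m a n, β (ρ m a) n = β m (l a n))
    (t : BTensor M N) : lift β h (mk ρ l t) = BTensor.lift β t := rfl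

end BalancedTensor

end Balanced

section Essential

variable {A B : Type*}
  [NonUnitalRing A] [Module ℂ A] [IsScalarTower ℂ A A] [SMulCommClass ℂ A A] [Bornology A]
  [BornAlgebra A]
  [NonUnitalRing B] [Module ℂ B] [IsScalarTower ℂ B B] [SMulCommClass ℂ B B] [Bornology B]
  [BornAlgebra B]

variable (A) in
/-- A (nonzero) bornological algebra is essential if the multiplication induces an
isomorphism `A ⊗_A A ≅ A`. -/
def IsEssentialAlgebra : Prop :=
  Nontrivial A ∧ (BalancedTensor.lift (ρ := mulB) (l := mulB) (mulB : BLin A (BLin A A))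
    (fun a b c => mul_assoc a b c)).IsIso

/-- The left action `(a, b) ↦ f(a) · b` of `A` on `B` defined by `f : A → M(B)`. -/
def leftAction (f : BLin A (Multiplier B)) : BLin A (BLin B B) := Multiplier.LB.comp f

/-- The right action `(b, a) ↦ b · f(a)` of `A` on `B` defined by `f : A → M(B)`. -/
def rightAction (f : BLin A (Multiplier B)) : BLin B (BLin A B) := (Multiplier.RB.comp f).flip

@[simp] theorem leftAction_apply (f : BLin A (Multiplier B)) (a : A) (b : B) :
    leftAction f a b = (f a).L b := rfl

@[simp] theorem rightAction_apply (f : BLin A (Multiplier B)) (a : A) (b : B) :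
    rightAction f b a = (f a).R b := rfl

theorem leftAction_mul {f : BLin A (Multiplier B)} (hf : ∀ a b, f (a * b) = f a * f b)
    (a a' : A) (b : B) : leftAction f (mulB a a') b = leftAction f a (leftAction f a' b) := by
  simp [hf]

theorem rightAction_mul {f : BLin A (Multiplier B)} (hf : ∀ a b, f (a * b) = f a * f b)
    (b : B) (a a' : A) : rightAction f (rightAction f b a) a' = rightAction f b (mulB a a') := by
  simp [hf]

/-- Essential homomorphisms `f : A → M(B)`: the canonical maps `A ⊗_A B → B` and `B ⊗_A A → B`
are isomorphisms. -/
structure IsEssentialHom (f : BLin A (Multiplier B)) : Prop where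
  map_mul : ∀ a b, f (a * b) = f a * f b
  left : (BalancedTensor.lift (ρ := mulB) (l := leftAction f) (leftAction f)
    (leftAction_mul map_mul)).IsIso
  right : (BalancedTensor.lift (ρ := rightAction f) (l := mulB) (rightAction f)
    (rightAction_mul map_mul)).IsIso

/-- `n ∈ M(B)` is the value at `m ∈ M(A)` of the canonical extension `M(A) → M(B)` of a
homomorphism `f : A → M(B)`: `n f(a) b = f(m a) b` and `b f(a) n = b f(a m)`. For essential `f`,
there is exactly one such `n`, see `IsEssentialHom.existsUnique_extendsAt`. -/
def ExtendsAt (f : BLin A (Multiplier B)) (m : Multiplier A) (n : Multiplier B) : Prop :=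
  (∀ a b, n.L ((f a).L b) = (f (m.L a)).L b) ∧ ∀ a b, n.R ((f a).R b) = (f (m.R a)).R b

namespace IsEssentialHom

variable {f : BLin A (Multiplier B)}
  {P : Type*} [AddCommGroup P] [Module ℂ P] [Bornology P] [CompleteBornSpace P]

theorem ext_left (hf : IsEssentialHom f) {g h : BLin B P} (H : ∀ a b, g ((f a).L b) = h ((f a).L b)) (b : B) :
    g b = h b := by
  obtain ⟨k, -, hk⟩ := hf.left
  rw [← hk b]
  obtain ⟨t, ht⟩ := BalancedTensor.mk_surjective _ _ (k b)
  rw [← ht, BalancedTensor.lift_mk]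
  exact BTensor.ext_apply (f := g.comp (BTensor.lift (leftAction f)))
    (g := h.comp (BTensor.lift (leftAction f))) (fun a b => by simpa using H a b) t

theorem ext_right (hf : IsEssentialHom f) {g h : BLin B P} (H : ∀ a b, g ((f a).R b) = h ((f a).R b)) (b : B) :
    g b = h b := by
  obtain ⟨k, -, hk⟩ := hf.right
  rw [← hk b]
  obtain ⟨t, ht⟩ := BalancedTensor.mk_surjective _ _ (k b)
  rw [← ht, BalancedTensor.lift_mk]
  exact BTensor.ext_apply (f := g.comp (BTensor.lift (rightAction f)))
    (g := h.comp (BTensor.lift (rightAction f))) (fun b a => by simpa using H a b) t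

theorem exists_left (hf : IsEssentialHom f) (m : Multiplier A) :
    ∃ g : BLin B B, ∀ a b, g ((f a).L b) = (f (m.L a)).L b := by
  obtain ⟨k, hk, -⟩ := hf.left
  have hbal : ∀ a a' b, (leftAction f).comp m.L (mulB a a') b =
      (leftAction f).comp m.L a (leftAction f a' b) := fun a a' b => by
    simp [m.L_mul, hf.map_mul]
  refine ⟨(BalancedTensor.lift ((leftAction f).comp m.L) hbal).comp k, fun a b => ?_⟩
  have h1 : (f a).L b = BalancedTensor.lift (leftAction f) (leftAction_mul hf.map_mul)
      (BalancedTensor.mk mulB (leftAction f) (BTensor.tmul a b)) := by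
    rw [BalancedTensor.lift_mk, BTensor.lift_tmul, leftAction_apply]
  rw [BLin.comp_apply, h1, hk, BalancedTensor.lift_mk, BTensor.lift_tmul, BLin.comp_apply,
    leftAction_apply]

theorem exists_right (hf : IsEssentialHom f) (m : Multiplier A) :
    ∃ g : BLin B B, ∀ a b, g ((f a).R b) = (f (m.R a)).R b := by
  obtain ⟨k, hk, -⟩ := hf.right
  have hbal : ∀ b a a', ((rightAction f).flip.comp m.R).flip (rightAction f b a) a' =
      ((rightAction f).flip.comp m.R).flip b (mulB a a') := fun b a a' => by
    simp [m.R_mul, hf.map_mul]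
  refine ⟨(BalancedTensor.lift ((rightAction f).flip.comp m.R).flip hbal).comp k, fun a b => ?_⟩
  have h1 : (f a).R b = BalancedTensor.lift (rightAction f) (rightAction_mul hf.map_mul)
      (BalancedTensor.mk (rightAction f) mulB (BTensor.tmul b a)) := by
    rw [BalancedTensor.lift_mk, BTensor.lift_tmul, rightAction_apply]
  rw [BLin.comp_apply, h1, hk, BalancedTensor.lift_mk, BTensor.lift_tmul, BLin.flip_apply,
    BLin.comp_apply, BLin.flip_apply, rightAction_apply]

theorem existsUnique_extendsAt (hf : IsEssentialHom f) (m : Multiplier A) : ∃! n, ExtendsAt f m n := by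
  obtain ⟨g, hg⟩ := hf.exists_left m
  obtain ⟨h, hh⟩ := hf.exists_right m
  refine ⟨⟨g, h, fun x y => ?_, fun x y => ?_, fun x y => ?_⟩, ⟨hg, hh⟩, fun n hn => ?_⟩
  · refine hf.ext_left (g := g.comp (mulB.flip y)) (h := (mulB.flip y).comp g) (fun a b => ?_) x
    simp [← Multiplier.L_mul, hg]
  · refine hf.ext_right (g := h.comp (mulB x)) (h := (mulB x).comp h) (fun a b => ?_) y
    simp [← Multiplier.R_mul, hh]
  · refine hf.ext_left (g := (mulB x).comp g) (h := mulB (h x)) (fun a b => ?_) y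
    refine hf.ext_right (g := mulB.flip (g ((f a).L b))) (h := (mulB.flip ((f a).L b)).comp h)
      (fun c d => ?_) x
    have h1 : f (c * m.L a) = f (m.R c * a) := by rw [m.mul_L]
    rw [hf.map_mul, hf.map_mul] at h1
    simp only [BLin.flip_apply, mulB_apply, BLin.comp_apply, hg, hh, ← Multiplier.mul_L]
    rw [← Multiplier.mul_L_apply, h1, Multiplier.mul_L_apply]
  · refine Multiplier.ext (hf.ext_left fun a b => ?_) (hf.ext_right fun a b => ?_)
    · rw [hn.1, hg]
    · rw [hn.2, hh]

end IsEssentialHom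

/-- `n ∈ M(A)` is the value at `m ∈ M(A)` of the canonical extension `M(A) → M(A)` of an algebra
antiautomorphism `θ` of `A`: `n θ(a) = θ(a m)` and `θ(a) n = θ(m a)`. -/
def AntiExtendsAt (θ : BLin A A) (m n : Multiplier A) : Prop :=
  (∀ a, n.L (θ a) = θ (m.R a)) ∧ ∀ a, n.R (θ a) = θ (m.L a)

/-- Faithful functionals. -/
def IsFaithful (ω : BLin A ℂ) : Prop :=
  (∀ a, (∀ b, ω (a * b) = 0) → a = 0) ∧ ∀ b, (∀ a, ω (a * b) = 0) → b = 0

end Essential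

/-! ### The approximation property -/

section Approximation

variable (V : Type*) [AddCommGroup V] [Module ℂ V] [Bornology V]

variable {V} in
/-- Finite rank operators: finite sums of operators `x ↦ ω(x) w` with `ω` a bounded functional. -/
def IsFiniteRank (f : BLin V V) : Prop :=
  ∃ (n : ℕ) (w : Fin n → V) (ω : Fin n → BLin V ℂ), ∀ x, f x = ∑ i, ω i x • w i

variable {V} in
/-- Compact subsets of a complete bornological vector space: subsets which are (sequentially)
compact in the Banach space spanned by some small completant disk `T`. -/
def IsBornCompact (S : Set V) : Prop :=
  ∃ T : Set V, IsBounded T ∧ IsCompletantDisk T ∧ S ⊆ Submodule.span ℂ T ∧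
    ∀ u : ℕ → V, (∀ n, u n ∈ S) → ∃ x ∈ S, ∃ k : ℕ → ℕ, StrictMono k ∧
      ∀ ε : ℝ, 0 < ε → ∃ N, ∀ n ≥ N, u (k n) - x ∈ (ε : ℂ) • T

/-- The approximation property: on each compact disk `S`, the identity is the limit of a sequence
of finite rank operators, uniformly on `S` in the bornological sense, i.e. in `Hom(⟨S⟩, V)`. -/
def ApproximationProperty : Prop :=
  ∀ S : Set V, IsDisk S → IsBornCompact S → ∃ f : ℕ → BLin V V, (∀ n, IsFiniteRank (f n)) ∧
    ∃ T : Set V, IsBounded T ∧ IsDisk T ∧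
      ∀ ε : ℝ, 0 < ε → ∃ N, ∀ n ≥ N, ∀ x ∈ S, f n x - x ∈ (ε : ℂ) • T

end Approximation

/-! ### Bornological quantum groups -/

section QuantumGroup

variable {H : Type*} [NonUnitalRing H] [Module ℂ H] [IsScalarTower ℂ H H] [SMulCommClass ℂ H H]
  [Bornology H] [BornAlgebra H]

open BTensor Multiplier

/-- Coassociativity `(Δ ⊗ id) Δ = (id ⊗ Δ) Δ`, where `Δ ⊗ id` and `id ⊗ Δ` are extended to
`M(H ⊗ H)` and `(H ⊗ H) ⊗ H` is identified with `H ⊗ (H ⊗ H)`. -/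
def IsCoassociative (Δ : BLin H (Multiplier (BTensor H H))) : Prop :=
  ∀ f : H, ∃ (m : Multiplier (BTensor (BTensor H H) H)) (n : Multiplier (BTensor H (BTensor H H))),
    ExtendsAt (tensorHom Δ (ι H)) (Δ f) m ∧ ExtendsAt (tensorHom (ι H) Δ) (Δ f) n ∧
      (∀ t, assoc (m.L t) = n.L (assoc t)) ∧ ∀ t, assoc (m.R t) = n.R (assoc t)

/-- A comultiplication: a coassociative essential homomorphism `H → M(H ⊗ H)`. -/
structure IsComultiplication (Δ : BLin H (Multiplier (BTensor H H))) : Prop where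
  essential : IsEssentialHom Δ
  coassoc : IsCoassociative Δ

variable (H) in
/-- A bornological quantum group: an essential bornological algebra `H` with the approximation
property, a comultiplication `Δ` all of whose Galois maps `γl`, `γr`, `ρl`, `ρr` are bornological
isomorphisms of `H ⊗ H`, and a faithful left invariant functional `φ`. -/
structure BornQuantumGroup where
  essential : IsEssentialAlgebra H
  approximation : ApproximationProperty H
  /-- the comultiplication -/
  Δ : BLin H (Multiplier (BTensor H H))
  comul : IsComultiplication Δ
  /-- the Galois map `f ⊗ g ↦ Δ(f) (g ⊗ 1)` -/
  γl : BLin (BTensor H H) (BTensor H H)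
  γl_spec : ∀ f g, ι _ (γl (tmul f g)) = Δ f * tensor (ι H g) 1
  γl_isIso : γl.IsIso
  /-- the Galois map `f ⊗ g ↦ Δ(f) (1 ⊗ g)` -/
  γr : BLin (BTensor H H) (BTensor H H)
  γr_spec : ∀ f g, ι _ (γr (tmul f g)) = Δ f * tensor 1 (ι H g)
  γr_isIso : γr.IsIso
  /-- the Galois map `f ⊗ g ↦ (f ⊗ 1) Δ(g)` -/
  ρl : BLin (BTensor H H) (BTensor H H)
  ρl_spec : ∀ f g, ι _ (ρl (tmul f g)) = tensor (ι H f) 1 * Δ g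
  ρl_isIso : ρl.IsIso
  /-- the Galois map `f ⊗ g ↦ (1 ⊗ f) Δ(g)` -/
  ρr : BLin (BTensor H H) (BTensor H H)
  ρr_spec : ∀ f g, ι _ (ρr (tmul f g)) = tensor 1 (ι H f) * Δ g
  ρr_isIso : ρr.IsIso
  /-- the left Haar functional -/
  φ : BLin H ℂ
  faithful : IsFaithful φ
  /-- `(id ⊗ φ) Δ(f) = φ(f) 1`, as left and as right multipliers -/
  left_invariant : ∀ f g, sliceRight φ (γl (tmul f g)) = φ f • g ∧
    sliceRight φ (ρl (tmul g f)) = φ f • g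

namespace BornQuantumGroup

variable (Q : BornQuantumGroup H)

/-- `m` is the multiplier `(id ⊗ ω) Δ(f)`, defined by
`m · g = (id ⊗ ω)(Δ(f) (g ⊗ 1))` and `g · m = (id ⊗ ω)((g ⊗ 1) Δ(f))`. -/
def IsRightSlice (ω : BLin H ℂ) (f : H) (m : Multiplier H) : Prop :=
  ∀ g, m.L g = sliceRight ω (Q.γl (tmul f g)) ∧ m.R g = sliceRight ω (Q.ρl (tmul g f))

/-- `m` is the multiplier `(ω ⊗ id) Δ(f)`, defined by
`m · g = (ω ⊗ id)(Δ(f) (1 ⊗ g))` and `g · m = (ω ⊗ id)((1 ⊗ g) Δ(f))`. -/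
def IsLeftSlice (ω : BLin H ℂ) (f : H) (m : Multiplier H) : Prop :=
  ∀ g, m.L g = sliceLeft ω (Q.γr (tmul f g)) ∧ m.R g = sliceLeft ω (Q.ρr (tmul g f))

/-- The counit: an essential algebra homomorphism `ε : H → ℂ` such that
`(ε ⊗ id) Δ = id = (id ⊗ ε) Δ`. -/
structure IsCounit (ε : BLin H ℂ) : Prop where
  essential : IsEssentialHom ((ι ℂ).comp ε)
  left : ∀ f, Q.IsLeftSlice ε f (ι H f)
  right : ∀ f, Q.IsRightSlice ε f (ι H f)

/-- The antipode with respect to `ε`: a linear isomorphism `S` of `H`, an antihomomorphism of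
algebras and of coalgebras (that is, `Δ S = (S ⊗ S) τ Δ`), such that
`μ (S ⊗ id) γr = ε ⊗ id` and `μ (id ⊗ S) ρl = id ⊗ ε`. -/
structure IsAntipode (ε : BLin H ℂ) (S : BLin H H) : Prop where
  isIso : S.IsIso
  map_mul : ∀ f g, S (f * g) = S g * S f
  comul : ∀ f, AntiExtendsAt ((BTensor.map S S).comp swap) (Q.Δ f) (Q.Δ (S f))
  left : ∀ t, BTensor.lift mulB (BTensor.map S (BLin.id H) (Q.γr t)) = sliceLeft ε t
  right : ∀ t, BTensor.lift mulB (BTensor.map (BLin.id H) S (Q.ρl t)) = sliceRight ε t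

/-- `δ` is the modular element: `(φ ⊗ id) Δ(f) = φ(f) δ` for all `f`. -/
def IsModularElement (δ : Multiplier H) : Prop :=
  ∀ f, Q.IsLeftSlice Q.φ f (Q.φ f • δ)

end BornQuantumGroup

end QuantumGroup

end BornQG

end

open BornQG

/-! The argument is Van Daele's for multiplier Hopf algebras, carried out in completed tensor
products. Everything is read off from the four Galois maps, and each identity of bounded linear maps
is checked on elementary tensors (`BTensor.ext_fun`, with boundedness left to `fun_prop`). Write
Δ(f) = f₁ ⊗ f₂ informally, and μ for the multiplication.

Two facts make cancellation possible. Faithfulness of φ makes H nondegenerate and separates its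
points by functionals. The approximation property ensures that slice maps detect elements of a
completed tensor product (`ApproximationProperty.slice_eq_zero`), so nondegeneracy passes to H ⊗ H,
and factors can be inserted in one leg and cancelled again. Coassociativity, an equation of
multipliers, thereby becomes an equation between Galois maps on three legs: `map_comulApply_γr`,
`leg12_ρl_γr`, `map_γr_γr`.

Counit: `leg12_ρl_γr` forces x ⊗ μγr⁻¹(y ⊗ c) = μρl⁻¹(x ⊗ y) ⊗ c. Hence μγr⁻¹ = ε ⊗ id and μρl⁻¹ =
id ⊗ ε for a single functional ε, and multiplicativity and uniqueness follow from bijectivity of γr.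

Antipode: (ε ⊗ id)γr⁻¹ should be f ⊗ g ↦ S(f)g. This map turns left multiplication by Δ(h) into the
scalar ε(h), which shows that S(f) lies in H and not only among the multipliers. The same
construction with γl gives the inverse of S. Compatibility with Δ says that f ↦ Δ(S(f)) and f ↦ (S ⊗
S)τΔ(f) are both convolution inverse to Δ; they agree by the pentagon equation (`Δ_antipode_L`).

Modular element: ψ = φS is right invariant, and strong left invariance (`antipode_sliceRight_γr`)
gives (φ ⊗ φ)((1 ⊗ f)Δ(g)) = ψ(f)φ(g). By faithfulness (φ ⊗ id)Δ(g) depends on g only through φ(g),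
so it is φ(g)δ. Slicing coassociativity by φ makes δ group-like, slicing by ε gives ε(δ) = 1, and
the antipode identities then yield S(δ)δ = 1 = δS(δ). -/

set_option linter.unusedSectionVars false

noncomputable section

open Bornology Set Filter
open scoped Pointwise

namespace BornQG

open CompleteBornSpace

/-! ### Bounded linearity as a predicate on functions. -/

section IsBLin

variable {V W X Y Z : Type*} [AddCommGroup V] [Module ℂ V] [Bornology V]
  [AddCommGroup W] [Module ℂ W] [Bornology W] [AddCommGroup X] [Module ℂ X] [Bornology X]
  [AddCommGroup Y] [Module ℂ Y] [Bornology Y] [AddCommGroup Z] [Module ℂ Z] [Bornology Z]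

/-- A function is bounded linear if it underlies a bounded linear map. -/
@[fun_prop] def IsBLin (F : V → W) : Prop := ∃ f : BLin V W, ∀ x, f x = F x

namespace IsBLin

@[fun_prop] theorem id : IsBLin (fun x : V => x) := ⟨BLin.id V, fun _ => rfl⟩

@[fun_prop] theorem blin (f : BLin V W) : IsBLin (fun x => f x) := ⟨f, fun _ => rfl⟩

@[fun_prop] theorem comp {G : W → X} {F : V → W} (hG : IsBLin G) (hF : IsBLin F) :
    IsBLin (fun x => G (F x)) := by
  obtain ⟨f, hf⟩ := hF
  obtain ⟨g, hg⟩ := hG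
  exact ⟨g.comp f, fun x => by rw [BLin.comp_apply, hf, hg]⟩

@[fun_prop] theorem apply_blin (f : BLin W X) {F : V → W} (hF : IsBLin F) :
    IsBLin (fun x => f (F x)) := (blin f).comp hF

@[fun_prop] theorem eval [CompleteBornSpace X] {F : V → BLin W X} (hF : IsBLin F) (w : W) :
    IsBLin (fun x => F x w) := by
  obtain ⟨f, hf⟩ := hF
  exact ⟨f.flip w, fun x => by rw [BLin.flip_apply, hf]⟩

@[fun_prop] theorem map_left [CompleteBornSpace X] [CompleteBornSpace Z] {F : V → BLin W X}
    (hF : IsBLin F) (g : BLin Y Z) : IsBLin (fun x => BTensor.map (F x) g) :=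
  by simpa using (blin (BTensor.mapB.flip g)).comp hF

@[fun_prop] theorem map_right [CompleteBornSpace X] [CompleteBornSpace Z] {F : V → BLin Y Z}
    (hF : IsBLin F) (g : BLin W X) : IsBLin (fun x => BTensor.map g (F x)) :=
  by simpa using (blin (BTensor.mapB g)).comp hF

@[fun_prop] theorem const_smul [CompleteBornSpace W] (c : ℂ) {F : V → W} (hF : IsBLin F) :
    IsBLin (fun x => c • F x) := by
  obtain ⟨f, hf⟩ := hF
  exact ⟨c • f, fun x => by rw [BLin.smul_apply, hf]⟩

@[fun_prop] theorem smul_const [CompleteBornSpace W] {F : V → ℂ} (hF : IsBLin F) (w : W) :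
    IsBLin (fun x => F x • w) := ((blin (BLin.smulB.flip w)).comp hF : _)

section Algebra

variable {A : Type*} [NonUnitalRing A] [Module ℂ A] [IsScalarTower ℂ A A] [SMulCommClass ℂ A A]
  [Bornology A] [BornAlgebra A]

@[fun_prop] theorem mul_const {F : V → A} (hF : IsBLin F) (a : A) : IsBLin (fun x => F x * a) :=
  ((blin (mulB.flip a)).comp hF : _)

@[fun_prop] theorem const_mul {F : V → A} (hF : IsBLin F) (a : A) : IsBLin (fun x => a * F x) :=
  ((blin (mulB a)).comp hF : _)

end Algebra

end IsBLin

/-- Bounded linear functions on a tensor product agree if they agree on elementary tensors. -/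
theorem BTensor.ext_fun [CompleteBornSpace X] {F G : BTensor V W → X}
    (h : ∀ v w, F (BTensor.tmul v w) = G (BTensor.tmul v w))
    (hF : IsBLin F := by fun_prop) (hG : IsBLin G := by fun_prop) (t : BTensor V W) :
    F t = G t := by
  obtain ⟨f, hf⟩ := hF
  obtain ⟨g, hg⟩ := hG
  rw [← hf, ← hg]
  exact BTensor.ext_apply (fun v w => by rw [hf, hg, h]) t

end IsBLin

/-! ### Reassociation, and operators acting on chosen legs of a triple tensor product. -/

namespace BTensor

variable {V W X Y Z : Type*} [AddCommGroup V] [Module ℂ V] [Bornology V] [CompleteBornSpace V]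
  [AddCommGroup W] [Module ℂ W] [Bornology W] [CompleteBornSpace W]
  [AddCommGroup X] [Module ℂ X] [Bornology X] [CompleteBornSpace X]
  [AddCommGroup Y] [Module ℂ Y] [Bornology Y] [CompleteBornSpace Y]
  [AddCommGroup Z] [Module ℂ Z] [Bornology Z] [CompleteBornSpace Z]

/-- The inverse associativity map `v ⊗ (w ⊗ x) ↦ (v ⊗ w) ⊗ x`. -/
def assocSymm : BLin (BTensor V (BTensor W X)) (BTensor (BTensor V W) X) :=
  lift (liftB.comp ((BLin.compB tmul).comp tmul))

@[simp] theorem assocSymm_tmul (v : V) (w : W) (x : X) :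
    assocSymm (tmul v (tmul w x)) = tmul (tmul v w) x := by
  simp [assocSymm]

@[simp] theorem assoc_assocSymm (t : BTensor V (BTensor W X)) : assoc (assocSymm t) = t := by
  revert t
  refine ext_fun fun v t => ?_
  revert t
  refine ext_fun fun w x => ?_
  simp

@[simp] theorem assocSymm_assoc (t : BTensor (BTensor V W) X) : assocSymm (assoc t) = t := by
  revert t
  refine ext_fun fun t x => ?_
  revert t
  refine ext_fun fun v w => ?_
  simp

@[simp] theorem swap_swap (t : BTensor V W) : swap (swap t) = t := by
  revert t
  refine ext_fun fun v w => ?_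
  simp

/-- An operator on `V ⊗ W` acting on the first two legs of `V ⊗ (W ⊗ X)`. -/
def leg12 (F : BLin (BTensor V W) (BTensor V W)) :
    BLin (BTensor V (BTensor W X)) (BTensor V (BTensor W X)) :=
  assoc.comp ((map F (BLin.id X)).comp assocSymm)

/-- An operator on `V ⊗ X` acting on the first and third leg of `V ⊗ (W ⊗ X)`. -/
def leg13 (F : BLin (BTensor V X) (BTensor V X)) :
    BLin (BTensor V (BTensor W X)) (BTensor V (BTensor W X)) :=
  (map (BLin.id V) swap).comp ((leg12 F).comp (map (BLin.id V) swap))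

theorem leg12_tmul (F : BLin (BTensor V W) (BTensor V W)) (v : V) (w : W) (x : X) :
    leg12 F (tmul v (tmul w x)) = assoc (tmul (F (tmul v w)) x) := by
  simp [leg12]

/-- `v ⊗ x ↦ v ⊗ (w ⊗ x)`. -/
def insertMid (w : W) : BLin (BTensor V X) (BTensor V (BTensor W X)) :=
  map (BLin.id V) (tmul w)

@[simp] theorem insertMid_tmul (v : V) (w : W) (x : X) :
    insertMid w (tmul v x) = tmul v (tmul w x) := by
  simp [insertMid]

theorem leg13_tmul (F : BLin (BTensor V X) (BTensor V X)) (v : V) (w : W) (x : X) :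
    leg13 F (tmul v (tmul w x)) = insertMid w (F (tmul v x)) := by
  simp only [leg13, BLin.comp_apply, map_tmul, swap_tmul, leg12_tmul, BLin.id_apply]
  generalize F (tmul v x) = t
  revert t
  refine ext_fun fun p q => ?_
  simp

end BTensor

/-! ### Separation of points by functionals -/

/-- A summable family of nonnegative numbers stays summable after multiplication with suitable
weights tending to infinity on its support. -/
theorem exists_weights {ι : Type*} {c : ι → ℝ} (hc0 : ∀ i, 0 ≤ c i) (hc : Summable c) :
    ∃ κ : ι → ℝ, (∀ i, 1 ≤ κ i) ∧ (Summable fun i => c i * κ i) ∧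
      ∀ C : ℝ, {i | c i ≠ 0 ∧ κ i ≤ C}.Finite := by
  classical
  have hvan : ∀ n : ℕ, ∃ s : Finset ι, ∀ t : Finset ι, Disjoint t s →
      ∑ i ∈ t, c i ≤ (1 / 2) ^ n := fun n => by
    obtain ⟨s, hs⟩ := summable_iff_vanishing_norm.1 hc ((1 / 2) ^ n) (by positivity)
    exact ⟨s, fun t ht => (le_abs_self _).trans (hs t ht).le⟩
  choose s hs using hvan
  set g : ℕ × ι → ℝ := fun p => if p.2 ∈ s p.1 then 0 else c p.2 with hg
  have hg0 : ∀ p, 0 ≤ g p := fun p => by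
    simp only [hg]
    split_ifs
    exacts [le_rfl, hc0 _]
  have hrow : ∀ n, Summable fun i => g (n, i) := fun n =>
    hc.of_nonneg_of_le (fun i => hg0 _) fun i => by
      simp only [hg]
      split_ifs
      exacts [hc0 _, le_rfl]
  have hrowle : ∀ n, ∑' i, g (n, i) ≤ (1 / 2) ^ n := fun n => by
    refine (hrow n).tsum_le_of_sum_le fun t => ?_
    refine le_trans (le_of_eq ?_) (hs n (t \ s n) Finset.sdiff_disjoint)
    rw [Finset.sdiff_eq_filter, Finset.sum_filter]
    refine Finset.sum_congr rfl fun i _ => ?_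
    by_cases hi : i ∈ s n <;> simp [hg, hi]
  have hgs : Summable g := (summable_prod_of_nonneg hg0).2 ⟨hrow,
    (summable_geometric_of_lt_one (by norm_num) (by norm_num : (1 / 2 : ℝ) < 1)).of_nonneg_of_le
      (fun n => tsum_nonneg fun i => hg0 _) hrowle⟩
  have hgs' : Summable fun p : ι × ℕ => g (p.2, p.1) := hgs.prod_symm
  set k : ι → ℕ → ℝ := fun i n => if i ∈ s n then 0 else 1 with hk
  have hk0 : ∀ i n, 0 ≤ k i n := fun i n => by
    simp only [hk]
    split_ifs
    exacts [le_rfl, zero_le_one]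
  have hgk : ∀ i n, g (n, i) = c i * k i n := fun i n => by
    by_cases hi : i ∈ s n <;> simp [hg, hk, hi]
  -- The weight of `i` is one plus the number of sets `s n` that miss `i`. Exchanging the order of
  -- summation bounds the weighted sum by that of `c` plus a geometric series. An infinite count,
  -- which `tsum` reads as 0, can occur only where `c i = 0`.
  refine ⟨fun i => 1 + ∑' n, k i n, fun i => ?_, ?_, fun C => ?_⟩
  · have h1 : 0 ≤ ∑' n, k i n := tsum_nonneg (hk0 i)
    linarith
  · have h1 := hc.add hgs'.prod
    refine h1.congr fun i => ?_
    rw [mul_add, mul_one, ← tsum_mul_left]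
    simp only [hgk]
  · obtain ⟨N, hN⟩ := exists_nat_gt C
    refine ((Finset.range N).biUnion s).finite_toSet.subset ?_
    rintro i ⟨hi, hiC⟩
    by_contra hcon
    simp only [Finset.coe_biUnion, mem_iUnion, Finset.mem_coe, Finset.mem_range, not_exists] at hcon
    have hks : Summable (k i) := by
      have h1 : Summable fun n => c i * k i n := by
        refine (hgs'.prod_factor i).congr fun n => hgk i n
      exact (summable_mul_left_iff hi).1 h1
    have h2 := hks.sum_le_tsum (Finset.range N) fun n _ => hk0 i n
    have h3 : ∑ n ∈ Finset.range N, k i n = N := by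
      rw [Finset.sum_congr rfl (g := fun _ => (1 : ℝ)) fun n hn => by
        simp [hk, hcon n (Finset.mem_range.1 hn)]]
      simp
    linarith

/-! ### Compact disks spanned by null sequences. -/

section Hull

variable {V : Type*} [AddCommGroup V] [Module ℂ V] [Bornology V] [CompleteBornSpace V]

/-- The bound `1 + C` of `exists_bsum` does not shrink with `C`. Dividing the coefficients by `C`,
using that bound for total mass 1, and scaling back gives a factor proportional to `C`, as
ε-estimates require. -/
theorem BTendsto.mem_scale {ι : Type*} {U : Set V} (hU : IsBounded U) (hUc : IsCompletantDisk U)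
    {c : ι → ℂ} {b : ι → V} (hb : ∀ i, c i ≠ 0 → b i ∈ U) {C : ℝ} (hC : 0 < C)
    (hc : ∀ s : Finset ι, ∑ i ∈ s, ‖c i‖ ≤ C) {x : V}
    (hx : BTendsto (fun s : Finset ι => ∑ i ∈ s, c i • b i) atTop x) :
    x ∈ ((2 * C : ℝ) : ℂ) • U := by
  have hne : (C : ℂ) ≠ 0 := by exact_mod_cast hC.ne'
  have hn : ∀ i, ‖(C : ℂ)⁻¹ * c i‖ = C⁻¹ * ‖c i‖ := fun i => by
    rw [norm_mul, norm_inv, Complex.norm_real, Real.norm_of_nonneg hC.le]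
  have hs : Summable fun i => ‖c i‖ := summable_of_sum_le (fun _ => norm_nonneg _) hc
  obtain ⟨y, hy, hyC⟩ := exists_bsum hU hUc (fun i => (C : ℂ)⁻¹ * c i) b
    (by simpa only [hn] using hs.mul_left C⁻¹) fun i hi => hb i (right_ne_zero_of_mul hi)
  have h1 := hyC 1 fun s => by
    simp only [hn]
    rw [← Finset.mul_sum, inv_mul_le_iff₀ hC]
    simpa using hc s
  have h2 : x = (C : ℂ) • y := by
    refine hx.unique ?_
    have h3 := hy.smul (C : ℂ)
    refine cast ?_ h3
    congr 1
    funext s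
    rw [Finset.smul_sum]
    refine Finset.sum_congr rfl fun i _ => ?_
    rw [smul_smul, mul_inv_cancel_left₀ hne]
  rw [h2, mul_comm, Complex.ofReal_mul, ← smul_smul]
  refine smul_mem_smul_set ?_
  norm_num at h1 ⊢
  exact h1

/-- The absolutely convex hull of a null sequence is compact. -/
theorem exists_isBornCompact_hull {ι : Type*} [Countable ι] {U : Set V} (hU : IsBounded U)
    (hUc : IsCompletantDisk U) (w : ι → V) (hw : ∀ i, w i ∈ U) (r : ι → ℝ) (hr0 : ∀ i, 0 ≤ r i)
    (hr : ∀ ε : ℝ, 0 < ε → {i | ε < r i}.Finite) :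
    ∃ K : Set V, IsDisk K ∧ IsBornCompact K ∧ ∀ i, (r i : ℂ) • w i ∈ K := by
  classical
  -- The hull is parametrised by the ℓ¹ unit ball. For coordinatewise convergence this is a closed
  -- subset of a product of discs, hence compact, and sequentially compact because `ι` is countable.
  set D : Set (ι → ℂ) := {a | ∀ s : Finset ι, ∑ i ∈ s, ‖a i‖ ≤ 1} with hD
  obtain ⟨R, hR, hrR⟩ : ∃ R : ℝ, 0 < R ∧ ∀ i, r i ≤ R := by
    have hfin := hr 1 one_pos
    obtain ⟨R, hR⟩ := (hfin.image r).bddAbove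
    refine ⟨max R 1, by positivity, fun i => ?_⟩
    by_cases hi : 1 < r i
    · exact (hR ⟨i, hi, rfl⟩).trans (le_max_left _ _)
    · exact (not_lt.1 hi).trans (le_max_right _ _)
  have hnorm : ∀ (a : ι → ℂ) i, ‖a i * r i‖ = ‖a i‖ * r i := fun a i => by
    rw [norm_mul, Complex.norm_real, Real.norm_of_nonneg (hr0 i)]
  have hsum : ∀ a ∈ D, Summable fun i => ‖a i * r i‖ := fun a ha => by
    have h1 : Summable fun i => ‖a i‖ := summable_of_sum_le (fun _ => norm_nonneg _) ha
    refine (h1.mul_right R).of_nonneg_of_le (fun _ => norm_nonneg _) fun i => ?_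
    rw [hnorm]
    exact mul_le_mul_of_nonneg_left (hrR i) (norm_nonneg _)
  have hex : ∀ a : ι → ℂ, ∃ x, a ∈ D →
      BTendsto (fun s : Finset ι => ∑ i ∈ s, (a i * r i) • w i) atTop x := fun a => by
    by_cases ha : a ∈ D
    · obtain ⟨x, hx, -⟩ := exists_bsum hU hUc (fun i => a i * r i) w (hsum a ha)
        fun i _ => hw i
      exact ⟨x, fun _ => hx⟩
    · exact ⟨0, fun h => absurd h ha⟩
  choose σ hσ using hex
  have hcomb : ∀ a ∈ D, ∀ b ∈ D, ∀ z z' : ℂ,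
      BTendsto (fun s : Finset ι => ∑ i ∈ s, ((z * a i + z' * b i) * r i) • w i) atTop
        (z • σ a + z' • σ b) := fun a ha b hb z z' => by
    refine cast ?_ (((hσ a ha).smul z).add ((hσ b hb).smul z'))
    congr 1
    funext s
    rw [Finset.smul_sum, Finset.smul_sum, ← Finset.sum_add_distrib]
    refine Finset.sum_congr rfl fun i _ => ?_
    rw [smul_smul, smul_smul, ← add_smul]
    congr 1
    ring
  have hDadd : ∀ a ∈ D, ∀ b ∈ D, ∀ z z' : ℂ, ‖z‖ + ‖z'‖ ≤ 1 →
      (fun i => z * a i + z' * b i) ∈ D := fun a ha b hb z z' hz s => by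
    calc ∑ i ∈ s, ‖z * a i + z' * b i‖ ≤ ∑ i ∈ s, (‖z‖ * ‖a i‖ + ‖z'‖ * ‖b i‖) :=
          Finset.sum_le_sum fun i _ => by
            rw [← norm_mul, ← norm_mul]; exact norm_add_le _ _
      _ = ‖z‖ * ∑ i ∈ s, ‖a i‖ + ‖z'‖ * ∑ i ∈ s, ‖b i‖ := by
          rw [Finset.sum_add_distrib, Finset.mul_sum, Finset.mul_sum]
      _ ≤ ‖z‖ * 1 + ‖z'‖ * 1 := by
          gcongr
          · exact ha s
          · exact hb s
      _ ≤ 1 := by linarith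
  have hDcompact : IsCompact D := by
    refine (isCompact_univ_pi fun _ : ι => isCompact_closedBall (0 : ℂ) 1).of_isClosed_subset ?_ ?_
    · simp only [hD, ofPred_forall]
      refine isClosed_iInter fun s => isClosed_le ?_ continuous_const
      fun_prop
    · intro a ha i _
      simpa using ha {i}
  have hspan : ∀ a ∈ D, σ a ∈ Submodule.span ℂ U := fun a ha => by
    obtain ⟨u, hu, hux⟩ := BTendsto.mem_scale hU hUc (C := R) (fun i _ => hw i) hR
      (fun s => by
        calc ∑ i ∈ s, ‖a i * r i‖ ≤ ∑ i ∈ s, ‖a i‖ * R := Finset.sum_le_sum fun i _ => by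
              rw [hnorm]; exact mul_le_mul_of_nonneg_left (hrR i) (norm_nonneg _)
          _ ≤ 1 * R := by rw [← Finset.sum_mul]; gcongr; exact ha s
          _ = R := one_mul R) (hσ a ha)
    rw [← hux]
    exact Submodule.smul_mem _ _ (Submodule.subset_span hu)
  refine ⟨σ '' D, ⟨⟨_, 0, fun s => by simp, rfl⟩, ?_⟩, ⟨U, hU, hUc, ?_, fun u hu => ?_⟩,
    fun i => ?_⟩
  · rintro _ ⟨a, ha, rfl⟩ _ ⟨b, hb, rfl⟩ z z' hz
    have h1 := hDadd a ha b hb z z' hz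
    exact ⟨_, h1, (hσ _ h1).unique (hcomb a ha b hb z z')⟩
  · rintro _ ⟨a, ha, rfl⟩
    exact hspan a ha
  · choose α hα hαu using hu
    obtain ⟨a, ha, k, hk, hlim⟩ := hDcompact.isSeqCompact hα
    refine ⟨σ a, ⟨a, ha, rfl⟩, k, hk, fun ε hε => ?_⟩
    -- Coordinatewise convergence suffices because `r` tends to 0. On the finite set `F` where `r`
    -- exceeds ε/8 the difference is eventually below ε/4; off `F` it is at most (1 + 1)·ε/8. The
    -- total is ε/2, which `BTendsto.mem_scale` doubles.
    set F := (hr (ε / 8) (by positivity)).toFinset with hF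
    have hlim' : Tendsto (fun n => ∑ i ∈ F, ‖α (k n) i - a i‖ * r i) atTop (nhds 0) := by
      rw [← Finset.sum_const_zero (s := F)]
      refine tendsto_finsetSum _ fun i _ => ?_
      have h1 := ((tendsto_pi_nhds.1 hlim i).sub_const (a i)).norm.mul_const (r i)
      simpa using h1
    obtain ⟨N, hN⟩ := eventually_atTop.1 (hlim'.eventually_lt_const (show (0 : ℝ) < ε / 4 by positivity))
    refine ⟨N, fun n hn => ?_⟩
    have h1 := hcomb _ (hα (k n)) a ha 1 (-1)
    rw [one_smul, neg_one_smul, ← sub_eq_add_neg, hαu] at h1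
    have h2 := BTendsto.mem_scale hU hUc (C := ε / 2) (fun i _ => hw i) (by positivity)
      (fun s => ?_) h1
    · rwa [mul_div_cancel₀ ε two_ne_zero] at h2
    · have e : ∀ i, ‖(1 * α (k n) i + -1 * a i) * r i‖ = ‖α (k n) i - a i‖ * r i := fun i => by
        rw [norm_mul, Complex.norm_real, Real.norm_of_nonneg (hr0 i)]
        congr 2
        ring
      simp only [e]
      rw [← Finset.sum_inter_add_sum_sdiff s F]
      have h3 : ∑ i ∈ s ∩ F, ‖α (k n) i - a i‖ * r i ≤ ε / 4 :=
        (Finset.sum_le_sum_of_subset_of_nonneg Finset.inter_subset_right fun i _ _ =>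
          mul_nonneg (norm_nonneg _) (hr0 i)).trans (hN n hn).le
      have h4 : ∑ i ∈ s \ F, ‖α (k n) i - a i‖ * r i ≤ (1 + 1) * (ε / 8) :=
        calc ∑ i ∈ s \ F, ‖α (k n) i - a i‖ * r i
            ≤ ∑ i ∈ s \ F, (‖α (k n) i‖ + ‖a i‖) * (ε / 8) := Finset.sum_le_sum fun i hi => by
              have : r i ≤ ε / 8 := by
                by_contra hcon
                exact (Finset.mem_sdiff.1 hi).2 ((Finite.mem_toFinset _).2 (not_le.1 hcon))
              exact mul_le_mul (norm_sub_le _ _) this (hr0 i) (by positivity)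
          _ ≤ (1 + 1) * (ε / 8) := by
              rw [← Finset.sum_mul, Finset.sum_add_distrib]
              gcongr
              · exact hα (k n) _
              · exact ha _
      linarith
  · have hmem : (Pi.single i 1 : ι → ℂ) ∈ D := fun s => by
      calc ∑ j ∈ s, ‖(Pi.single i 1 : ι → ℂ) j‖ = ∑ j ∈ s, if j = i then (1 : ℝ) else 0 :=
            Finset.sum_congr rfl fun j _ => by
              by_cases h : j = i
              · subst h; simp
              · simp [h]
        _ ≤ 1 := by rw [Finset.sum_ite_eq']; split_ifs <;> norm_num
    refine ⟨_, hmem, (hσ _ hmem).unique ⟨{0}, isBounded_singleton,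
      ⟨singleton_nonempty _, by simp⟩, fun ε hε => ?_⟩⟩
    filter_upwards [eventually_ge_atTop {i}] with s hs
    refine ⟨0, rfl, ?_⟩
    rw [Finset.sum_eq_single_of_mem i (hs (Finset.mem_singleton_self _))
      (fun j _ hj => by simp [Pi.single_eq_of_ne hj])]
    simp

end Hull

/-- Bounded functionals separate the points of `V`. -/
def Separated (V : Type*) [AddCommGroup V] [Module ℂ V] [Bornology V] : Prop :=
  ∀ v : V, (∀ ω : BLin V ℂ, ω v = 0) → v = 0

/-! ### Slice maps and the approximation property. -/

section Slice

variable {V W : Type*} [AddCommGroup V] [Module ℂ V] [Bornology V] [CompleteBornSpace V]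
  [AddCommGroup W] [Module ℂ W] [Bornology W] [CompleteBornSpace W]

open BTensor

theorem BTensor.lift_proj_btendsto {X : Type*} [AddCommGroup X] [Module ℂ X] [Bornology X]
    [CompleteBornSpace X] (f : BLin V (BLin W X)) (c : FormalTensor V W) :
    BTendsto (fun s : Finset (V × W) => ∑ p ∈ s, c.1 p • f p.1 p.2) atTop
      (lift f (proj V W c)) := by
  rw [lift_proj]
  exact (exists_sum f c).choose_spec

theorem BTensor.lift_tmul_self (t : BTensor V W) : lift tmul t = t := by
  revert t
  refine ext_fun fun v w => ?_
  simp

/-- By the approximation property, the slice maps separate the points of `V ⊗ W`. -/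
theorem ApproximationProperty.slice_eq_zero (hW : ApproximationProperty W) (t : BTensor V W)
    (h : ∀ ω : BLin W ℂ, sliceRight ω t = 0) : t = 0 := by
  classical
  obtain ⟨c, rfl⟩ := proj_surjective V W t
  obtain ⟨hc, S, T, hS, hT, hcST⟩ := c.2
  obtain ⟨U, hU, hUc, hTU⟩ := exists_completant hT
  -- In Σ c v ⊗ w, the weight κ is moved into the coefficients and κ⁻¹ into the second factors. The
  -- coefficients stay summable, while the vectors κ⁻¹w become a null sequence and so lie in a
  -- compact disk.
  obtain ⟨κ, hκ1, hκs, hκ⟩ := exists_weights (fun p => norm_nonneg (c.1 p)) hc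
  have hκ0 : ∀ p, 0 < κ p := fun p => one_pos.trans_le (hκ1 p)
  set I : Set (V × W) := {p | c.1 p ≠ 0} with hI
  have hcount : Countable I := by
    have := hc.countable_support
    refine (this.mono fun p hp => ?_).to_subtype
    exact norm_ne_zero_iff.2 hp
  obtain ⟨K, hKd, hKc, hK⟩ := exists_isBornCompact_hull hU hUc (fun i : I => i.1.2)
    (fun i => hTU (hcST _ i.2).2) (fun i => (κ i.1)⁻¹) (fun i => (inv_pos.2 (hκ0 _)).le)
    (fun ε hε => by
      refine Finite.of_finite_image ((hκ (1 / ε)).subset ?_) Subtype.val_injective.injOn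
      rintro _ ⟨i, hi, rfl⟩
      refine ⟨norm_ne_zero_iff.2 i.2, ?_⟩
      rw [le_div_iff₀ hε, ← le_div_iff₀' (hκ0 _), one_div]
      exact le_of_lt hi)
  obtain ⟨f, hf, T', hT', hT'd, hlim⟩ := hW K hKd hKc
  -- A finite rank operator on the second leg is a finite combination of slices, which all vanish
  -- here.
  have hzero : ∀ n, map (BLin.id V) (f n) (proj V W c) = 0 := fun n => by
    obtain ⟨m, w, ω, hfw⟩ := hf n
    have h1 : ∀ t : BTensor V W, map (BLin.id V) (f n) t =
        (∑ i, (tmul.flip (w i)).comp (sliceRight (ω i))) t := by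
      intro t
      refine ext_apply (fun v x => ?_) t
      have h2 : ∀ (s : Finset (Fin m)) (x : BTensor V W),
          (∑ i ∈ s, (tmul.flip (w i)).comp (sliceRight (ω i)) : BLin (BTensor V W) _) x =
            ∑ i ∈ s, tmul (sliceRight (ω i) x) (w i) := fun s x => by
        induction s using Finset.induction_on with
        | empty => simp
        | insert i s hi ih => rw [Finset.sum_insert hi, Finset.sum_insert hi, BLin.add_apply, ih]; rfl
      rw [h2, map_tmul, hfw, map_sum]
      refine Finset.sum_congr rfl fun i _ => ?_
      simp
    rw [h1]
    have h2 : ∀ s : Finset (Fin m),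
        (∑ i ∈ s, (tmul.flip (w i)).comp (sliceRight (ω i)) : BLin (BTensor V W) _) (proj V W c) = 0 :=
      fun s => by
        induction s using Finset.induction_on with
        | empty => simp
        | insert i s hi ih => rw [Finset.sum_insert hi, BLin.add_apply, ih, BLin.comp_apply, h]; simp
    exact h2 _
  obtain ⟨U', hU', hUc', hST'⟩ := exists_completant
    ((tmul : BLin V (BLin W (BTensor V W))).bounded₂ hS hT')
  set C : ℝ := (∑' p, ‖c.1 p‖ * κ p) + 1 with hC
  have hC0 : 0 < C := by
    have : 0 ≤ ∑' p, ‖c.1 p‖ * κ p :=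
      tsum_nonneg fun p => mul_nonneg (norm_nonneg _) (hκ0 p).le
    linarith
  refine eq_zero_of_scale hU' fun ε hε => ?_
  -- The weighted coefficients have total mass at most `C`, the added 1 keeping `C` positive. The
  -- tolerance ε/(2C) leaves total mass ε/2, and `BTendsto.mem_scale` turns this into ε. Since `id ⊗
  -- f N` kills the tensor, the error being estimated is minus the tensor itself.
  obtain ⟨N, hN⟩ := hlim (ε / (2 * C)) (by positivity)
  have h1 := lift_proj_btendsto (tmul : BLin V (BLin W (BTensor V W))) c
  have h2 := lift_proj_btendsto (V := V) ((BLin.compB.flip (f N)).comp tmul) c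
  have e2 : lift ((BLin.compB.flip (f N)).comp tmul) (proj V W c) =
      map (BLin.id V) (f N) (proj V W c) := ext_apply (fun v w => by simp) _
  rw [e2, hzero] at h2
  rw [lift_tmul_self] at h1
  have h3 := h2.add (h1.smul (-1))
  have hεC : ((ε / (2 * C) : ℝ) : ℂ) ≠ 0 := by
    have : ε / (2 * C) ≠ 0 := by positivity
    exact_mod_cast this
  have h4 : ∀ p, c.1 p ≠ 0 → ∃ u ∈ U', ((ε / (2 * C) : ℝ) : ℂ) • u =
      tmul p.1 ((κ p : ℂ)⁻¹ • (f N p.2 - p.2)) := fun p hp => by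
    obtain ⟨y, hy, hye⟩ := hN N le_rfl _ (hK ⟨p, hp⟩)
    refine ⟨tmul p.1 y, hST' (mem_image2_of_mem (hcST p hp).1 hy), ?_⟩
    rw [← map_smul]
    congr 1
    simp only at hye
    rw [hye, map_smul, smul_sub]
    push_cast
    rfl
  choose! u hu hue using h4
  have h5 : BTendsto (fun s : Finset (V × W) =>
      ∑ p ∈ s, (c.1 p * κ p * ((ε / (2 * C) : ℝ) : ℂ)) • u p) atTop
      (0 + (-1 : ℂ) • proj V W c) := by
    refine cast ?_ h3
    congr 1
    funext s
    rw [Finset.smul_sum, ← Finset.sum_add_distrib]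
    refine Finset.sum_congr rfl fun p _ => ?_
    by_cases hp : c.1 p = 0
    · simp [hp]
    · have hκp : (κ p : ℂ) ≠ 0 := by exact_mod_cast (hκ0 p).ne'
      rw [mul_smul, hue p hp, map_smul, mul_smul, smul_inv_smul₀ hκp, map_sub]
      simp only [BLin.comp_apply, BLin.flip_apply, BLin.compB_apply]
      module
  have h6 := h5.mem_scale (C := ε / 2) hU' hUc' (fun p hp => hu p fun h0 => hp (by simp [h0]))
    (by positivity) fun s => by
      have e : ∀ p, ‖c.1 p * κ p * ((ε / (2 * C) : ℝ) : ℂ)‖ = ‖c.1 p‖ * κ p * (ε / (2 * C)) :=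
        fun p => by
          rw [norm_mul, norm_mul, Complex.norm_real, Complex.norm_real,
            Real.norm_of_nonneg (hκ0 p).le, Real.norm_of_nonneg (by positivity)]
      simp only [e]
      rw [← Finset.sum_mul]
      calc (∑ p ∈ s, ‖c.1 p‖ * κ p) * (ε / (2 * C)) ≤ C * (ε / (2 * C)) := by
            gcongr
            have := hκs.sum_le_tsum s fun p _ => mul_nonneg (norm_nonneg (c.1 p)) (hκ0 p).le
            linarith
        _ = ε / 2 := by field_simp
  rw [mul_div_cancel₀ ε two_ne_zero, zero_add] at h6
  have h7 := hUc'.1.scale_neg hε.le h6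
  rwa [neg_one_smul, neg_neg] at h7

end Slice

/-! ### Joint injectivity of operators acting on one leg. -/

section SeparatedTensor

variable {V W : Type*} [AddCommGroup V] [Module ℂ V] [Bornology V] [CompleteBornSpace V]
  [AddCommGroup W] [Module ℂ W] [Bornology W] [CompleteBornSpace W]

open BTensor

/-- The functionals η ∘ (id ⊗ ω) already suffice: they first detect the slices, and the slices
detect the tensor. -/
theorem Separated.tensor_right (hV : Separated V) (hW : ApproximationProperty W) :
    Separated (BTensor V W) := fun t ht =>
  hW.slice_eq_zero t fun ω => hV _ fun η => ht (η.comp (sliceRight ω))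

/-- Slicing the untouched leg by η commutes with the `F i`, so joint injectivity kills every η-slice
of the difference. Exchanging the order of slicing, separation of `V` kills its ω-slices, and the
approximation property of `W` finishes. -/
theorem ApproximationProperty.map_id_ext (hW : ApproximationProperty W) (hV : Separated V)
    {ι : Type*} {F : ι → BLin W W} (hF : ∀ x, (∀ i, F i x = 0) → x = 0) {s t : BTensor V W}
    (h : ∀ i, map (BLin.id V) (F i) s = map (BLin.id V) (F i) t) : s = t := by
  have key : ∀ (η : BLin V ℂ), sliceLeft η (s - t) = 0 := fun η => hF _ fun i => by
    have h1 : ∀ t : BTensor V W, F i (sliceLeft η t) = sliceLeft η (map (BLin.id V) (F i) t) :=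
      ext_fun fun v w => by simp
    rw [h1, map_sub, h, sub_self, map_zero]
  refine sub_eq_zero.1 (hW.slice_eq_zero _ fun ω => hV _ fun η => ?_)
  have h1 : ∀ t : BTensor V W, η (sliceRight ω t) = ω (sliceLeft η t) :=
    ext_fun fun v w => by simp [mul_comm]
  rw [h1, key, map_zero]

/-- When the untouched leg has the approximation property, its slices alone are conclusive, and
neither leg needs to be separated. This serves triple tensor products, where `W` is H ⊗ H. -/
theorem ApproximationProperty.id_map_ext (hV : ApproximationProperty V)
    {ι : Type*} {F : ι → BLin W W} (hF : ∀ x, (∀ i, F i x = 0) → x = 0) {s t : BTensor V W}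
    (h : ∀ i, map (BLin.id V) (F i) s = map (BLin.id V) (F i) t) : s = t := by
  have h1 : swap (s - t) = 0 := hV.slice_eq_zero _ fun η => hF _ fun i => by
    have h1 : ∀ t : BTensor V W, F i (sliceRight η (swap t)) =
        sliceLeft η (map (BLin.id V) (F i) t) := ext_fun fun v w => by simp
    rw [h1, map_sub, h, sub_self, map_zero]
  rw [← sub_eq_zero, ← swap_swap (s - t), h1, map_zero]

theorem ApproximationProperty.map_ext_id (hW : ApproximationProperty W) (hV : Separated V)
    {ι : Type*} {F : ι → BLin W W} (hF : ∀ x, (∀ i, F i x = 0) → x = 0) {s t : BTensor W V}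
    (h : ∀ i, map (F i) (BLin.id V) s = map (F i) (BLin.id V) t) : s = t := by
  have h1 : swap s = swap t := hW.map_id_ext hV hF fun i => by
    have h2 : ∀ t : BTensor W V, map (BLin.id V) (F i) (swap t) = swap (map (F i) (BLin.id V) t) :=
      ext_fun fun v w => by simp
    rw [h2, h2, h]
  rw [← swap_swap s, h1, swap_swap]

end SeparatedTensor

/-! ### Multiplication in a single leg. -/

section LegMultiplication

variable {A V : Type*} [NonUnitalRing A] [Module ℂ A] [IsScalarTower ℂ A A] [SMulCommClass ℂ A A]
  [Bornology A] [BornAlgebra A] [AddCommGroup V] [Module ℂ V] [Bornology V] [CompleteBornSpace V]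

open BTensor

/-- `x ⊗ y ↦ a x ⊗ y`. -/
def lmulFst (a : A) : BLin (BTensor A V) (BTensor A V) := map (mulB a) (BLin.id V)

/-- `x ⊗ y ↦ x a ⊗ y`. -/
def rmulFst (a : A) : BLin (BTensor A V) (BTensor A V) := map (mulB.flip a) (BLin.id V)

/-- `x ⊗ y ↦ x ⊗ a y`. -/
def lmulSnd (a : A) : BLin (BTensor V A) (BTensor V A) := map (BLin.id V) (mulB a)

/-- `x ⊗ y ↦ x ⊗ y a`. -/
def rmulSnd (a : A) : BLin (BTensor V A) (BTensor V A) := map (BLin.id V) (mulB.flip a)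

@[simp] theorem lmulFst_tmul (a x : A) (y : V) : lmulFst a (tmul x y) = tmul (a * x) y := by
  simp [lmulFst]

@[simp] theorem rmulFst_tmul (a x : A) (y : V) : rmulFst a (tmul x y) = tmul (x * a) y := by
  simp [rmulFst]

@[simp] theorem lmulSnd_tmul (a y : A) (x : V) : lmulSnd a (tmul x y) = tmul x (a * y) := by
  simp [lmulSnd]

@[simp] theorem rmulSnd_tmul (a y : A) (x : V) : rmulSnd a (tmul x y) = tmul x (y * a) := by
  simp [rmulSnd]

variable {X : Type*} [AddCommGroup X] [Module ℂ X] [Bornology X]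

@[fun_prop] theorem isBLin_rmulFst {F : X → A} (hF : IsBLin F) :
    IsBLin (fun x => (rmulFst (F x) : BLin (BTensor A V) (BTensor A V))) :=
  IsBLin.map_left ((IsBLin.blin mulB.flip).comp hF) (BLin.id V)

end LegMultiplication

namespace BornQuantumGroup

variable {H : Type*} [NonUnitalRing H] [Module ℂ H] [IsScalarTower ℂ H H] [SMulCommClass ℂ H H]
  [Bornology H] [BornAlgebra H] {V X : Type*}
  [AddCommGroup V] [Module ℂ V] [Bornology V] [CompleteBornSpace V]
  [AddCommGroup X] [Module ℂ X] [Bornology X] [CompleteBornSpace X]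

open BTensor Multiplier

local notation:75 x:76 " ⊠ " y:75 => BTensor.tmul x y

/-! ### Nondegeneracy -/


theorem eq_zero_of_mul_right (Q : BornQuantumGroup H) (a : H) (h : ∀ b, a * b = 0) : a = 0 :=
  Q.faithful.1 a fun b => by rw [h, map_zero]

theorem eq_zero_of_mul_left (Q : BornQuantumGroup H) (b : H) (h : ∀ a, a * b = 0) : b = 0 :=
  Q.faithful.2 b fun a => by rw [h, map_zero]

theorem eq_of_mul_right (Q : BornQuantumGroup H) {a a' : H} (h : ∀ b, a * b = a' * b) : a = a' :=
  sub_eq_zero.1 (Q.eq_zero_of_mul_right _ fun b => by rw [sub_mul, h, sub_self])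

theorem eq_of_mul_left (Q : BornQuantumGroup H) {b b' : H} (h : ∀ a, a * b = a * b') : b = b' :=
  sub_eq_zero.1 (Q.eq_zero_of_mul_left _ fun a => by rw [mul_sub, h, sub_self])

/-- By faithfulness the functionals a ↦ φ(ab) are enough. -/
theorem separated (Q : BornQuantumGroup H) : Separated H := fun a h =>
  Q.faithful.1 a fun b => h (Q.φ.comp (mulB.flip b))

theorem separated_tensor (Q : BornQuantumGroup H) : Separated (BTensor H H) := Q.separated.tensor_right Q.approximation

theorem ext_rmulFst (Q : BornQuantumGroup H) (hV : Separated V) {s t : BTensor H V}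
    (h : ∀ a, rmulFst a s = rmulFst a t) : s = t :=
  Q.approximation.map_ext_id hV Q.eq_zero_of_mul_right h

theorem ext_lmulFst (Q : BornQuantumGroup H) (hV : Separated V) {s t : BTensor H V}
    (h : ∀ a, lmulFst a s = lmulFst a t) : s = t :=
  Q.approximation.map_ext_id hV Q.eq_zero_of_mul_left h

theorem ext_rmulSnd (Q : BornQuantumGroup H) (hV : Separated V) {s t : BTensor V H}
    (h : ∀ a, rmulSnd a s = rmulSnd a t) : s = t :=
  Q.approximation.map_id_ext hV Q.eq_zero_of_mul_right h

theorem ext_lmulSnd (Q : BornQuantumGroup H) (hV : Separated V) {s t : BTensor V H}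
    (h : ∀ a, lmulSnd a s = lmulSnd a t) : s = t :=
  Q.approximation.map_id_ext hV Q.eq_zero_of_mul_left h

/-- Multiplying by a ⊗ b multiplies each leg separately, so nondegeneracy of H passes to H ⊗ H one
leg at a time. This cancellation turns identities of multipliers into identities in H ⊗ H. -/
theorem tensor_ext_right (Q : BornQuantumGroup H) {s t : BTensor H H} (h : ∀ z, s * z = t * z) : s = t :=
  Q.ext_rmulFst Q.separated fun a => Q.ext_rmulSnd Q.separated fun b => by
    have h1 : ∀ s : BTensor H H, rmulSnd b (rmulFst a s) = s * a ⊠ b :=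
      ext_fun fun x y => by simp
    rw [h1, h1, h]

theorem tensor_ext_left (Q : BornQuantumGroup H) {s t : BTensor H H} (h : ∀ z, z * s = z * t) : s = t :=
  Q.ext_lmulFst Q.separated fun a => Q.ext_lmulSnd Q.separated fun b => by
    have h1 : ∀ s : BTensor H H, lmulSnd b (lmulFst a s) = a ⊠ b * s :=
      ext_fun fun x y => by simp
    rw [h1, h1, h]

/-- H is essential, so each element is the image under μ of some tensor in H ⊗ H. This permits
splitting an element into factors without an approximate unit. -/
theorem mul_ext (Q : BornQuantumGroup H) {F G : H → X} (h : ∀ a b, F (a * b) = G (a * b)) (hF : IsBLin F := by fun_prop)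
    (hG : IsBLin G := by fun_prop) (a : H) : F a = G a := by
  obtain ⟨k, -, hk⟩ := Q.essential.2
  obtain ⟨t, ht⟩ := BalancedTensor.mk_surjective _ _ (k a)
  have h1 : lift mulB t = a := by
    rw [← hk a, ← ht]
    rfl
  rw [← h1]
  exact ext_fun (F := fun t => F (lift mulB t)) (G := fun t => G (lift mulB t))
    (fun a b => by simpa using h a b) (hF.comp (IsBLin.blin _)) (hG.comp (IsBLin.blin _)) t

/-- Essentiality of Δ in usable form. Extensions to multipliers are prescribed only on such
elements. -/
theorem comul_ext (Q : BornQuantumGroup H) {F G : BTensor H H → X} (h : ∀ a t, F ((Q.Δ a).L t) = G ((Q.Δ a).L t))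
    (hF : IsBLin F := by fun_prop) (hG : IsBLin G := by fun_prop) (t : BTensor H H) :
    F t = G t := by
  obtain ⟨f, hf⟩ := hF
  obtain ⟨g, hg⟩ := hG
  rw [← hf, ← hg]
  exact Q.comul.essential.ext_left (fun a t => by rw [hf, hg, h]) t

variable (Q : BornQuantumGroup H)

/-! ### Galois maps and the comultiplication -/

theorem Δ_mul (f g : H) : Q.Δ (f * g) = Q.Δ f * Q.Δ g := Q.comul.essential.map_mul f g

theorem γl_mul (f g : H) (t : BTensor H H) :
    Q.γl (f ⊠ g) * t = (Q.Δ f).L (lmulFst g t) := by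
  have h := congrArg (fun m => m.L t) (Q.γl_spec f g)
  exact h

theorem γr_mul (f g : H) (t : BTensor H H) :
    Q.γr (f ⊠ g) * t = (Q.Δ f).L (lmulSnd g t) := by
  have h := congrArg (fun m => m.L t) (Q.γr_spec f g)
  exact h

theorem mul_ρl (f g : H) (t : BTensor H H) :
    t * Q.ρl (f ⊠ g) = (Q.Δ g).R (rmulFst f t) := by
  have h := congrArg (fun m => m.R t) (Q.ρl_spec f g)
  exact h

theorem mul_ρr (f g : H) (t : BTensor H H) :
    t * Q.ρr (f ⊠ g) = (Q.Δ g).R (rmulSnd f t) := by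
  have h := congrArg (fun m => m.R t) (Q.ρr_spec f g)
  exact h

theorem lmulFst_mul (a : H) (s t : BTensor H H) : lmulFst a (s * t) = lmulFst a s * t := by
  have h := (tensor (ι H a) 1).L_mul s t
  exact h

theorem lmulSnd_mul (a : H) (s t : BTensor H H) : lmulSnd a (s * t) = lmulSnd a s * t := by
  have h := (tensor 1 (ι H a)).L_mul s t
  exact h

theorem mul_lmulFst (a : H) (s t : BTensor H H) : s * lmulFst a t = rmulFst a s * t := by
  have h := (tensor (ι H a) 1).mul_L s t
  exact h

theorem mul_lmulSnd (a : H) (s t : BTensor H H) : s * lmulSnd a t = rmulSnd a s * t := by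
  have h := (tensor 1 (ι H a)).mul_L s t
  exact h

/-- Factor x ⊗ y as (1 ⊗ y)(x ⊗ 1) and let Δ(f) absorb the first factor. The specification of the
Galois map only describes its products, so the equation is tested against an arbitrary `z` and
cancelled. The three variants below factor differently. -/
theorem Δ_L_eq_γr (f x y : H) : (Q.Δ f).L (x ⊠ y) = rmulFst x (Q.γr (f ⊠ y)) :=
  Q.tensor_ext_right fun z => by
    rw [← Multiplier.L_mul, ← mul_lmulFst, γr_mul]
    congr 1
    revert z
    exact ext_fun fun p q => by simp

theorem Δ_L_eq_γl (f x y : H) : (Q.Δ f).L (x ⊠ y) = rmulSnd y (Q.γl (f ⊠ x)) :=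
  Q.tensor_ext_right fun z => by
    rw [← Multiplier.L_mul, ← mul_lmulSnd, γl_mul]
    congr 1
    revert z
    exact ext_fun fun p q => by simp

theorem Δ_R_eq_ρr (f x y : H) : (Q.Δ f).R (x ⊠ y) = lmulFst x (Q.ρr (y ⊠ f)) :=
  Q.tensor_ext_left fun z => by
    rw [← Multiplier.R_mul, mul_lmulFst, mul_ρr]
    congr 1
    revert z
    exact ext_fun fun p q => by simp

theorem Δ_R_eq_ρl (f x y : H) : (Q.Δ f).R (x ⊠ y) = lmulSnd y (Q.ρl (x ⊠ f)) :=
  Q.tensor_ext_left fun z => by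
    rw [← Multiplier.R_mul, mul_lmulSnd, mul_ρl]
    congr 1
    revert z
    exact ext_fun fun p q => by simp

theorem γr_mul_right (f g h : H) : Q.γr (f ⊠ (g * h)) = rmulSnd h (Q.γr (f ⊠ g)) :=
  Q.tensor_ext_right fun z => by
    rw [γr_mul, ← mul_lmulSnd, γr_mul]
    congr 1
    revert z
    exact ext_fun fun p q => by simp [mul_assoc]

theorem γl_mul_right (f g h : H) : Q.γl (f ⊠ (g * h)) = rmulFst h (Q.γl (f ⊠ g)) :=
  Q.tensor_ext_right fun z => by
    rw [γl_mul, ← mul_lmulFst, γl_mul]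
    congr 1
    revert z
    exact ext_fun fun p q => by simp [mul_assoc]

theorem ρr_mul_left (f g h : H) : Q.ρr ((f * g) ⊠ h) = lmulSnd f (Q.ρr (g ⊠ h)) :=
  Q.tensor_ext_left fun z => by
    rw [mul_ρr, mul_lmulSnd, mul_ρr]
    congr 1
    revert z
    exact ext_fun fun p q => by simp [mul_assoc]

theorem γr_mul_left (f g h : H) : Q.γr ((f * g) ⊠ h) = (Q.Δ f).L (Q.γr (g ⊠ h)) :=
  Q.tensor_ext_right fun z => by
    rw [← Multiplier.L_mul, γr_mul, γr_mul, Δ_mul, mul_L_apply]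

theorem γl_mul_left (f g h : H) : Q.γl ((f * g) ⊠ h) = (Q.Δ f).L (Q.γl (g ⊠ h)) :=
  Q.tensor_ext_right fun z => by
    rw [← Multiplier.L_mul, γl_mul, γl_mul, Δ_mul, mul_L_apply]

/-- Two bracketings of (c ⊗ 1)Δ(f)(1 ⊗ g), compared between arbitrary factors `w` and `z` by the
compatibility of left and right multiplication by Δ(f). -/
theorem lmulFst_γr (c f g : H) : lmulFst c (Q.γr (f ⊠ g)) = rmulSnd g (Q.ρl (c ⊠ f)) :=
  Q.tensor_ext_right fun z => Q.tensor_ext_left fun w => by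
    rw [← lmulFst_mul, mul_lmulFst, γr_mul, Multiplier.mul_L, ← mul_lmulSnd, ← mul_assoc, mul_ρl]

theorem lmulSnd_γr (c f g : H) : lmulSnd c (Q.γr (f ⊠ g)) = rmulSnd g (Q.ρr (c ⊠ f)) :=
  Q.tensor_ext_right fun z => Q.tensor_ext_left fun w => by
    rw [← lmulSnd_mul, mul_lmulSnd, γr_mul, Multiplier.mul_L, ← mul_lmulSnd, ← mul_assoc, mul_ρr]

theorem lmulSnd_γl (c f g : H) : lmulSnd c (Q.γl (f ⊠ g)) = rmulFst g (Q.ρr (c ⊠ f)) :=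
  Q.tensor_ext_right fun z => Q.tensor_ext_left fun w => by
    rw [← lmulSnd_mul, mul_lmulSnd, γl_mul, Multiplier.mul_L, ← mul_lmulFst, ← mul_assoc, mul_ρr]

theorem lmulFst_γl (c f g : H) : lmulFst c (Q.γl (f ⊠ g)) = rmulFst g (Q.ρl (c ⊠ f)) :=
  Q.tensor_ext_right fun z => Q.tensor_ext_left fun w => by
    rw [← lmulFst_mul, mul_lmulFst, γl_mul, Multiplier.mul_L, ← mul_lmulFst, ← mul_assoc, mul_ρl]

/-! ### Coassociativity -/

/-- The map `q ↦ Δ(q) s`. -/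
def comulApply (s : BTensor H H) : BLin H (BTensor H H) := (LB.comp Q.Δ).flip s

@[simp] theorem comulApply_apply (s : BTensor H H) (q : H) : Q.comulApply s q = (Q.Δ q).L s := rfl

@[fun_prop] theorem isBLin_comulApply {F : V → BTensor H H} (hF : IsBLin F) :
    IsBLin (fun x => Q.comulApply (F x)) := (IsBLin.blin (LB.comp Q.Δ).flip).comp hF

/-- Coassociativity in terms of `γr`: with `p ⊗ q = γr (f ⊗ g)`, the element `p ⊗ Δ(q) s` is
`γr₁₂ γr₁₃ (f ⊗ Δ(g) s)`. -/
theorem map_comulApply_γr (f g : H) (s : BTensor H H) :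
    map (BLin.id H) (Q.comulApply s) (Q.γr (f ⊠ g)) =
      leg12 Q.γr (leg13 Q.γr (f ⊠ (Q.Δ g).L s)) := by
  obtain ⟨m, n, ⟨hm, -⟩, ⟨hn, -⟩, hmn, -⟩ := Q.comul.coassoc f
  -- Here `m` is (Δ ⊗ id)Δ(f). Its defining property applies only when the first two legs are Δ(b)t
  -- and the last is a product, which is enough by `comul_ext` and `mul_ext`.
  have h1 : ∀ (y : H) (v : BTensor H H), m.L (v ⊠ y) =
      map (Q.comulApply v) (BLin.id H) (Q.γr (f ⊠ y)) := by
    intro y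
    refine Q.comul_ext fun b t => ?_
    · revert y
      refine Q.mul_ext fun y y' => ?_
      have h2 := hm (b ⊠ y) (t ⊠ y')
      rw [tensorHom_tmul, tensor_L, map_tmul, ι_L, Δ_L_eq_γr] at h2
      rw [h2, γr_mul_right]
      generalize Q.γr (f ⊠ y) = u
      revert u
      refine ext_fun fun p q => ?_
      simp [Δ_mul]
  -- Coassociativity makes `n` the reassociated `m`. With γr(f ⊗ y) = p ⊗ q, the factor Δ(p)(a ⊗ x)
  -- is γr(p ⊗ x)(a ⊗ 1).
  have h3 : ∀ (a : H) (v : BTensor H H), n.L (a ⊠ v) =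
      rmulFst a (leg12 Q.γr (leg13 Q.γr (f ⊠ v))) := by
    intro a
    refine ext_fun fun x y => ?_
    have h4 := hmn ((a ⊠ x) ⊠ y)
    rw [assoc_tmul] at h4
    rw [← h4, h1, leg13_tmul]
    generalize Q.γr (f ⊠ y) = u
    revert u
    refine ext_fun fun p q => ?_
    rw [map_tmul, insertMid_tmul, leg12_tmul, comulApply_apply, Δ_L_eq_γr]
    generalize Q.γr (p ⊠ x) = w
    revert w
    refine ext_fun fun p q => ?_
    simp
  -- The multiplier `n` needs an element in its first leg, so an arbitrary `a` is placed there and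
  -- cancelled at the end.
  refine Q.ext_rmulFst Q.separated_tensor fun a => ?_
  rw [← h3]
  revert a
  refine Q.mul_ext fun a a' => ?_
  have h5 := hn (a ⊠ g) (a' ⊠ s)
  rw [tensorHom_tmul, tensor_L, map_tmul, ι_L, Δ_L_eq_γr] at h5
  rw [h5]
  generalize Q.γr (f ⊠ g) = u
  revert u
  refine ext_fun fun p q => ?_
  simp [mul_assoc]

/-- Both sides stand for (c ⊗ 1 ⊗ 1)(id ⊗ Δ)Δ(f)(1 ⊗ s). For s = Δ(g)t it is `map_comulApply_γr`
multiplied by `c` on the left. -/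
theorem map_comulApply_ρl (c f : H) (s : BTensor H H) :
    map (BLin.id H) (Q.comulApply s) (Q.ρl (c ⊠ f)) =
      lmulFst c (leg12 Q.γr (leg13 Q.γr (f ⊠ s))) := by
  revert s
  refine Q.comul_ext fun g t => ?_
  rw [← map_comulApply_γr]
  have h1 : ∀ u : BTensor H H, lmulFst c (map (BLin.id H) (Q.comulApply t) u) =
      map (BLin.id H) (Q.comulApply t) (lmulFst c u) := ext_fun fun p q => by simp
  rw [h1, lmulFst_γr]
  generalize Q.ρl (c ⊠ f) = u
  revert u
  refine ext_fun fun p q => ?_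
  simp [Δ_mul]

/-- The Galois maps `ρl` on the first two and `γr` on the last two legs commute. -/
theorem leg12_ρl_γr (c f y : H) : leg12 Q.ρl (c ⊠ Q.γr (f ⊠ y)) =
    map (BLin.id H) Q.γr (assoc (Q.ρl (c ⊠ f) ⊠ y)) := by
  -- With `x` inserted on the right of the middle leg, both sides become (c ⊗ 1 ⊗ 1)(id ⊗ Δ)Δ(f)(1 ⊗
  -- x ⊗ y).
  refine Q.approximation.id_map_ext (F := fun x : H => (rmulFst x : BLin (BTensor H H) _))
    (fun t ht => Q.ext_rmulFst Q.separated fun x => by rw [ht, map_zero]) fun x => ?_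
  have h1 : ∀ u : BTensor H H, map (BLin.id H) (rmulFst x) (map (BLin.id H) Q.γr (assoc (u ⊠ y))) =
      map (BLin.id H) (Q.comulApply (x ⊠ y)) u := ext_fun fun p q => by simp [Δ_L_eq_γr]
  rw [h1, map_comulApply_ρl, leg13_tmul]
  generalize Q.γr (f ⊠ y) = w
  revert w
  refine ext_fun fun p q => ?_
  have h2 : ∀ u : BTensor H H, lmulFst c (assoc (u ⊠ q)) = assoc (lmulFst c u ⊠ q) :=
    ext_fun fun p q => by simp
  rw [leg12_tmul, insertMid_tmul, leg12_tmul, h2, lmulFst_γr]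
  generalize Q.ρl (c ⊠ p) = u
  revert u
  refine ext_fun fun p q => ?_
  simp

/-- Both sides stand for (c ⊗ 1 ⊗ x)(id ⊗ Δ)Δ(f). A factor `y` on the right of the last leg replaces
ρr by γr and reduces the claim to `leg12_ρl_γr`. -/
theorem leg12_ρl_ρr (c x f : H) : leg12 Q.ρl (c ⊠ Q.ρr (x ⊠ f)) =
    map (BLin.id H) (Q.ρr.comp (tmul x)) (Q.ρl (c ⊠ f)) := by
  refine Q.approximation.id_map_ext (F := fun y : H => (rmulSnd y : BLin (BTensor H H) _))
    (fun t ht => Q.ext_rmulSnd Q.separated fun x => by rw [ht, map_zero]) fun y => ?_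
  have h1 : ∀ w : BTensor H H, map (BLin.id H) (rmulSnd y) (leg12 Q.ρl (c ⊠ w)) =
      leg12 Q.ρl (c ⊠ rmulSnd y w) := ext_fun fun p q => by
    rw [rmulSnd_tmul, leg12_tmul, leg12_tmul]
    generalize Q.ρl (c ⊠ p) = u
    revert u
    exact ext_fun fun p q => by simp
  have h2 : ∀ w : BTensor H H, map (BLin.id H) (lmulSnd x) (leg12 Q.ρl (c ⊠ w)) =
      leg12 Q.ρl (c ⊠ lmulSnd x w) := ext_fun fun p q => by
    rw [lmulSnd_tmul, leg12_tmul, leg12_tmul]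
    generalize Q.ρl (c ⊠ p) = u
    revert u
    exact ext_fun fun p q => by simp
  rw [h1, ← lmulSnd_γr, ← h2, leg12_ρl_γr]
  generalize Q.ρl (c ⊠ f) = u
  revert u
  refine ext_fun fun p q => ?_
  simp [lmulSnd_γr]

end BornQuantumGroup

theorem BalancedTensor.mk_balanced {A M N : Type*} [AddCommGroup A] [Module ℂ A] [Bornology A]
    [AddCommGroup M] [Module ℂ M] [Bornology M] [CompleteBornSpace M]
    [AddCommGroup N] [Module ℂ N] [Bornology N] [CompleteBornSpace N]
    (ρ : BLin M (BLin A M)) (l : BLin A (BLin N N)) (m : M) (a : A) (n : N) :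
    mk ρ l (BTensor.tmul (ρ m a) n) = mk ρ l (BTensor.tmul m (l a n)) := by
  rw [← sub_eq_zero, ← map_sub]
  exact (BQuot.mk_eq_zero _).2 (subset_closedSpan _ ⟨m, a, n, rfl⟩)

namespace BornQuantumGroup

variable {H : Type*} [NonUnitalRing H] [Module ℂ H] [IsScalarTower ℂ H H] [SMulCommClass ℂ H H]
  [Bornology H] [BornAlgebra H] (Q : BornQuantumGroup H)

open BTensor Multiplier

local notation:75 x:76 " ⊠ " y:75 => BTensor.tmul x y

/-! ### The counit -/

/-- The inverse of `γl`. -/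
def γlInv : BLin (BTensor H H) (BTensor H H) := Q.γl_isIso.choose

/-- The inverse of `γr`. -/
def γrInv : BLin (BTensor H H) (BTensor H H) := Q.γr_isIso.choose

/-- The inverse of `ρl`. -/
def ρlInv : BLin (BTensor H H) (BTensor H H) := Q.ρl_isIso.choose

@[simp] theorem γlInv_γl (t : BTensor H H) : Q.γlInv (Q.γl t) = t := Q.γl_isIso.choose_spec.1 t
@[simp] theorem γl_γlInv (t : BTensor H H) : Q.γl (Q.γlInv t) = t := Q.γl_isIso.choose_spec.2 t
@[simp] theorem γrInv_γr (t : BTensor H H) : Q.γrInv (Q.γr t) = t := Q.γr_isIso.choose_spec.1 t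
@[simp] theorem γr_γrInv (t : BTensor H H) : Q.γr (Q.γrInv t) = t := Q.γr_isIso.choose_spec.2 t
@[simp] theorem ρlInv_ρl (t : BTensor H H) : Q.ρlInv (Q.ρl t) = t := Q.ρl_isIso.choose_spec.1 t
@[simp] theorem ρl_ρlInv (t : BTensor H H) : Q.ρl (Q.ρlInv t) = t := Q.ρl_isIso.choose_spec.2 t

theorem exists_φ_eq_one : ∃ e : H, Q.φ e = 1 := by
  obtain ⟨a, ha⟩ := @exists_ne H Q.essential.1 0
  by_contra! hcon
  refine ha (Q.faithful.1 a fun b => ?_)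
  by_contra hb
  exact hcon ((Q.φ (a * b))⁻¹ • (a * b)) (by rw [map_smul, smul_eq_mul, inv_mul_cancel₀ hb])

/-- This separation of variables creates the counit: μγr⁻¹(y ⊗ c) must be a multiple of `c`, by a
scalar depending on `y` alone. Applying id ⊗ μγr⁻¹ to `leg12_ρl_γr` undoes γr and leaves (id ⊗
μγr⁻¹)(ρl(a ⊗ b) ⊗ c) = ab ⊗ c; then ρl is inverted. -/
theorem tmul_lift_γrInv (x y c : H) :
    x ⊠ lift mulB (Q.γrInv (y ⊠ c)) = lift mulB (Q.ρlInv (x ⊠ y)) ⊠ c := by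
  have h1 : ∀ a w, map (BLin.id H) ((lift mulB).comp Q.γrInv) (leg12 Q.ρl (a ⊠ w)) =
      lmulFst a w := by
    intro a w
    obtain ⟨t, rfl⟩ : ∃ t, Q.γr t = w := ⟨_, Q.γr_γrInv w⟩
    revert t
    refine ext_fun fun f g => ?_
    rw [leg12_ρl_γr, lmulFst_γr]
    generalize Q.ρl (a ⊠ f) = u
    revert u
    refine ext_fun fun p q => ?_
    simp
  have h2 : ∀ t, map (BLin.id H) ((lift mulB).comp Q.γrInv) (assoc (Q.ρl t ⊠ c)) =
      lift mulB t ⊠ c := ext_fun fun a b => by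
    rw [← leg12_tmul, h1]
    simp
  have h3 := h2 (Q.ρlInv (x ⊠ y))
  rw [ρl_ρlInv] at h3
  simpa using h3

/-- The counit. -/
def counit : BLin H ℂ :=
  Q.φ.comp ((lift mulB).comp (Q.ρlInv.comp (tmul Q.exists_φ_eq_one.choose)))

/-- Apply φ to the first leg of `tmul_lift_γrInv`, taking for x the element with φ(x) = 1 used in
the definition of ε. -/
theorem lift_γrInv (w : BTensor H H) : lift mulB (Q.γrInv w) = sliceLeft Q.counit w := by
  revert w
  refine ext_fun fun y c => ?_
  have h := congrArg (sliceLeft Q.φ) (Q.tmul_lift_γrInv Q.exists_φ_eq_one.choose y c)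
  rw [sliceLeft_tmul, sliceLeft_tmul, Q.exists_φ_eq_one.choose_spec, one_smul] at h
  rw [h, sliceLeft_tmul]
  rfl

theorem lift_ρlInv (w : BTensor H H) : lift mulB (Q.ρlInv w) = sliceRight Q.counit w := by
  revert w
  refine ext_fun fun x y => ?_
  have h := congrArg (sliceRight Q.φ) (Q.tmul_lift_γrInv x y Q.exists_φ_eq_one.choose)
  rw [lift_γrInv, sliceLeft_tmul, map_smul, map_smul, sliceRight_tmul, sliceRight_tmul,
    Q.exists_φ_eq_one.choose_spec, one_smul, one_smul] at h
  rw [← h, sliceRight_tmul]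

theorem counit_γr (t : BTensor H H) : sliceLeft Q.counit (Q.γr t) = lift mulB t := by
  rw [← lift_γrInv, γrInv_γr]

theorem counit_ρl (t : BTensor H H) : sliceRight Q.counit (Q.ρl t) = lift mulB t := by
  rw [← lift_ρlInv, ρlInv_ρl]

theorem sliceLeft_lmulSnd (ω : BLin H ℂ) (c : H) (t : BTensor H H) :
    sliceLeft ω (lmulSnd c t) = c * sliceLeft ω t := by
  revert t
  exact ext_fun fun p q => by simp [mul_smul_comm]

theorem sliceLeft_rmulSnd (ω : BLin H ℂ) (c : H) (t : BTensor H H) :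
    sliceLeft ω (rmulSnd c t) = sliceLeft ω t * c := by
  revert t
  exact ext_fun fun p q => by simp [smul_mul_assoc]

theorem sliceRight_lmulFst (ω : BLin H ℂ) (c : H) (t : BTensor H H) :
    sliceRight ω (lmulFst c t) = c * sliceRight ω t := by
  revert t
  exact ext_fun fun p q => by simp [mul_smul_comm]

theorem sliceRight_rmulFst (ω : BLin H ℂ) (c : H) (t : BTensor H H) :
    sliceRight ω (rmulFst c t) = sliceRight ω t * c := by
  revert t
  exact ext_fun fun p q => by simp [smul_mul_assoc]

/-- A right factor in the second leg turns ρr into γr, where the identity is known; cancelling the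
factor transports it. -/
theorem counit_ρr (t : BTensor H H) : sliceLeft Q.counit (Q.ρr t) = lift mulB t := by
  revert t
  refine ext_fun fun f g => Q.eq_of_mul_right fun b => ?_
  rw [← sliceLeft_rmulSnd, ← lmulSnd_γr, sliceLeft_lmulSnd, counit_γr]
  simp [mul_assoc]

theorem counit_γl (t : BTensor H H) : sliceRight Q.counit (Q.γl t) = lift mulB t := by
  revert t
  refine ext_fun fun f g => Q.eq_of_mul_left fun b => ?_
  rw [← sliceRight_lmulFst, lmulFst_γl, sliceRight_rmulFst, counit_ρl]
  simp [mul_assoc]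

/-- Write w as γr of a tensor; left multiplication by Δ(c) only changes the first argument f of γr
to cf. -/
theorem counit_Δ (c : H) (w : BTensor H H) :
    sliceLeft Q.counit ((Q.Δ c).L w) = c * sliceLeft Q.counit w := by
  obtain ⟨t, rfl⟩ : ∃ t, Q.γr t = w := ⟨_, Q.γr_γrInv w⟩
  revert t
  refine ext_fun fun f g => ?_
  rw [← γr_mul_left, counit_γr, counit_γr]
  simp [mul_assoc]

/-- By `counit_Δ`, (ε ⊗ id)(Δ(c)(b ⊗ d)) = ε(b)cd, so right multiplication by b ⊗ 1 acts as the
scalar ε(b) under ε ⊗ id on the range of γr, which is everything. -/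
theorem counit_mul (a b : H) : Q.counit (a * b) = Q.counit a * Q.counit b := by
  have h : ∀ w : BTensor H H, sliceLeft Q.counit (rmulFst b w) = Q.counit b • sliceLeft Q.counit w := by
    intro w
    obtain ⟨t, rfl⟩ : ∃ t, Q.γr t = w := ⟨_, Q.γr_γrInv w⟩
    revert t
    refine ext_fun fun c d => ?_
    rw [← Δ_L_eq_γr, counit_Δ, counit_γr]
    simp [mul_smul_comm]
  obtain ⟨e, he⟩ := Q.exists_φ_eq_one
  have h1 := congrArg Q.φ (h (a ⊠ e))
  simpa [he, mul_comm] using h1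

/-- If ε vanished, (ε ⊗ id)γr = μ would make the multiplication zero, against nondegeneracy. -/
theorem exists_counit_eq_one : ∃ e : H, Q.counit e = 1 := by
  by_contra! hcon
  have h0 : ∀ a, Q.counit a = 0 := fun a => by
    by_contra ha
    exact hcon ((Q.counit a)⁻¹ • a) (by rw [map_smul, smul_eq_mul, inv_mul_cancel₀ ha])
  obtain ⟨a, ha⟩ := @exists_ne H Q.essential.1 0
  refine ha (Q.eq_zero_of_mul_right a fun b => ?_)
  have h1 : ∀ w, sliceLeft Q.counit w = (0 : BLin (BTensor H H) H) w :=
    ext_fun fun p q => by simp [h0]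
  have h2 := Q.counit_γr (a ⊠ b)
  rw [h1] at h2
  simpa using h2.symm

theorem sliceRight_counit_rmulSnd (c : H) (t : BTensor H H) :
    sliceRight Q.counit (rmulSnd c t) = Q.counit c • sliceRight Q.counit t := by
  revert t
  exact ext_fun fun p q => by simp [counit_mul, mul_smul, smul_comm (Q.counit c)]

theorem sliceLeft_counit_lmulFst (c : H) (t : BTensor H H) :
    sliceLeft Q.counit (lmulFst c t) = Q.counit c • sliceLeft Q.counit t := by
  revert t
  exact ext_fun fun p q => by simp [counit_mul, mul_smul]

theorem sliceRight_counit_lmulSnd (c : H) (t : BTensor H H) :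
    sliceRight Q.counit (lmulSnd c t) = Q.counit c • sliceRight Q.counit t := by
  revert t
  exact ext_fun fun p q => by simp [counit_mul, mul_smul]

/-- After insertion of `x` in the first leg, Δ(a)(x ⊗ b) can be expressed through γl instead, and
multiplicativity of ε extracts ε(b). -/
theorem sliceRight_counit_γr (t : BTensor H H) :
    sliceRight Q.counit (Q.γr t) = sliceRight Q.counit t := by
  revert t
  refine ext_fun fun a b => Q.eq_of_mul_right fun x => ?_
  rw [← sliceRight_rmulFst, ← Δ_L_eq_γr, Δ_L_eq_γl, sliceRight_counit_rmulSnd, counit_γl]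
  simp [smul_mul_assoc]

theorem sliceLeft_counit_ρl (t : BTensor H H) :
    sliceLeft Q.counit (Q.ρl t) = sliceLeft Q.counit t := by
  revert t
  refine ext_fun fun a b => Q.eq_of_mul_left fun x => ?_
  rw [← sliceLeft_lmulSnd, ← Δ_R_eq_ρl, Δ_R_eq_ρr, sliceLeft_counit_lmulFst, counit_ρr]
  simp [mul_smul_comm]

theorem sliceRight_counit_ρr (t : BTensor H H) :
    sliceRight Q.counit (Q.ρr t) = sliceLeft Q.counit t := by
  revert t
  refine ext_fun fun a b => Q.eq_of_mul_left fun x => ?_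
  rw [← sliceRight_lmulFst, ← Δ_R_eq_ρr, Δ_R_eq_ρl, sliceRight_counit_lmulSnd, counit_ρl]
  simp [mul_smul_comm]

theorem isEssentialHom_counit : IsEssentialHom ((ι ℂ).comp Q.counit) where
  map_mul a b := by
    ext z <;> simp [counit_mul, mul_comm, mul_left_comm]
  left := by
    obtain ⟨e, he⟩ := Q.exists_counit_eq_one
    set l := leftAction ((ι ℂ).comp Q.counit) with hl
    have hl' : ∀ a z, l a z = Q.counit a • z := fun _ _ => rfl
    have hsm : ∀ (c z : ℂ) (x : H), x ⊠ (c • z) = (c • x) ⊠ z := fun c z x => by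
      rw [map_smul, map_smul, BLin.smul_apply]
    refine ⟨(BalancedTensor.mk mulB l).comp (tmul e), fun y => ?_, fun z => ?_⟩
    · obtain ⟨t, rfl⟩ := BalancedTensor.mk_surjective _ _ y
      rw [BalancedTensor.lift_mk]
      revert t
      refine ext_fun fun f z => ?_
      have h1 : ∀ s : BTensor H H, BalancedTensor.mk mulB l (lift mulB s ⊠ z) =
          BalancedTensor.mk mulB l (sliceRight Q.counit s ⊠ z) := by
        refine ext_fun fun a b => ?_
        have h2 := BalancedTensor.mk_balanced mulB l a b z
        rw [lift_tmul, h2, sliceRight_tmul, hl', hsm]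
      -- For s = γr⁻¹(f ⊗ e) one has μ(s) = ε(f)e but (id ⊗ ε)(s) = f. Balancing identifies the two,
      -- so every class is a multiple of a class of `e`, and z ↦ [e ⊗ z] is the inverse.
      have h2 := h1 (Q.γrInv (f ⊠ e))
      rw [lift_γrInv, ← sliceRight_counit_γr, γr_γrInv, sliceRight_tmul, he, one_smul,
        sliceLeft_tmul] at h2
      rw [← h2, lift_tmul, hl', BLin.comp_apply, hsm]
    · rw [BLin.comp_apply, BalancedTensor.lift_mk, lift_tmul, hl', he, one_smul]
  right := by
    obtain ⟨e, he⟩ := Q.exists_counit_eq_one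
    set r := rightAction ((ι ℂ).comp Q.counit) with hr
    have hr' : ∀ z a, r z a = Q.counit a • z := fun z a => mul_comm _ _
    have hsm : ∀ (c z : ℂ) (x : H), (c • z) ⊠ x = z ⊠ (c • x) := fun c z x => by
      rw [map_smul, map_smul, BLin.smul_apply]
    refine ⟨(BalancedTensor.mk r mulB).comp (tmul.flip e), fun y => ?_, fun z => ?_⟩
    · obtain ⟨t, rfl⟩ := BalancedTensor.mk_surjective _ _ y
      rw [BalancedTensor.lift_mk]
      revert t
      refine ext_fun fun z f => ?_
      have h1 : ∀ s : BTensor H H, BalancedTensor.mk r mulB (z ⊠ lift mulB s) =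
          BalancedTensor.mk r mulB (z ⊠ sliceLeft Q.counit s) := by
        refine ext_fun fun a b => ?_
        have h2 := BalancedTensor.mk_balanced r mulB z a b
        rw [lift_tmul, ← h2, sliceLeft_tmul, hr', hsm]
      -- Mirror image: for s = ρl⁻¹(e ⊗ f), μ(s) = ε(f)e and (ε ⊗ id)(s) = f.
      have h2 := h1 (Q.ρlInv (e ⊠ f))
      rw [lift_ρlInv, ← sliceLeft_counit_ρl, ρl_ρlInv, sliceLeft_tmul, he, one_smul,
        sliceRight_tmul] at h2
      rw [← h2, lift_tmul, hr', BLin.comp_apply, BLin.flip_apply, hsm]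
    · rw [BLin.comp_apply, BalancedTensor.lift_mk, BLin.flip_apply, lift_tmul, hr', he, one_smul]

theorem isCounit_counit : Q.IsCounit Q.counit where
  essential := Q.isEssentialHom_counit
  left f g := ⟨by simp [counit_γr], by simp [counit_ρr]⟩
  right f g := ⟨by simp [counit_γl], by simp [counit_ρl]⟩

/-- The counit property says (ε ⊗ id)γr = μ, and γr is onto, so ε ⊗ id is determined. -/
theorem IsCounit.eq_counit {ε : BLin H ℂ} (hε : Q.IsCounit ε) : ε = Q.counit := by
  have h1 : ∀ t, sliceLeft ε (Q.γr t) = lift mulB t := ext_fun fun f g => by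
    rw [← (hε.left f g).1]
    simp
  obtain ⟨e, he⟩ := Q.exists_φ_eq_one
  ext a
  have h2 : sliceLeft ε (a ⊠ e) = sliceLeft Q.counit (a ⊠ e) := by
    rw [← Q.γr_γrInv (a ⊠ e), h1, counit_γr]
  simpa [he] using congrArg Q.φ h2

/-! ### The antipode -/

/-- The map `f ⊗ g ↦ S(f) g`, constructed from the inverse of `γr`. -/
def antipodeMul : BLin (BTensor H H) H := (sliceLeft Q.counit).comp Q.γrInv

/-- The map `f ⊗ g ↦ f S(g)`, constructed from the inverse of `ρl`. -/
def mulAntipode : BLin (BTensor H H) H := (sliceRight Q.counit).comp Q.ρlInv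

/-- The map `g ⊗ f ↦ S⁻¹(f) g`, constructed from the inverse of `γl`. -/
def antipodeInvMul : BLin (BTensor H H) H := (sliceLeft Q.counit).comp Q.γlInv

theorem antipodeMul_γr (t : BTensor H H) : Q.antipodeMul (Q.γr t) = sliceLeft Q.counit t := by
  simp [antipodeMul]

theorem mulAntipode_ρl (t : BTensor H H) : Q.mulAntipode (Q.ρl t) = sliceRight Q.counit t := by
  simp [mulAntipode]

theorem antipodeInvMul_γl (t : BTensor H H) :
    Q.antipodeInvMul (Q.γl t) = sliceLeft Q.counit t := by
  simp [antipodeInvMul]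

theorem antipodeMul_rmulSnd (b : H) (w : BTensor H H) :
    Q.antipodeMul (rmulSnd b w) = Q.antipodeMul w * b := by
  obtain ⟨t, rfl⟩ : ∃ t, Q.γr t = w := ⟨_, Q.γr_γrInv w⟩
  revert t
  refine ext_fun fun f g => ?_
  rw [← γr_mul_right, antipodeMul_γr, antipodeMul_γr]
  simp [smul_mul_assoc]

/-- Informally S(h₁p)h₂q = S(p)S(h₁)h₂q. Since S is not yet available, γr(hf ⊗ g) = Δ(h)γr(f ⊗ g)
and multiplicativity of ε are used instead. -/
theorem antipodeMul_Δ (h : H) (w : BTensor H H) :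
    Q.antipodeMul ((Q.Δ h).L w) = Q.counit h • Q.antipodeMul w := by
  obtain ⟨t, rfl⟩ : ∃ t, Q.γr t = w := ⟨_, Q.γr_γrInv w⟩
  revert t
  refine ext_fun fun f g => ?_
  rw [← γr_mul_left, antipodeMul_γr, antipodeMul_γr]
  simp [counit_mul, mul_smul]

theorem antipodeInvMul_rmulFst (b : H) (w : BTensor H H) :
    Q.antipodeInvMul (rmulFst b w) = Q.antipodeInvMul w * b := by
  obtain ⟨t, rfl⟩ : ∃ t, Q.γl t = w := ⟨_, Q.γl_γlInv w⟩
  revert t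
  refine ext_fun fun f g => ?_
  rw [← γl_mul_right, antipodeInvMul_γl, antipodeInvMul_γl]
  simp [smul_mul_assoc]

theorem antipodeInvMul_Δ (h : H) (w : BTensor H H) :
    Q.antipodeInvMul ((Q.Δ h).L w) = Q.counit h • Q.antipodeInvMul w := by
  obtain ⟨t, rfl⟩ : ∃ t, Q.γl t = w := ⟨_, Q.γl_γlInv w⟩
  revert t
  refine ext_fun fun f g => ?_
  rw [← γl_mul_left, antipodeInvMul_γl, antipodeInvMul_γl]
  simp [counit_mul, mul_smul]

/-- The antipode. -/
def antipode : BLin H H :=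
  Q.antipodeMul.comp (Q.γl.comp (tmul Q.exists_counit_eq_one.choose))

/-- The inverse of the antipode. -/
def antipodeInv : BLin H H :=
  Q.antipodeInvMul.comp (Q.γr.comp (tmul Q.exists_counit_eq_one.choose))

/-- A priori b ↦ `antipodeMul (x ⊠ b)` is only a left multiplier. Choosing ε(h) = 1 exhibits it as
multiplication by an element of H, which is the definition of S(x). -/
theorem antipodeMul_γl_mul (h x b : H) :
    Q.antipodeMul (Q.γl (h ⊠ x)) * b = Q.counit h • Q.antipodeMul (x ⊠ b) := by
  rw [← antipodeMul_rmulSnd, ← Δ_L_eq_γl, antipodeMul_Δ]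

theorem antipodeInvMul_γr_mul (h x b : H) :
    Q.antipodeInvMul (Q.γr (h ⊠ x)) * b = Q.counit h • Q.antipodeInvMul (b ⊠ x) := by
  rw [← antipodeInvMul_rmulFst, ← Δ_L_eq_γr, antipodeInvMul_Δ]

theorem antipode_mul (x b : H) : Q.antipode x * b = Q.antipodeMul (x ⊠ b) := by
  have h := Q.antipodeMul_γl_mul Q.exists_counit_eq_one.choose x b
  rwa [Q.exists_counit_eq_one.choose_spec, one_smul] at h

theorem antipodeInv_mul (x b : H) : Q.antipodeInv x * b = Q.antipodeInvMul (b ⊠ x) := by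
  have h := Q.antipodeInvMul_γr_mul Q.exists_counit_eq_one.choose x b
  rwa [Q.exists_counit_eq_one.choose_spec, one_smul] at h

theorem lift_map_antipode_id (w : BTensor H H) :
    lift mulB (map Q.antipode (BLin.id H) w) = Q.antipodeMul w := by
  revert w
  exact ext_fun fun x y => by simp [antipode_mul]

theorem antipodeMul_γl (h x : H) : Q.antipodeMul (Q.γl (h ⊠ x)) = Q.counit h • Q.antipode x :=
  Q.eq_of_mul_right fun b => by
    rw [antipodeMul_γl_mul, smul_mul_assoc, antipode_mul]

theorem antipodeInvMul_γr (h x : H) :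
    Q.antipodeInvMul (Q.γr (h ⊠ x)) = Q.counit h • Q.antipodeInv x :=
  Q.eq_of_mul_right fun b => by
    rw [antipodeInvMul_γr_mul, smul_mul_assoc, antipodeInv_mul]

/-- The antipodes obtained from γr and from ρl coincide. Contracting `leg12_ρl_γr` with
`mulAntipode` on the first two legs, followed by μ, gives `mulAntipode (a ⊠ x)` times b equal to a
times `antipodeMul (x ⊠ b)`; then b is cancelled. -/
theorem mul_antipode (a x : H) : a * Q.antipode x = Q.mulAntipode (a ⊠ x) := by
  have h1 : ∀ c w, lift mulB (map Q.mulAntipode (BLin.id H) (assocSymm (leg12 Q.ρl (c ⊠ w)))) =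
      c * sliceLeft Q.counit w := fun c => ext_fun fun p q => by
    rw [leg12_tmul, assocSymm_assoc, map_tmul, mulAntipode_ρl]
    simp [mul_smul_comm]
  have h2 : ∀ y u, lift mulB (map Q.mulAntipode (BLin.id H)
      (assocSymm (map (BLin.id H) Q.γr (assoc (u ⊠ y))))) = sliceRight Q.counit u * y := by
    intro y u
    obtain ⟨t, rfl⟩ : ∃ t, Q.ρl t = u := ⟨_, Q.ρl_ρlInv u⟩
    revert t
    refine ext_fun fun c f => ?_
    rw [← leg12_ρl_γr, h1, counit_γr, counit_ρl]
    simp [mul_assoc]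
  have h3 : ∀ w, lift mulB (map Q.mulAntipode (BLin.id H) (assocSymm (a ⊠ w))) =
      a * Q.antipodeMul w := by
    intro w
    obtain ⟨t, rfl⟩ : ∃ t, Q.γr t = w := ⟨_, Q.γr_γrInv w⟩
    revert t
    refine ext_fun fun g y => ?_
    have h4 := h2 y (a ⊠ g)
    simp only [assoc_tmul, map_tmul, BLin.id_apply] at h4
    rw [h4, antipodeMul_γr]
    simp [smul_mul_assoc, mul_smul_comm]
  refine Q.eq_of_mul_right fun b => ?_
  have h4 := h3 (x ⊠ b)
  rw [← antipode_mul] at h4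
  rw [mul_assoc, ← h4]
  simp

theorem lift_map_id_antipode (w : BTensor H H) :
    lift mulB (map (BLin.id H) Q.antipode w) = Q.mulAntipode w := by
  revert w
  exact ext_fun fun x y => by simp [mul_antipode]

/-- Evaluated on Δ(h)(x ⊗ b), `antipodeMul` is ε(h)S(x)b. Hence a right factor x in the first leg
comes out as S(x) on the left. -/
theorem antipode_map_mul (y x : H) : Q.antipode (y * x) = Q.antipode x * Q.antipode y := by
  have h : ∀ w, Q.antipodeMul (rmulFst x w) = Q.antipode x * Q.antipodeMul w := by
    intro w
    obtain ⟨t, rfl⟩ : ∃ t, Q.γr t = w := ⟨_, Q.γr_γrInv w⟩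
    revert t
    refine ext_fun fun h b => ?_
    rw [← Δ_L_eq_γr, antipodeMul_Δ, antipodeMul_γr, ← antipode_mul]
    simp [mul_smul_comm]
  refine Q.eq_of_mul_right fun c => ?_
  rw [mul_assoc, antipode_mul Q y, ← h, rmulFst_tmul, antipode_mul]

/-- On p ⊗ q this anticipates S(S⁻¹(q)p) = S(p)q. On the range of γl both sides are ε(f)S(g). -/
theorem antipode_antipodeInvMul (w : BTensor H H) :
    Q.antipode (Q.antipodeInvMul w) = Q.antipodeMul w := by
  obtain ⟨t, rfl⟩ : ∃ t, Q.γl t = w := ⟨_, Q.γl_γlInv w⟩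
  revert t
  refine ext_fun fun f g => ?_
  rw [antipodeInvMul_γl, antipodeMul_γl]
  simp

theorem antipodeInv_antipodeMul (w : BTensor H H) :
    Q.antipodeInv (Q.antipodeMul w) = Q.antipodeInvMul w := by
  obtain ⟨t, rfl⟩ : ∃ t, Q.γr t = w := ⟨_, Q.γr_γrInv w⟩
  revert t
  refine ext_fun fun f g => ?_
  rw [antipodeMul_γr, antipodeInvMul_γr]
  simp

-- The two sides agree after left multiplication by any S(b). Such factors can be cancelled because
-- c ⊗ b ↦ cS(b) maps H ⊗ H onto H: it sends ρl(c ⊗ e) to c when ε(e) = 1.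
@[simp] theorem antipode_antipodeInv (a : H) : Q.antipode (Q.antipodeInv a) = a := by
  have h1 : ∀ b, Q.antipode b * Q.antipode (Q.antipodeInv a) = Q.antipode b * a := fun b => by
    rw [← antipode_map_mul, antipodeInv_mul, antipode_antipodeInvMul, antipode_mul]
  have h2 : ∀ t, Q.mulAntipode t * Q.antipode (Q.antipodeInv a) = Q.mulAntipode t * a :=
    ext_fun fun c b => by rw [← mul_antipode, mul_assoc, h1, mul_assoc]
  refine Q.eq_of_mul_left fun c => ?_
  obtain ⟨e, he⟩ := Q.exists_counit_eq_one
  have h3 := h2 (Q.ρl (c ⊠ e))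
  rwa [mulAntipode_ρl, sliceRight_tmul, he, one_smul] at h3

/-- If S(z) = 0 then S(gz) = S(z)S(g) = 0, so `antipodeInvMul` vanishes whenever the first leg
carries a right factor z. Evaluated at γl(e ⊗ gz) with ε(e) = 1 it returns gz, so z = 0. -/
theorem antipode_injective {x y : H} (hxy : Q.antipode x = Q.antipode y) : x = y := by
  obtain ⟨e, he⟩ := Q.exists_counit_eq_one
  set z := x - y with hz
  have hSz : Q.antipode z = 0 := by rw [hz, map_sub, hxy, sub_self]
  have h1 : ∀ w, Q.antipodeInvMul (rmulFst z w) = (0 : BLin (BTensor H H) H) w := by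
    refine ext_fun fun g b => ?_
    rw [rmulFst_tmul, ← antipodeInv_antipodeMul, ← antipode_mul, antipode_map_mul, hSz]
    simp
  refine sub_eq_zero.1 (Q.eq_zero_of_mul_left z fun g => ?_)
  have h2 := h1 (Q.γl (e ⊠ g))
  rwa [← γl_mul_right, antipodeInvMul_γl, sliceLeft_tmul, he, one_smul, BLin.zero_apply] at h2

@[simp] theorem antipodeInv_antipode (a : H) : Q.antipodeInv (Q.antipode a) = a :=
  Q.antipode_injective (by rw [antipode_antipodeInv])

end BornQuantumGroup

namespace BornQuantumGroup

variable {H : Type*} [NonUnitalRing H] [Module ℂ H] [IsScalarTower ℂ H H] [SMulCommClass ℂ H H]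
  [Bornology H] [BornAlgebra H] (Q : BornQuantumGroup H)

open BTensor Multiplier

local notation:75 x:76 " ⊠ " y:75 => BTensor.tmul x y

/-! ### The antipode is a coalgebra antihomomorphism -/

/-- The pentagon equation for `γr`. -/
theorem map_γr_γr (f g y : H) : map (BLin.id H) Q.γr (assoc (Q.γr (f ⊠ g) ⊠ y)) =
    leg12 Q.γr (leg13 Q.γr (f ⊠ Q.γr (g ⊠ y))) := by
  refine Q.approximation.id_map_ext (F := fun x : H => (rmulFst x : BLin (BTensor H H) _))
    (fun t ht => Q.ext_rmulFst Q.separated fun x => by rw [ht, map_zero]) fun x => ?_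
  have h1 : ∀ u : BTensor H H, map (BLin.id H) (rmulFst x) (map (BLin.id H) Q.γr (assoc (u ⊠ y))) =
      map (BLin.id H) (Q.comulApply (x ⊠ y)) u := ext_fun fun p q => by simp [Δ_L_eq_γr]
  have h2 : ∀ w, map (BLin.id H) (rmulFst x) (leg12 Q.γr (leg13 Q.γr (f ⊠ w))) =
      leg12 Q.γr (leg13 Q.γr (f ⊠ rmulFst x w)) := ext_fun fun p q => by
    rw [rmulFst_tmul, leg13_tmul, leg13_tmul]
    generalize Q.γr (f ⊠ q) = u
    revert u
    refine ext_fun fun a b => ?_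
    rw [insertMid_tmul, insertMid_tmul, leg12_tmul, leg12_tmul, γr_mul_right]
    generalize Q.γr (a ⊠ p) = v
    revert v
    exact ext_fun fun c d => by simp
  rw [h1, h2, ← Δ_L_eq_γr, map_comulApply_γr]

/-- The version of the pentagon with (id ⊗ Δ)Δ(f) acting on 1 ⊗ Δ(g)(c ⊗ 1); a factor `y` completes
the last leg and is cancelled. -/
theorem map_γl_γr (f g c : H) : map (BLin.id H) (Q.γl.comp (tmul.flip c)) (Q.γr (f ⊠ g)) =
    leg12 Q.γr (leg13 Q.γr (f ⊠ Q.γl (g ⊠ c))) := by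
  refine Q.approximation.id_map_ext (F := fun x : H => (rmulSnd x : BLin (BTensor H H) _))
    (fun t ht => Q.ext_rmulSnd Q.separated fun x => by rw [ht, map_zero]) fun y => ?_
  have h1 : ∀ u : BTensor H H, map (BLin.id H) (rmulSnd y)
      (map (BLin.id H) (Q.γl.comp (tmul.flip c)) u) =
      map (BLin.id H) (Q.comulApply (c ⊠ y)) u := ext_fun fun p q => by simp [Δ_L_eq_γl]
  have h2 : ∀ w, map (BLin.id H) (rmulSnd y) (leg12 Q.γr (leg13 Q.γr (f ⊠ w))) =
      leg12 Q.γr (leg13 Q.γr (f ⊠ rmulSnd y w)) := ext_fun fun p q => by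
    rw [rmulSnd_tmul, leg13_tmul, leg13_tmul, γr_mul_right]
    generalize Q.γr (f ⊠ q) = u
    revert u
    refine ext_fun fun a b => ?_
    rw [rmulSnd_tmul, insertMid_tmul, insertMid_tmul, leg12_tmul, leg12_tmul]
    generalize Q.γr (a ⊠ p) = v
    revert v
    exact ext_fun fun c d => by simp
  rw [h1, h2, ← Δ_L_eq_γl, map_comulApply_γr]

/-- Informally f₁ ⊗ f₂S(f₃)S(x) = f ⊗ S(x). It makes γr⁻¹ explicit on f ⊗ S(x). Left factors `c` and
`d` turn γr into ρl, so that `leg12_ρl_ρr` and the right antipode identity apply. -/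
theorem γr_map_antipode_ρr (x f : H) :
    Q.γr (map (BLin.id H) Q.antipode (Q.ρr (x ⊠ f))) = f ⊠ Q.antipode x := by
  refine Q.ext_lmulFst Q.separated fun c => Q.ext_lmulSnd Q.separated fun d => ?_
  have h1 : ∀ w, lmulSnd d (lmulFst c (Q.γr (map (BLin.id H) Q.antipode w))) =
      map (BLin.id H) ((lift mulB).comp ((map (BLin.id H) Q.antipode).comp (lmulFst d)))
        (leg12 Q.ρl (c ⊠ w)) := ext_fun fun p q => by
    rw [map_tmul, BLin.id_apply, lmulFst_γr, leg12_tmul]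
    generalize Q.ρl (c ⊠ p) = u
    revert u
    exact ext_fun fun a b => by simp [mul_assoc]
  have h2 : ∀ q, lift mulB (map (BLin.id H) Q.antipode (lmulFst d (Q.ρr (x ⊠ q)))) =
      Q.counit q • (d * Q.antipode x) := fun q => by
    have h3 : ∀ u : BTensor H H, lift mulB (map (BLin.id H) Q.antipode (lmulSnd x u)) =
        lift mulB (map (BLin.id H) Q.antipode u) * Q.antipode x :=
      ext_fun fun a b => by simp [antipode_map_mul, mul_assoc]
    rw [← Δ_R_eq_ρr, Δ_R_eq_ρl, h3, lift_map_id_antipode, mulAntipode_ρl, sliceRight_tmul,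
      smul_mul_assoc]
  have h4 : ∀ u, map (BLin.id H) ((lift mulB).comp ((map (BLin.id H) Q.antipode).comp (lmulFst d)))
      (map (BLin.id H) (Q.ρr.comp (tmul x)) u) =
      sliceRight Q.counit u ⊠ (d * Q.antipode x) := ext_fun fun p q => by
    simp [h2]
  rw [h1, leg12_ρl_ρr, h4, counit_ρl]
  simp

/-- The antiautomorphism `(S ⊗ S) τ` of `H ⊗ H`. -/
def antipodeTensor : BLin (BTensor H H) (BTensor H H) :=
  (map Q.antipode Q.antipode).comp swap

@[simp] theorem antipodeTensor_tmul (x y : H) :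
    Q.antipodeTensor (x ⊠ y) = Q.antipode y ⊠ Q.antipode x := by
  simp [antipodeTensor]

theorem antipodeTensor_mul (s t : BTensor H H) :
    Q.antipodeTensor (s * t) = Q.antipodeTensor t * Q.antipodeTensor s := by
  revert s
  refine ext_fun fun a b => ?_
  revert t
  refine ext_fun fun c d => ?_
  simp [antipode_map_mul]

theorem antipodeTensor_surjective (t : BTensor H H) : ∃ s, Q.antipodeTensor s = t := by
  refine ⟨swap (map Q.antipodeInv Q.antipodeInv t), ?_⟩
  revert t
  exact ext_fun fun a b => by simp

/-- Uniqueness of convolution inverses. `A` sends f ⊗ s to Δ(S(f))s; `B` is designed to send it to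
(S ⊗ S)τ(Δ(f))s, but is written through γr⁻¹. On f₁ ⊗ Δ(f₂)w both give ε(f)w, for `B` by the
pentagon equation. -/
theorem Δ_antipode_L (f : H) (t : BTensor H H) :
    (Q.Δ (Q.antipode f)).L (Q.antipodeTensor t) = Q.antipodeTensor ((Q.Δ f).R t) := by
  set A : BLin (BTensor H (BTensor H H)) (BTensor H H) :=
    lift ((LB.comp Q.Δ).comp Q.antipode) with hA
  set b : BLin (BTensor (BTensor H H) H) (BTensor H H) :=
    (map (BLin.id H) Q.antipodeMul).comp (assoc.comp (map swap (BLin.id H))) with hb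
  set B : BLin (BTensor H (BTensor H H)) (BTensor H H) :=
    b.comp ((map Q.γrInv (BLin.id H)).comp assocSymm) with hB
  have hbt : ∀ p q y, b ((p ⊠ q) ⊠ y) = q ⊠ Q.antipodeMul (p ⊠ y) := fun p q y => by simp [hb]
  have hBT : ∀ T, B T = b (map Q.γrInv (BLin.id H) (assocSymm T)) := fun _ => rfl
  have h1 : ∀ f g y, A (map (BLin.id H) Q.γr (assoc (Q.γr (f ⊠ g) ⊠ y))) =
      Q.counit f • Q.γr (g ⊠ y) := fun f g y => by
    have h2 : ∀ w, A (map (BLin.id H) Q.γr (assoc (w ⊠ y))) = Q.γr (Q.antipodeMul w ⊠ y) :=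
      ext_fun fun p q => by simp [hA, ← γr_mul_left, antipode_mul]
    rw [h2, antipodeMul_γr]
    simp
  have hinv : ∀ T' : BTensor (BTensor H H) H,
      map Q.γrInv (BLin.id H) (map Q.γr (BLin.id H) T') = T' := ext_fun fun p q => by simp
  have h3 : ∀ T, map Q.γrInv (BLin.id H) (assocSymm (leg12 Q.γr T)) = assocSymm T := fun T => by
    rw [leg12, BLin.comp_apply, BLin.comp_apply, assocSymm_assoc]
    exact hinv (assocSymm T)
  have h4 : ∀ f w, B (leg12 Q.γr (leg13 Q.γr (f ⊠ w))) = Q.counit f • w := fun f =>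
    ext_fun fun x y => by
      rw [hBT, h3, leg13_tmul]
      have h5 : ∀ u, b (assocSymm (insertMid x u)) = x ⊠ Q.antipodeMul u :=
        ext_fun fun p q => by rw [insertMid_tmul, assocSymm_tmul, hbt]
      rw [h5, antipodeMul_γr]
      simp
  have hAB : ∀ T, A T = B T := by
    have h5 : ∀ T, A (map (BLin.id H) Q.γr (leg12 Q.γr T)) =
        B (map (BLin.id H) Q.γr (leg12 Q.γr T)) := by
      refine ext_fun fun f s => ?_
      revert s
      refine ext_fun fun g y => ?_
      rw [leg12_tmul, h1, map_γr_γr, h4]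
    intro T
    -- Since γr is bijective on legs 12 and on legs 23, the test elements exhaust the triple tensor
    -- product.
    have h6 := h5 (assoc (map Q.γrInv (BLin.id H) (assocSymm (map (BLin.id H) Q.γrInv T))))
    have h7 : ∀ T : BTensor H (BTensor H H),
        leg12 Q.γr (assoc (map Q.γrInv (BLin.id H) (assocSymm T))) = T := fun T => by
      rw [leg12, BLin.comp_apply, BLin.comp_apply, assocSymm_assoc]
      have h8 : ∀ T' : BTensor (BTensor H H) H,
          map Q.γr (BLin.id H) (map Q.γrInv (BLin.id H) T') = T' :=
        ext_fun fun p q => by simp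
      rw [h8, assoc_assocSymm]
    have h9 : ∀ T : BTensor H (BTensor H H),
        map (BLin.id H) Q.γr (map (BLin.id H) Q.γrInv T) = T := ext_fun fun p q => by simp
    rwa [h7, h9] at h6
  revert t
  refine ext_fun fun y x => ?_
  -- On f ⊗ S(x) the inverse of γr is (id ⊗ S)ρr(x ⊗ f), so `B` yields S(xf₂) ⊗ S(yf₁), the image of
  -- (y ⊗ x)Δ(f) under (S ⊗ S)τ.
  have h5 := hAB (f ⊠ (Q.antipode x ⊠ Q.antipode y))
  rw [hA, lift_tmul, hBT, assocSymm_tmul, map_tmul,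
    ← Q.γr_map_antipode_ρr x f, γrInv_γr] at h5
  have h6 : ∀ w, b (map (BLin.id H) Q.antipode w ⊠ BLin.id H (Q.antipode y)) =
      Q.antipodeTensor (lmulFst y w) := ext_fun fun p q => by
    simp [hbt, ← antipode_mul, antipode_map_mul]
  rw [h6, ← Δ_R_eq_ρr] at h5
  rw [antipodeTensor_tmul]
  exact h5

/-- Follows from `Δ_antipode_L` by moving the multiplier across a product, as (S ⊗ S)τ is a
surjective antihomomorphism. -/
theorem Δ_antipode_R (f : H) (t : BTensor H H) :
    (Q.Δ (Q.antipode f)).R (Q.antipodeTensor t) = Q.antipodeTensor ((Q.Δ f).L t) := by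
  refine Q.tensor_ext_right fun z => ?_
  obtain ⟨s, rfl⟩ := Q.antipodeTensor_surjective z
  rw [← Multiplier.mul_L, Δ_antipode_L, ← antipodeTensor_mul, ← antipodeTensor_mul,
    Multiplier.mul_L]

theorem isAntipode_antipode : Q.IsAntipode Q.counit Q.antipode where
  isIso := ⟨Q.antipodeInv, Q.antipodeInv_antipode, Q.antipode_antipodeInv⟩
  map_mul := Q.antipode_map_mul
  comul f := ⟨Q.Δ_antipode_L f, Q.Δ_antipode_R f⟩
  left t := by rw [lift_map_antipode_id, antipodeMul_γr]
  right t := by rw [lift_map_id_antipode, mulAntipode_ρl]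

/-- The first antipode identity alone determines S(a)b, through γr⁻¹(a ⊗ b). -/
theorem IsAntipode.eq_antipode {S : BLin H H} (hS : Q.IsAntipode Q.counit S) :
    S = Q.antipode := by
  ext a
  refine Q.eq_of_mul_right fun b => ?_
  have h := hS.left (Q.γrInv (a ⊠ b))
  rw [γr_γrInv, map_tmul, lift_tmul] at h
  rw [antipode_mul]
  exact h

/-! ### The modular element -/

theorem γl_antipode (f x : H) :
    Q.γl (Q.antipode f ⊠ Q.antipode x) = Q.antipodeTensor (Q.ρr (x ⊠ f)) := by
  refine Q.ext_rmulSnd Q.separated fun b => ?_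
  obtain ⟨y, rfl⟩ : ∃ y, Q.antipode y = b := ⟨_, Q.antipode_antipodeInv b⟩
  have h : ∀ w, rmulSnd (Q.antipode y) (Q.antipodeTensor w) = Q.antipodeTensor (lmulFst y w) :=
    ext_fun fun p q => by simp [antipode_map_mul]
  rw [h, ← Δ_L_eq_γl, ← antipodeTensor_tmul, Δ_antipode_L, Δ_R_eq_ρr]

/-- The right Haar functional `φ S`. -/
def ψ : BLin H ℂ := Q.φ.comp Q.antipode

/-- Right invariance of ψ: under S, by `γl_antipode`, it becomes left invariance of φ at S(f). -/
theorem sliceLeft_ψ_ρr (x f : H) : sliceLeft Q.ψ (Q.ρr (x ⊠ f)) = Q.ψ f • x := by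
  refine Q.antipode_injective ?_
  have h : ∀ w, Q.antipode (sliceLeft Q.ψ w) = sliceRight Q.φ (Q.antipodeTensor w) :=
    ext_fun fun p q => by simp [ψ]
  rw [h, ← γl_antipode, (Q.left_invariant _ _).1, map_smul]
  rfl

theorem sliceLeft_ψ_γr (f g : H) : sliceLeft Q.ψ (Q.γr (f ⊠ g)) = Q.ψ f • g := by
  refine Q.eq_of_mul_left fun x => ?_
  rw [← sliceLeft_lmulSnd, lmulSnd_γr, sliceLeft_rmulSnd, sliceLeft_ψ_ρr, smul_mul_assoc,
    mul_smul_comm]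

/-- Strong left invariance of the Haar functional. -/
theorem antipode_sliceRight_γr (f g : H) :
    Q.antipode (sliceRight Q.φ (Q.γr (f ⊠ g))) = sliceRight Q.φ (Q.ρr (f ⊠ g)) := by
  refine Q.eq_of_mul_right fun c => ?_
  -- `G` is p ⊗ q ⊗ r ↦ φ(r)S(p)q, applied to both sides of `map_γl_γr`. Left invariance makes one
  -- side S(f₁φ(f₂g))c; on the other S(f₁)f₂ collapses and leaves g₁cφ(fg₂).
  set G : BLin (BTensor H (BTensor H H)) H :=
    Q.antipodeMul.comp (map (BLin.id H) (sliceRight Q.φ)) with hG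
  have h1 : ∀ w, G (map (BLin.id H) (Q.γl.comp (tmul.flip c)) w) =
      Q.antipode (sliceRight Q.φ w) * c := ext_fun fun p q => by
    simp [hG, (Q.left_invariant _ _).1, smul_mul_assoc, antipode_mul]
  have h2 : ∀ v, G (leg12 Q.γr (leg13 Q.γr (f ⊠ v))) = sliceRight Q.φ (lmulSnd f v) :=
    ext_fun fun x y => by
      rw [leg13_tmul]
      have h3 : ∀ u, G (leg12 Q.γr (insertMid x u)) = Q.φ (sliceLeft Q.counit u) • x :=
        ext_fun fun a b => by
          rw [insertMid_tmul, leg12_tmul]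
          have h4 : ∀ v, G (assoc (v ⊠ b)) = Q.φ b • Q.antipodeMul v :=
            ext_fun fun p q => by simp [hG]
          rw [h4, antipodeMul_γr]
          simp [mul_smul, smul_comm (Q.φ b)]
      rw [h3, counit_γr]
      simp
  rw [← h1, map_γl_γr, h2, lmulSnd_γl, sliceRight_rmulFst]

/-- Strong left invariance replaces the outer φ by ψ; exchanging the slices, right invariance of ψ
applies. -/
theorem φ_sliceLeft_ρr (f g : H) : Q.φ (sliceLeft Q.φ (Q.ρr (f ⊠ g))) = Q.ψ f * Q.φ g := by
  have h1 : ∀ w : BTensor H H, Q.φ (sliceLeft Q.φ w) = Q.φ (sliceRight Q.φ w) :=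
    ext_fun fun p q => by simp [mul_comm]
  have h2 : ∀ w : BTensor H H, Q.ψ (sliceRight Q.φ w) = Q.φ (sliceLeft Q.ψ w) :=
    ext_fun fun p q => by simp [mul_comm]
  rw [h1, ← antipode_sliceRight_γr]
  change Q.ψ (sliceRight Q.φ (Q.γr (f ⊠ g))) = _
  rw [h2, sliceLeft_ψ_γr, map_smul, smul_eq_mul]

/-- Paired with any f through φ, the slice gives ψ(fh)φ(g), which sees g only through φ(g).
Faithfulness concludes. -/
theorem sliceLeft_φ_ρr (h g e : H) (he : Q.φ e = 1) :
    sliceLeft Q.φ (Q.ρr (h ⊠ g)) = Q.φ g • sliceLeft Q.φ (Q.ρr (h ⊠ e)) := by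
  rw [← sub_eq_zero]
  refine Q.faithful.2 _ fun f => ?_
  rw [mul_sub, mul_smul_comm, map_sub, map_smul, ← sliceLeft_lmulSnd, ← sliceLeft_lmulSnd,
    ← ρr_mul_left, ← ρr_mul_left, φ_sliceLeft_ρr, φ_sliceLeft_ρr, he, smul_eq_mul]
  ring

theorem mul_sliceLeft_γr (ω : BLin H ℂ) (x f g : H) :
    x * sliceLeft ω (Q.γr (f ⊠ g)) = sliceLeft ω (Q.ρr (x ⊠ f)) * g := by
  rw [← sliceLeft_lmulSnd, lmulSnd_γr, sliceLeft_rmulSnd]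

/-- The slice `(ω ⊗ id) Δ(f)`. -/
def leftSlice (ω : BLin H ℂ) (f : H) : Multiplier H where
  L := (sliceLeft ω).comp (Q.γr.comp (tmul f))
  R := (sliceLeft ω).comp (Q.ρr.comp (tmul.flip f))
  L_mul a b := by
    simp only [BLin.comp_apply]
    rw [γr_mul_right, sliceLeft_rmulSnd]
  R_mul a b := by
    simp only [BLin.comp_apply, BLin.flip_apply]
    rw [ρr_mul_left, sliceLeft_lmulSnd]
  mul_L a b := Q.mul_sliceLeft_γr ω a f b

/-- `sliceLeft_φ_ρr` is the claim for right multiplication; the left one follows by moving the slice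
across a product. -/
theorem isModularElement_leftSlice {e : H} (he : Q.φ e = 1) :
    Q.IsModularElement (Q.leftSlice Q.φ e) := by
  refine fun f g => ⟨Q.eq_of_mul_left fun x => ?_, (Q.sliceLeft_φ_ρr g f e he).symm⟩
  rw [mul_sliceLeft_γr, Q.sliceLeft_φ_ρr x f e he, smul_L, mul_smul_comm, smul_mul_assoc,
    Multiplier.mul_L]
  rfl

theorem IsModularElement.eq {δ δ' : Multiplier H} (h : Q.IsModularElement δ)
    (h' : Q.IsModularElement δ') : δ = δ' := by
  obtain ⟨e, he⟩ := Q.exists_φ_eq_one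
  have h1 := h e
  have h2 := h' e
  rw [he, one_smul] at h1 h2
  exact Multiplier.ext (fun a => (h1 a).1.trans (h2 a).1.symm)
    fun a => (h1 a).2.trans (h2 a).2.symm

/-! ### Group-likeness of the modular element. -/

section Modular

variable {Q} {δ : Multiplier H}

theorem IsModularElement.isLeftSlice (hδ : Q.IsModularElement δ) {e : H} (he : Q.φ e = 1) :
    Q.IsLeftSlice Q.φ e δ := by
  have h := hδ e
  rwa [he, one_smul] at h

/-- Write δa as (φ ⊗ id)(Δ(e)(1 ⊗ a)) and apply Δ. By `map_comulApply_γr` this slices γr₁₂γr₁₃(e ⊗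
Δ(a)t) in the first leg: slicing γr₁₂ yields one δ and leaves φ in the first leg, slicing γr₁₃
yields the other. -/
theorem IsModularElement.Δ_L (hδ : Q.IsModularElement δ) (a : H) (t : BTensor H H) :
    (Q.Δ (δ.L a)).L t = (tensor δ δ).L ((Q.Δ a).L t) := by
  obtain ⟨e, he⟩ := Q.exists_φ_eq_one
  have h1 : ∀ u : BTensor H H, sliceLeft Q.φ (map (BLin.id H) (Q.comulApply t) u) =
      Q.comulApply t (sliceLeft Q.φ u) := ext_fun fun p q => by simp
  have h2 : ∀ s, sliceLeft Q.φ (leg12 Q.γr (leg13 Q.γr (e ⊠ s))) = (tensor δ δ).L s :=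
    ext_fun fun x y => by
      have h3 : ∀ u : BTensor H H, sliceLeft Q.φ (leg12 Q.γr (insertMid x u)) =
          δ.L x ⊠ sliceLeft Q.φ u := ext_fun fun p q => by
        have h4 : ∀ v : BTensor H H, sliceLeft Q.φ (assoc (v ⊠ q)) = sliceLeft Q.φ v ⊠ q :=
          ext_fun fun a b => by simp
        rw [insertMid_tmul, leg12_tmul, h4, ← (hδ p x).1]
        simp
      rw [leg13_tmul, h3, ← (hδ.isLeftSlice he y).1, tensor_L, map_tmul]
  rw [← h2, ← map_comulApply_γr, h1, ← (hδ.isLeftSlice he a).1, comulApply_apply]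

theorem tensor_multiplier_ext (Q : BornQuantumGroup H) {m n : Multiplier (BTensor H H)}
    (h : ∀ t, m.L t = n.L t) : m = n :=
  Multiplier.ext h fun s => Q.tensor_ext_right fun z => by
    rw [← Multiplier.mul_L, h, Multiplier.mul_L]

theorem multiplier_ext (Q : BornQuantumGroup H) {m n : Multiplier H}
    (h : ∀ t, m.L t = n.L t) : m = n :=
  Multiplier.ext h fun s => Q.eq_of_mul_right fun z => by
    rw [← Multiplier.mul_L, h, Multiplier.mul_L]

/-- Only left multiplication has to be computed: an extension exists by essentiality, and by
nondegeneracy its left part identifies it with δ ⊗ δ. -/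
theorem IsModularElement.extendsAt_Δ (hδ : Q.IsModularElement δ) :
    ExtendsAt Q.Δ δ (tensor δ δ) := by
  obtain ⟨n, hn, -⟩ := Q.comul.essential.existsUnique_extendsAt δ
  have h : n = tensor δ δ := Q.tensor_multiplier_ext
    (Q.comul_ext fun a t => by rw [hn.1, hδ.Δ_L])
  rwa [← h]

/-- The slices by φ and ε commute, and (id ⊗ ε)(Δ(e)(1 ⊗ a)) = ε(a)e with φ(e) = 1. -/
theorem IsModularElement.counit_L (hδ : Q.IsModularElement δ) (a : H) :
    Q.counit (δ.L a) = Q.counit a := by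
  obtain ⟨e, he⟩ := Q.exists_φ_eq_one
  have h : ∀ u : BTensor H H, Q.counit (sliceLeft Q.φ u) = Q.φ (sliceRight Q.counit u) :=
    ext_fun fun p q => by simp [mul_comm]
  rw [(hδ.isLeftSlice he a).1, h, sliceRight_counit_γr]
  simp [he]

theorem IsModularElement.counit_R (hδ : Q.IsModularElement δ) (a : H) :
    Q.counit (δ.R a) = Q.counit a := by
  obtain ⟨e, he⟩ := Q.exists_φ_eq_one
  have h : ∀ u : BTensor H H, Q.counit (sliceLeft Q.φ u) = Q.φ (sliceRight Q.counit u) :=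
    ext_fun fun p q => by simp [mul_comm]
  rw [(hδ.isLeftSlice he a).2, h, sliceRight_counit_ρr]
  simp [he]

theorem IsModularElement.extendsAt_counit (hδ : Q.IsModularElement δ) :
    ExtendsAt ((ι ℂ).comp Q.counit) δ 1 := by
  refine ⟨fun a b => ?_, fun a b => ?_⟩
  · rw [BLin.comp_apply, BLin.comp_apply, hδ.counit_L, one_L]
  · rw [BLin.comp_apply, BLin.comp_apply, hδ.counit_R, one_R]

/-- Group-likeness gives (δ ⊗ δ)γr(f ⊗ g) = γr(δf ⊗ g), and ε(δf) = ε(f), so `antipodeMul` does not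
notice δ ⊗ δ. This is S(δ)δ = 1 with test elements; `mul_antipode_R` does the same for δS(δ) = 1. -/
theorem IsModularElement.antipode_mul_L (hδ : Q.IsModularElement δ) (a b : H) :
    Q.antipode (δ.L a) * δ.L b = Q.antipode a * b := by
  have h : ∀ w, Q.antipodeMul ((tensor δ δ).L w) = Q.antipodeMul w := by
    intro w
    obtain ⟨t, rfl⟩ : ∃ t, Q.γr t = w := ⟨_, Q.γr_γrInv w⟩
    revert t
    refine ext_fun fun f g => ?_
    have h1 : (tensor δ δ).L (Q.γr (f ⊠ g)) = Q.γr (δ.L f ⊠ g) :=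
      Q.tensor_ext_right fun z => by
        rw [← Multiplier.L_mul, γr_mul, γr_mul, hδ.Δ_L]
    rw [h1, antipodeMul_γr, antipodeMul_γr]
    simp [hδ.counit_L]
  have h1 := h (a ⊠ b)
  rwa [tensor_L, map_tmul, ← antipode_mul, ← antipode_mul] at h1

theorem IsModularElement.mul_antipode_R (hδ : Q.IsModularElement δ) (a b : H) :
    δ.R a * Q.antipode (δ.R b) = a * Q.antipode b := by
  have h : ∀ w, Q.mulAntipode ((tensor δ δ).R w) = Q.mulAntipode w := by
    intro w
    obtain ⟨t, rfl⟩ : ∃ t, Q.ρl t = w := ⟨_, Q.ρl_ρlInv w⟩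
    revert t
    refine ext_fun fun f g => ?_
    have h1 : (tensor δ δ).R (Q.ρl (f ⊠ g)) = Q.ρl (f ⊠ δ.R g) :=
      Q.tensor_ext_left fun z => by
        rw [← Multiplier.R_mul, mul_ρl, mul_ρl, hδ.extendsAt_Δ.2]
    rw [h1, mulAntipode_ρl, mulAntipode_ρl]
    simp [hδ.counit_R]
  have h1 := h (a ⊠ b)
  rwa [tensor_R, map_tmul, ← mul_antipode, ← mul_antipode] at h1

end Modular

/-! ### The antipode on multipliers and the inverse of the modular element. -/

theorem antipodeInv_map_mul (a b : H) :
    Q.antipodeInv (a * b) = Q.antipodeInv b * Q.antipodeInv a :=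
  Q.antipode_injective (by simp [antipode_map_mul])

/-- The extension of the antipode to multipliers. -/
def antipodeMultiplier (m : Multiplier H) : Multiplier H where
  L := Q.antipode.comp (m.R.comp Q.antipodeInv)
  R := Q.antipode.comp (m.L.comp Q.antipodeInv)
  L_mul a b := by simp [antipodeInv_map_mul, m.R_mul, antipode_map_mul]
  R_mul a b := by simp [antipodeInv_map_mul, m.L_mul, antipode_map_mul]
  mul_L a b := by
    obtain ⟨a, rfl⟩ : ∃ x, Q.antipode x = a := ⟨_, Q.antipode_antipodeInv a⟩
    obtain ⟨b, rfl⟩ : ∃ x, Q.antipode x = b := ⟨_, Q.antipode_antipodeInv b⟩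
    simp only [BLin.comp_apply, antipodeInv_antipode]
    rw [← antipode_map_mul, ← antipode_map_mul, m.mul_L]

theorem antiExtendsAt_antipodeMultiplier (m : Multiplier H) :
    AntiExtendsAt Q.antipode m (Q.antipodeMultiplier m) :=
  ⟨fun a => by simp [antipodeMultiplier], fun a => by simp [antipodeMultiplier]⟩

theorem IsModularElement.antipodeMultiplier_mul {δ : Multiplier H} (hδ : Q.IsModularElement δ) :
    Q.antipodeMultiplier δ * δ = 1 := by
  refine Q.multiplier_ext fun b => Q.eq_of_mul_left fun x => ?_
  obtain ⟨a, rfl⟩ : ∃ a, Q.antipode a = x := ⟨_, Q.antipode_antipodeInv x⟩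
  rw [mul_L_apply, Multiplier.mul_L, (Q.antiExtendsAt_antipodeMultiplier δ).2,
    hδ.antipode_mul_L, one_L]

theorem IsModularElement.mul_antipodeMultiplier {δ : Multiplier H} (hδ : Q.IsModularElement δ) :
    δ * Q.antipodeMultiplier δ = 1 := by
  refine Q.multiplier_ext fun y => Q.eq_of_mul_left fun x => ?_
  obtain ⟨b, rfl⟩ : ∃ b, Q.antipode b = y := ⟨_, Q.antipode_antipodeInv y⟩
  rw [mul_L_apply, Multiplier.mul_L, (Q.antiExtendsAt_antipodeMultiplier δ).1,
    hδ.mul_antipode_R, one_L]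

end BornQuantumGroup

end BornQG

end

/-! ### The main theorem. -/

open BornQG
theorem mainTheorem9 {H : Type*} [NonUnitalRing H] [Module ℂ H] [IsScalarTower ℂ H H]
    [SMulCommClass ℂ H H] [Bornology H] [BornAlgebra H] (Q : BornQuantumGroup H) :
    (∃! p : BLin H ℂ × BLin H H, Q.IsCounit p.1 ∧ Q.IsAntipode p.1 p.2) ∧
    (∃! δ : Multiplier H, Q.IsModularElement δ) ∧
    ∀ (ε : BLin H ℂ) (S : BLin H H) (δ : Multiplier H),
      Q.IsCounit ε → Q.IsAntipode ε S → Q.IsModularElement δ →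
        ∃ u : (Multiplier H)ˣ, (u : Multiplier H) = δ ∧
          ExtendsAt Q.Δ δ (Multiplier.tensor δ δ) ∧
          ExtendsAt ((Multiplier.ι ℂ).comp ε) δ 1 ∧
          AntiExtendsAt S δ ((u⁻¹ : (Multiplier H)ˣ) : Multiplier H) := by
  refine ⟨⟨(Q.counit, Q.antipode), ⟨Q.isCounit_counit, Q.isAntipode_antipode⟩, ?_⟩, ?_, ?_⟩
  · rintro ⟨ε, S⟩ ⟨hε, hS⟩
    obtain rfl := hε.eq_counit
    obtain rfl := hS.eq_antipode
    rfl
  · obtain ⟨e, he⟩ := Q.exists_φ_eq_one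
    exact ⟨_, Q.isModularElement_leftSlice he, fun δ hδ =>
      hδ.eq Q (Q.isModularElement_leftSlice he)⟩
  · intro ε S δ hε hS hδ
    obtain rfl := hε.eq_counit
    obtain rfl := hS.eq_antipode
    exact ⟨⟨δ, Q.antipodeMultiplier δ, hδ.mul_antipodeMultiplier, hδ.antipodeMultiplier_mul⟩, rfl,
      hδ.extendsAt_Δ, hδ.extendsAt_counit, Q.antiExtendsAt_antipodeMultiplier δ⟩
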